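/- Let $d\ge 2$ and $p,q\in[1,\infty]$ with $1/p+1/q<2/d$ and $(d,q)\ne(2,\infty)$. Put $p^*=p/(p-1)$ ($p^*=1$ if $p=\infty$), $\rho=\frac{2qd}{q(d-2)+d}$ ($\rho=\frac{2d}{d-2}$ if $q=\infty$) and $\nu=2-2p^*/\rho$. There is a constant $C_4>0$ depending only on $p,q,d$ such that the following holds. **Coefficients.** Let $a:\mathbb R^d\to\mathbb R^{d\times d}$ be a measurable field of symmetric matrices and $\lambda,\Lambda:\mathbb R^d\to[0,\infty)$ measurable with $\lambda(x)|\xi|^2\le\langle a(x)\xi,\xi\rangle\le\Lambda(x)|\xi|^2$ for almost every $x$ and all $\xi\in\mathbb R^d$. For a ball $B$ write $\|f\|_{p,B}=\big(|B|^{-1}\int_B|f|^p\,dx\big)^{1/p}$ (the essential supremum of $|f|$ on $B$ if $p=\infty$), and assume $\limsup_{R\to\infty}\big(\|\Lambda\|_{p,B(0,R)}+\|\lambda^{-1}\|_{q,B(0,R)}\big)<\infty$, with $1/0=\infty$. Let $C_S^{B,\Lambda}=\|\lambda^{-1}\|_{q,B}\,\|\Lambda\|_{p,B}^{2p^*/\rho}$.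 **Supercaloric functions.** Let $\mathcal E(u,v)=\sum_{i,j}\int_{\mathbb R^d}a_{ij}\,\partial_iu\,\partial_jv\,dx$ and $(u,v)_\Lambda=\int uv\,\Lambda\,dx$. For open $G\subset\mathbb R^d$ let $\mathcal F_G^\Lambda$ be the closure of $C_0^\infty(G)$ in $L^2(\Lambda\,dx)$ with respect to $\mathcal E+(\cdot,\cdot)_\Lambda$, with $\mathcal E$ extended by continuity (the form is closable); put $\mathcal F^\Lambda=\mathcal F^\Lambda_{\mathbb R^d}$. For an open interval $I$, a map $u:I\to\mathcal F^\Lambda$ is supercaloric in $I\times G$ if $t\mapsto\int_G u(t,\cdot)\,\phi\,\Lambda\,dx$ is differentiable on $I$ for every $\phi\in L^2(G,\Lambda\,dx)$, and $\frac{d}{dt}(u(t,\cdot),\phi)_\Lambda+\mathcal E(u(t,\cdot),\phi)\ge0$ for all $t\in I$ and all $\phi\in\mathcal F_G^\Lambda$ with $\phi\ge0$. **Claim.** Let $\tau,r>0$, $s\in\mathbb R$, $x\in\mathbb R^d$, $1/2\le\sigma'<\sigma\le1$, $B=B(x,r)$, $Q_\delta=(s-\delta\tau r^2,s)\times B(x,\delta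 r)$ and $Q=Q_1$. Let $u$ be supercaloric in $Q$ and positive there, i.e. for every $t\in(s-\tau r^2,s)$, $u(t,\cdot)>0$ almost everywhere on $B$. Then for every $\alpha\in(0,\infty)$ $$\sup_{Q_{\sigma'}}u(t,z)^{-\alpha}\;\le\;C_4\,\big(C_S^{B,\Lambda}\big)^{\frac1{\nu-1}}\;\tau\left[\frac{1+\tau^{-1}}{(\sigma-\sigma')^2}\right]^{\frac{\nu}{\nu-1}}\|u^{-1}\|^{\alpha}_{\alpha,Q_\sigma,\Lambda},$$ where, for $I'\times B'=Q_\sigma$, $\|f\|_{\alpha,Q_\sigma,\Lambda}=\Big(\frac1{|I'|\,|B'|}\int_{I'}\int_{B'}|f(t,z)|^\alpha\Lambda(z)\,dz\,dt\Big)^{1/\alpha}\in[0,\infty]$, and the supremum is over all times of the essential suprema in space. -/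

import Mathlib

open MeasureTheory Set Filter Topology
open scoped ENNReal

noncomputable section

namespace DegenerateParabolic

/-- The bilinear form `⟨A ξ, η⟩ = ∑ A i j * ξ i * η j` of a matrix. -/
def bil {d : ℕ} (A : Matrix (Fin d) (Fin d) ℝ) (ξ η : EuclideanSpace ℝ (Fin d)) : ℝ :=
  ∑ i, ∑ j, A i j * ξ i * η j

/-- The normalized Lebesgue measure `|B|⁻¹ 1_B dx` on the ball `B = B(x, r)`. Then
`eLpNorm f p (ballAvg x r)` is the averaged norm `‖f‖_{p,B}`. -/
def ballAvg {d : ℕ} (x : EuclideanSpace ℝ (Fin d)) (r : ℝ) :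
    Measure (EuclideanSpace ℝ (Fin d)) :=
  (volume (Metric.ball x r))⁻¹ • volume.restrict (Metric.ball x r)

/-- The measure `θ dx`. -/
def weighted {d : ℕ} (θ : EuclideanSpace ℝ (Fin d) → ℝ) : Measure (EuclideanSpace ℝ (Fin d)) :=
  volume.withDensity (fun x => ENNReal.ofReal (θ x))

/-- `1 / f` as a function with values in `[0, ∞]`, with `1 / 0 = ∞`. -/
def recip {d : ℕ} (f : EuclideanSpace ℝ (Fin d) → ℝ) (x : EuclideanSpace ℝ (Fin d)) : ℝ≥0∞ :=
  (ENNReal.ofReal (f x))⁻¹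

/-- The coefficients: `a` is a measurable field of symmetric matrices, and
`lam |ξ|² ≤ ⟨a ξ, ξ⟩ ≤ Lam |ξ|²` almost everywhere, with measurable non-negative `lam`, `Lam`. -/
structure IsEllipticField {d : ℕ} (a : EuclideanSpace ℝ (Fin d) → Matrix (Fin d) (Fin d) ℝ)
    (lam Lam : EuclideanSpace ℝ (Fin d) → ℝ) : Prop where
  measurable_a : ∀ i j, Measurable (fun x => a x i j)
  symm : ∀ x, (a x).IsSymm
  measurable_lam : Measurable lam
  measurable_Lam : Measurable Lam
  lam_nonneg : ∀ x, 0 ≤ lam x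
  Lam_nonneg : ∀ x, 0 ≤ Lam x
  bounds : ∀ᵐ x, ∀ ξ : EuclideanSpace ℝ (Fin d),
    lam x * ‖ξ‖ ^ 2 ≤ bil (a x) ξ ξ ∧ bil (a x) ξ ξ ≤ Lam x * ‖ξ‖ ^ 2

/-- The moment condition: the averaged norms `‖Lam‖_{p,B(0,R)}` and `‖1/lam‖_{q,B(0,R)}` stay
bounded as `R → ∞`. For finite `p`, `q` this says that
`limsup |B(0,R)|⁻¹ ∫_{B(0,R)} (Lam^p + lam^{-q}) dx < ∞`. -/
def MomentCondition {d : ℕ} (p q : ℝ≥0∞) (lam Lam : EuclideanSpace ℝ (Fin d) → ℝ) : Prop :=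
  limsup (fun R : ℝ => eLpNorm Lam p (ballAvg 0 R) + eLpNorm (recip lam) q (ballAvg 0 R)) atTop < ∞

/-- `φ ∈ C_0^∞(G)`. -/
structure IsTest {d : ℕ} (G : Set (EuclideanSpace ℝ (Fin d)))
    (φ : EuclideanSpace ℝ (Fin d) → ℝ) : Prop where
  smooth : ContDiff ℝ (⊤ : ℕ∞) φ
  compact : HasCompactSupport φ
  support : tsupport φ ⊆ G

/-- `u` is in the closure of `C_0^∞(G)` in `L²(θ dx)` with respect to `𝓔 + (·,·)_θ`, and `g` is
its gradient: some `φ n ∈ C_0^∞(G)` converge to `u` in `L²(θ dx)` while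
`∫ ⟨a (∇φ n - g), ∇φ n - g⟩ dx → 0`. -/
structure HasFormGradient {d : ℕ} (a : EuclideanSpace ℝ (Fin d) → Matrix (Fin d) (Fin d) ℝ)
    (θ : EuclideanSpace ℝ (Fin d) → ℝ) (G : Set (EuclideanSpace ℝ (Fin d)))
    (u : EuclideanSpace ℝ (Fin d) → ℝ)
    (g : EuclideanSpace ℝ (Fin d) → EuclideanSpace ℝ (Fin d)) : Prop where
  memLp : MemLp u 2 (weighted θ)
  measurable_grad : AEStronglyMeasurable g volume
  approx : ∃ φ : ℕ → EuclideanSpace ℝ (Fin d) → ℝ,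
    (∀ n, IsTest G (φ n)) ∧
    Tendsto (fun n => eLpNorm (fun x => φ n x - u x) 2 (weighted θ)) atTop (𝓝 0) ∧
    Tendsto (fun n => ∫⁻ x,
      ENNReal.ofReal (bil (a x) (gradient (φ n) x - g x) (gradient (φ n) x - g x))) atTop (𝓝 0)

/-- The form domain `𝓕_G^θ`; `𝓕^θ` is the case `G = univ`. -/
def FormDomain {d : ℕ} (a : EuclideanSpace ℝ (Fin d) → Matrix (Fin d) (Fin d) ℝ)
    (θ : EuclideanSpace ℝ (Fin d) → ℝ) (G : Set (EuclideanSpace ℝ (Fin d))) :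
    Set (EuclideanSpace ℝ (Fin d) → ℝ) :=
  {u | ∃ g, HasFormGradient a θ G u g}

open Classical in
/-- The gradient `∇u` of `u ∈ 𝓕^θ` (`0` outside of `𝓕^θ`). It is unique up to null sets when
`1/lam` and `1/θ` are locally integrable (closability of the form). -/
def formGrad {d : ℕ} (a : EuclideanSpace ℝ (Fin d) → Matrix (Fin d) (Fin d) ℝ)
    (θ : EuclideanSpace ℝ (Fin d) → ℝ) (u : EuclideanSpace ℝ (Fin d) → ℝ) :
    EuclideanSpace ℝ (Fin d) → EuclideanSpace ℝ (Fin d) :=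
  if h : ∃ g, HasFormGradient a θ univ u g then h.choose else 0

/-- The Dirichlet form `𝓔(u, v) = ∫ ∑ a_ij ∂_i u ∂_j v dx` on `𝓕^θ`. -/
def energy {d : ℕ} (a : EuclideanSpace ℝ (Fin d) → Matrix (Fin d) (Fin d) ℝ)
    (θ : EuclideanSpace ℝ (Fin d) → ℝ) (u v : EuclideanSpace ℝ (Fin d) → ℝ) : ℝ :=
  ∫ x, bil (a x) (formGrad a θ u x) (formGrad a θ v x)

/-- `u : I → 𝓕^θ` is supercaloric in `I × G` (for open `I`, `G`): `t ↦ (u t, φ)_θ` is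
differentiable on `I` for every `φ ∈ L²(G, θ dx)`, and `d/dt (u t, φ)_θ + 𝓔(u t, φ) ≥ 0` on `I`
for every non-negative `φ ∈ 𝓕_G^θ`. -/
structure IsSupercaloric {d : ℕ} (a : EuclideanSpace ℝ (Fin d) → Matrix (Fin d) (Fin d) ℝ)
    (θ : EuclideanSpace ℝ (Fin d) → ℝ) (I : Set ℝ) (G : Set (EuclideanSpace ℝ (Fin d)))
    (u : ℝ → EuclideanSpace ℝ (Fin d) → ℝ) : Prop where
  mem_domain : ∀ t ∈ I, u t ∈ FormDomain a θ univ
  differentiable : ∀ φ : EuclideanSpace ℝ (Fin d) → ℝ,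
    MemLp φ 2 ((weighted θ).restrict G) →
    ∀ t ∈ I, DifferentiableAt ℝ (fun t' => ∫ x in G, u t' x * φ x ∂(weighted θ)) t
  inequality : ∀ φ ∈ FormDomain a θ G, (∀ᵐ x, 0 ≤ φ x) →
    ∀ t ∈ I, 0 ≤ deriv (fun t' => ∫ x in G, u t' x * φ x ∂(weighted θ)) t + energy a θ (u t) φ

/-- `p* = p / (p - 1)`, that is `1 / (1 - 1/p)`, so `p* = 1` for `p = ∞`. -/
def pStar (p : ℝ≥0∞) : ℝ := 1 / (1 - (p⁻¹).toReal)

/-- `ρ = 2 q d / (q (d - 2) + d)`, that is `2 d / (d - 2 + d/q)`, so `ρ = 2 d / (d - 2)` for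
`q = ∞`. -/
def rho (d : ℕ) (q : ℝ≥0∞) : ℝ := 2 * d / (d - 2 + d * (q⁻¹).toReal)

/-- `ν = 2 - 2 p* / ρ`. -/
def nu (d : ℕ) (p q : ℝ≥0∞) : ℝ := 2 - 2 * pStar p / rho d q

/-- `C_S^{B,Lam} = ‖1/lam‖_{q,B} ‖Lam‖_{p,B}^{2 p* / ρ}` on the ball `B = B(x, r)`. -/
def sobolevConst {d : ℕ} (p q : ℝ≥0∞) (lam Lam : EuclideanSpace ℝ (Fin d) → ℝ)
    (x : EuclideanSpace ℝ (Fin d)) (r : ℝ) : ℝ≥0∞ :=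
  eLpNorm (recip lam) q (ballAvg x r) * eLpNorm Lam p (ballAvg x r) ^ (2 * pStar p / rho d q)

/-- The time interval `I_δ = (s - δ τ r², s)` of the parabolic ball
`Q_δ = I_δ × B(x, δ r)`; `Q = Q_1`. -/
def cylTime (τ s r δ : ℝ) : Set ℝ := Ioo (s - δ * τ * r ^ 2) s

/-- The averaged space-time norm
`‖f‖_{α,I×B,θ} = (|I|⁻¹ |B|⁻¹ ∫_I ∫_B |f t x| ^ α θ(x) dx dt) ^ (1/α)`, with values in `[0, ∞]`. -/
def spaceTimeNorm {d : ℕ} (α : ℝ) (I : Set ℝ) (B : Set (EuclideanSpace ℝ (Fin d)))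
    (θ : EuclideanSpace ℝ (Fin d) → ℝ) (f : ℝ → EuclideanSpace ℝ (Fin d) → ℝ) : ℝ≥0∞ :=
  ((volume I)⁻¹ * (volume B)⁻¹ *
    ∫⁻ t in I, ∫⁻ x in B, ‖f t x‖ₑ ^ α * ENNReal.ofReal (θ x)) ^ (1 / α)

/-- The supremum over `I × B` of a family of functions defined up to null sets: the supremum over
all times in `I` of the essential suprema over `B`. -/
def spaceTimeSup {d : ℕ} (I : Set ℝ) (B : Set (EuclideanSpace ℝ (Fin d)))
    (f : ℝ → EuclideanSpace ℝ (Fin d) → ℝ) : ℝ≥0∞ :=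
  ⨆ t ∈ I, essSup (fun x => ENNReal.ofReal (f t x)) (volume.restrict B)

end DegenerateParabolic

end

noncomputable section

namespace DegenerateParabolic

/-! The proof is a Moser iteration on negative powers of `u`, carried out for the bounded functions
`(u + ε)^(-β)`, with `ε → 0` at the end.

Energy estimate: put `w = (u + ε)^(-β/2)` and let `η` be a spatial cutoff. Testing the supercaloric
inequality with `(u + ε)^(-β-1) η²` gives `d/dt ∫ w² η² Λ + 𝓔(wη, wη) ≤ 4 sup|∇η|² ∫ w² Λ`, the last
integral over a ball containing the support of `η` (`IsSupercaloric.caccioppoli`). The time term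
carries the weight `Λ` that dominates `a`, so the right side is again a `Λ`-mass, and its constant
does not depend on `β`. Integrating from a well chosen initial time (`time_step`) bounds the mass at
every later time and the time integral of the energy.

Gain of integrability: the Gagliardo–Nirenberg–Sobolev inequality and two Hölder inequalities, which
spend `1/λ ∈ L^q` and `Λ ∈ L^p`, bound `‖wη‖²` in `L^(2/(2-ν))(Λ)` by the energy (`exists_sobolev`).
Interpolating with the mass bound (`slice_nu_le`) controls the space-time integral of `(u +
ε)^(-νβ)` on a smaller cylinder by the `ν`-th power of that of `(u + ε)^(-β)`
(`IsSupercaloric.moser_step`). The condition `1/p + 1/q < 2/d` says exactly that `ν > 1`.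

Iteration: take `β = α ν^k` and radii decreasing to `σ'`. Each step also bounds the mass at each
single time, so the limit `k → ∞` gives an essential supremum at every time, not just almost every
one (`IsSupercaloric.ae_shiftPow_le`).

Two points replace regularity of `u`. In space, local integrability of `1/λ` makes form gradients
weak gradients, hence unique, and chain and product rules follow by approximation
(`HasFormGradient.comp_mul_test`). In time, weak differentiability and uniform boundedness give a
Lipschitz bound at each time, so `t ↦ ∫ F(u t) ψ Λ` is differentiable for smooth bounded `F`
(`IsWeaklyDiff.hasDerivAt_comp`). -/

abbrev Euc (d : ℕ) := EuclideanSpace ℝ (Fin d)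

/-! ### Non-negative symmetric bilinear forms. -/

section Bilinear

variable {d : ℕ}

lemma bil_add_left (A : Matrix (Fin d) (Fin d) ℝ) (ξ ξ' η : Euc d) :
    bil A (ξ + ξ') η = bil A ξ η + bil A ξ' η := by
  simp only [bil, ← Finset.sum_add_distrib, PiLp.add_apply]
  exact Finset.sum_congr rfl fun i _ => Finset.sum_congr rfl fun j _ => by ring

lemma bil_smul_left (A : Matrix (Fin d) (Fin d) ℝ) (c : ℝ) (ξ η : Euc d) :
    bil A (c • ξ) η = c * bil A ξ η := by
  simp only [bil, Finset.mul_sum, PiLp.smul_apply, smul_eq_mul]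
  exact Finset.sum_congr rfl fun i _ => Finset.sum_congr rfl fun j _ => by ring

lemma bil_comm {A : Matrix (Fin d) (Fin d) ℝ} (hA : A.IsSymm) (ξ η : Euc d) :
    bil A ξ η = bil A η ξ := by
  rw [bil, bil, Finset.sum_comm]
  exact Finset.sum_congr rfl fun i _ => Finset.sum_congr rfl fun j _ => by
    rw [hA.apply]; ring

lemma bil_add_right {A : Matrix (Fin d) (Fin d) ℝ} (ξ η η' : Euc d) :
    bil A ξ (η + η') = bil A ξ η + bil A ξ η' := by
  simp only [bil, ← Finset.sum_add_distrib, PiLp.add_apply]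
  exact Finset.sum_congr rfl fun i _ => Finset.sum_congr rfl fun j _ => by ring

lemma bil_smul_right (A : Matrix (Fin d) (Fin d) ℝ) (c : ℝ) (ξ η : Euc d) :
    bil A ξ (c • η) = c * bil A ξ η := by
  simp only [bil, Finset.mul_sum, PiLp.smul_apply, smul_eq_mul]
  exact Finset.sum_congr rfl fun i _ => Finset.sum_congr rfl fun j _ => by ring

/-- A symmetric matrix whose quadratic form is non-negative. -/
structure IsNonnegForm (A : Matrix (Fin d) (Fin d) ℝ) : Prop where
  symm : A.IsSymm
  nonneg : ∀ ξ : Euc d, 0 ≤ bil A ξ ξ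

namespace IsNonnegForm

variable {A : Matrix (Fin d) (Fin d) ℝ}

lemma two_mul_le (hA : IsNonnegForm A) (ξ η : Euc d) :
    2 * bil A ξ η ≤ bil A ξ ξ + bil A η η := by
  have h := hA.nonneg (ξ + (-1 : ℝ) • η)
  simp only [bil_add_left, bil_add_right, bil_smul_left, bil_smul_right] at h
  rw [bil_comm hA.symm η ξ] at h
  linarith

lemma two_mul_abs_le (hA : IsNonnegForm A) (ξ η : Euc d) :
    2 * |bil A ξ η| ≤ bil A ξ ξ + bil A η η := by
  have h1 := hA.two_mul_le ξ η
  have h2 := hA.two_mul_le ((-1 : ℝ) • ξ) η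
  simp only [bil_smul_left, bil_smul_right] at h2
  rcases abs_cases (bil A ξ η) with h | h <;> linarith

lemma add_le (hA : IsNonnegForm A) (ξ η : Euc d) :
    bil A (ξ + η) (ξ + η) ≤ 2 * bil A ξ ξ + 2 * bil A η η := by
  have h := hA.two_mul_le ξ η
  simp only [bil_add_left, bil_add_right]
  rw [bil_comm hA.symm η ξ]
  linarith

lemma add_three_le (hA : IsNonnegForm A) (ξ η ζ : Euc d) :
    bil A (ξ + η + ζ) (ξ + η + ζ) ≤ 3 * bil A ξ ξ + 3 * bil A η η + 3 * bil A ζ ζ := by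
  have h := hA.two_mul_le ξ η
  have h' := hA.two_mul_le ξ ζ
  have h'' := hA.two_mul_le η ζ
  simp only [bil_add_left, bil_add_right]
  rw [bil_comm hA.symm η ξ, bil_comm hA.symm ζ ξ, bil_comm hA.symm ζ η]
  linarith

end IsNonnegForm

end Bilinear

/-! ### Local integrability of the weights; the measure `Λ dx`. -/

section Weights

variable {d : ℕ} {a : Euc d → Matrix (Fin d) (Fin d) ℝ} {lam Lam : Euc d → ℝ}

lemma IsEllipticField.isNonnegForm (h : IsEllipticField a lam Lam) :
    ∀ᵐ x, IsNonnegForm (a x) := by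
  filter_upwards [h.bounds] with x hx
  exact ⟨h.symm x, fun ξ => (mul_nonneg (h.lam_nonneg x) (sq_nonneg _)).trans (hx ξ).1⟩

lemma IsEllipticField.lam_le_Lam (hd : 0 < d) (h : IsEllipticField a lam Lam) :
    ∀ᵐ x, lam x ≤ Lam x := by
  filter_upwards [h.bounds] with x hx
  have h1 := hx (EuclideanSpace.single ⟨0, hd⟩ 1)
  simp only [PiLp.norm_single, norm_one, one_pow, mul_one] at h1
  exact h1.1.trans h1.2

lemma IsEllipticField.aestronglyMeasurable_bil (h : IsEllipticField a lam Lam)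
    {μ : Measure (Euc d)} {f g : Euc d → Euc d} (hf : AEStronglyMeasurable f μ)
    (hg : AEStronglyMeasurable g μ) :
    AEStronglyMeasurable (fun x => bil (a x) (f x) (g x)) μ := by
  have hc : ∀ (k : Euc d → Euc d) (i : Fin d), AEStronglyMeasurable k μ →
      AEStronglyMeasurable (fun x => k x i) μ := fun k i hk =>
    (EuclideanSpace.proj (𝕜 := ℝ) i).continuous.comp_aestronglyMeasurable hk
  unfold bil
  refine Finset.aestronglyMeasurable_fun_sum _ fun i _ =>
    Finset.aestronglyMeasurable_fun_sum _ fun j _ => ?_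
  exact ((h.measurable_a i j).aestronglyMeasurable.mul (hc f i hf)).mul (hc g j hg)

/-- Elliptic coefficients for which `Lam` and `1 / lam` are integrable on bounded sets. -/
structure IsIntegrableField (a : Euc d → Matrix (Fin d) (Fin d) ℝ) (lam Lam : Euc d → ℝ) : Prop
    extends IsEllipticField a lam Lam where
  dim_pos : 0 < d
  lintegral_Lam : ∀ x r, ∫⁻ y in Metric.ball x r, ENNReal.ofReal (Lam y) < ∞
  lintegral_recip : ∀ x r, ∫⁻ y in Metric.ball x r, recip lam y < ∞

lemma IsEllipticField.measurable_recip (h : IsEllipticField a lam Lam) : Measurable (recip lam) :=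
  (ENNReal.measurable_ofReal.comp h.measurable_lam).inv

lemma exists_ball_zero_superset (x : Euc d) (r : ℝ) :
    ∀ᶠ R : ℝ in atTop, Metric.ball x r ⊆ Metric.ball 0 R := by
  filter_upwards [eventually_ge_atTop (r + ‖x‖)] with R hR
  exact Metric.ball_subset_ball' (by simpa using hR)

section AvgNorm

variable {ε : Type*} [TopologicalSpace ε] [ESeminormedAddMonoid ε]

lemma eLpNorm_restrict_ball (f : Euc d → ε) (p : ℝ≥0∞) (x : Euc d) {r : ℝ} (hr : 0 < r) :
    eLpNorm f p (volume.restrict (Metric.ball x r)) =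
      volume (Metric.ball x r) ^ (1 / p).toReal * eLpNorm f p (ballAvg x r) := by
  have h0 : volume (Metric.ball x r) ≠ 0 := (Metric.measure_ball_pos volume x hr).ne'
  have ht : volume (Metric.ball x r) ≠ ∞ := measure_ball_lt_top.ne
  rw [ballAvg, eLpNorm_smul_measure_of_ne_zero (ENNReal.inv_ne_zero.2 ht), smul_eq_mul,
    ← mul_assoc, ← ENNReal.mul_rpow_of_nonneg _ _ ENNReal.toReal_nonneg,
    ENNReal.mul_inv_cancel h0 ht, ENNReal.one_rpow, one_mul]

lemma eLpNorm_ballAvg (f : Euc d → ε) (p : ℝ≥0∞) (x : Euc d) (r : ℝ) :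
    eLpNorm f p (ballAvg x r) = (volume (Metric.ball x r))⁻¹ ^ (1 / p).toReal *
      eLpNorm f p (volume.restrict (Metric.ball x r)) := by
  have ht : volume (Metric.ball x r) ≠ ∞ := measure_ball_lt_top.ne
  rw [ballAvg, eLpNorm_smul_measure_of_ne_zero (ENNReal.inv_ne_zero.2 ht), smul_eq_mul]

lemma eLpNorm_restrict_ball_lt_top_of_superset {f : Euc d → ε} {p : ℝ≥0∞} {x : Euc d} {r R : ℝ}
    (hR : 0 < R) (h : eLpNorm f p (ballAvg 0 R) < ∞)
    (hsub : Metric.ball x r ⊆ Metric.ball 0 R) :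
    eLpNorm f p (volume.restrict (Metric.ball x r)) < ∞ := by
  refine (eLpNorm_mono_measure f (Measure.restrict_mono_set volume hsub)).trans_lt ?_
  rw [eLpNorm_restrict_ball f p 0 hR]
  exact ENNReal.mul_lt_top
    (ENNReal.rpow_lt_top_of_nonneg ENNReal.toReal_nonneg measure_ball_lt_top.ne) h

end AvgNorm

/-- A finite limsup makes both norms finite on all sufficiently large centred balls, and every ball
lies inside one of these. This is the only use made of the moment condition. -/
lemma MomentCondition.eLpNorm_lt_top {p q : ℝ≥0∞} (h : MomentCondition p q lam Lam)
    (x : Euc d) (r : ℝ) :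
    eLpNorm Lam p (volume.restrict (Metric.ball x r)) < ∞ ∧
      eLpNorm (recip lam) q (volume.restrict (Metric.ball x r)) < ∞ := by
  obtain ⟨R, ⟨hR1, hR2⟩, hR3⟩ := (((eventually_lt_of_limsup_lt h).and
    (exists_ball_zero_superset x r)).and (eventually_gt_atTop 0)).exists
  exact ⟨eLpNorm_restrict_ball_lt_top_of_superset hR3 (le_self_add.trans_lt hR1) hR2,
    eLpNorm_restrict_ball_lt_top_of_superset hR3 (le_add_self.trans_lt hR1) hR2⟩

lemma lintegral_lt_top_of_eLpNorm {f : Euc d → ℝ≥0∞} (hf : Measurable f) {p : ℝ≥0∞} (hp : 1 ≤ p)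
    {x : Euc d} {r : ℝ} (h : eLpNorm f p (volume.restrict (Metric.ball x r)) < ∞) :
    ∫⁻ y in Metric.ball x r, f y < ∞ := by
  have : IsFiniteMeasure (volume.restrict (Metric.ball x r)) :=
    ⟨by simpa using measure_ball_lt_top⟩
  have h1 : eLpNorm f 1 (volume.restrict (Metric.ball x r)) < ∞ := by
    refine (eLpNorm_le_eLpNorm_mul_rpow_measure_univ hp hf.aestronglyMeasurable).trans_lt
      (ENNReal.mul_lt_top h (ENNReal.rpow_lt_top_of_nonneg ?_ (measure_ne_top _ _)))
    rcases eq_or_ne p ∞ with rfl | hpt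
    · simp
    · have : 1 ≤ p.toReal := by simpa using ENNReal.toReal_mono hpt hp
      simpa using inv_le_one_of_one_le₀ this
  simpa [eLpNorm_one_eq_lintegral_enorm] using h1

lemma MomentCondition.isIntegrableField {p q : ℝ≥0∞} (hd : 0 < d) (hp : 1 ≤ p) (hq : 1 ≤ q)
    (h : MomentCondition p q lam Lam) (ha : IsEllipticField a lam Lam) :
    IsIntegrableField a lam Lam where
  toIsEllipticField := ha
  dim_pos := hd
  lintegral_Lam x r := by
    refine lintegral_lt_top_of_eLpNorm (ENNReal.measurable_ofReal.comp ha.measurable_Lam) hp ?_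
    rw [eLpNorm_congr_enorm_ae (g := Lam)]
    · exact (h.eLpNorm_lt_top x r).1
    · exact Eventually.of_forall fun y => by
        simp [Real.enorm_eq_ofReal (ha.Lam_nonneg y)]
  lintegral_recip x r := lintegral_lt_top_of_eLpNorm ha.measurable_recip hq (h.eLpNorm_lt_top x r).2

lemma ae_of_forall_ae_ball {P : Euc d → Prop}
    (h : ∀ n : ℕ, ∀ᵐ y ∂volume.restrict (Metric.ball (0 : Euc d) n), P y) : ∀ᵐ y, P y := by
  have hu : (⋃ n : ℕ, Metric.ball (0 : Euc d) n) = univ := Metric.iUnion_ball_nat 0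
  rw [← Measure.restrict_univ (μ := volume), ← hu]
  exact (ae_restrict_iUnion_iff _ _).2 h

namespace IsIntegrableField

/-- An integrable `1/λ` is finite almost everywhere, and it is infinite where `λ = 0`. -/
lemma lam_pos (h : IsIntegrableField a lam Lam) : ∀ᵐ x, 0 < lam x := by
  refine ae_of_forall_ae_ball fun n => ?_
  filter_upwards [ae_lt_top h.measurable_recip (h.lintegral_recip 0 n).ne] with y hy
  by_contra hn
  simp [recip, ENNReal.ofReal_eq_zero.2 (not_lt.1 hn)] at hy

lemma Lam_pos (h : IsIntegrableField a lam Lam) : ∀ᵐ x, 0 < Lam x := by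
  filter_upwards [h.lam_pos, h.lam_le_Lam h.dim_pos] with x h1 h2 using h1.trans_le h2

lemma measurable_ofReal_Lam (h : IsIntegrableField a lam Lam) : Measurable fun x => ENNReal.ofReal (Lam x) :=
  ENNReal.measurable_ofReal.comp h.measurable_Lam

/-- Since `0 < λ ≤ Λ` almost everywhere, `Λ dx` and Lebesgue measure have the same null sets; this
allows almost-everywhere statements to pass freely between the two. -/
lemma volume_ac (h : IsIntegrableField a lam Lam) : (volume : Measure (Euc d)) ≪ weighted Lam := by
  refine withDensity_absolutelyContinuous' h.measurable_ofReal_Lam.aemeasurable ?_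
  filter_upwards [h.Lam_pos] with x hx
  simpa using hx

lemma ae_weighted_iff (h : IsIntegrableField a lam Lam) {P : Euc d → Prop} : (∀ᵐ x ∂weighted Lam, P x) ↔ ∀ᵐ x, P x :=
  ⟨fun hP => h.volume_ac.ae_le hP, fun hP => (withDensity_absolutelyContinuous _ _).ae_le hP⟩

lemma ae_weighted_restrict_iff (h : IsIntegrableField a lam Lam) {P : Euc d → Prop} (x : Euc d) (r : ℝ) :
    (∀ᵐ y ∂(weighted Lam).restrict (Metric.ball x r), P y) ↔
      ∀ᵐ y ∂volume.restrict (Metric.ball x r), P y := by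
  rw [ae_restrict_iff' measurableSet_ball, ae_restrict_iff' measurableSet_ball, h.ae_weighted_iff]

lemma lintegral_weighted (h : IsIntegrableField a lam Lam) (f : Euc d → ℝ≥0∞) :
    ∫⁻ x, f x ∂weighted Lam = ∫⁻ x, f x * ENNReal.ofReal (Lam x) := by
  rw [weighted, lintegral_withDensity_eq_lintegral_mul_non_measurable _ h.measurable_ofReal_Lam]
  · simp only [Pi.mul_apply, mul_comm]
  · exact Eventually.of_forall fun x => ENNReal.ofReal_lt_top

lemma setLIntegral_weighted (h : IsIntegrableField a lam Lam) (f : Euc d → ℝ≥0∞) {s : Set (Euc d)} (hs : MeasurableSet s) :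
    ∫⁻ x in s, f x ∂weighted Lam = ∫⁻ x in s, f x * ENNReal.ofReal (Lam x) := by
  rw [weighted, setLIntegral_withDensity_eq_setLIntegral_mul_non_measurable _
    h.measurable_ofReal_Lam _ hs]
  · simp only [Pi.mul_apply, mul_comm]
  · exact Eventually.of_forall fun x => ENNReal.ofReal_lt_top

lemma weighted_ball_lt_top (h : IsIntegrableField a lam Lam) (x : Euc d) (r : ℝ) : weighted Lam (Metric.ball x r) < ∞ := by
  rw [weighted, withDensity_apply _ measurableSet_ball]
  exact h.lintegral_Lam x r

end IsIntegrableField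

end Weights

/-! ### Test functions and their gradients. -/

section TestFunctions

variable {d : ℕ} {G G' : Set (Euc d)} {φ ψ : Euc d → ℝ}

lemma inner_gradient_left (φ : Euc d → ℝ) (x e : Euc d) :
    inner ℝ (gradient φ x) e = fderiv ℝ φ x e :=
  InnerProductSpace.toDual_symm_apply

lemma norm_gradient (φ : Euc d → ℝ) (x : Euc d) : ‖gradient φ x‖ = ‖fderiv ℝ φ x‖ :=
  LinearIsometryEquiv.norm_map _ _

namespace IsTest

lemma mono (h : IsTest G φ) (hG : G ⊆ G') : IsTest G' φ := ⟨h.smooth, h.compact, h.support.trans hG⟩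

lemma differentiable (h : IsTest G φ) : Differentiable ℝ φ := h.smooth.differentiable (by simp)

lemma continuous_fderiv (h : IsTest G φ) : Continuous (fderiv ℝ φ) :=
  h.smooth.continuous_fderiv (by simp)

lemma continuous_gradient (h : IsTest G φ) : Continuous (gradient φ) :=
  (LinearIsometryEquiv.continuous _).comp h.continuous_fderiv

lemma exists_bound (h : IsTest G φ) : ∃ C R : ℝ, 0 ≤ C ∧ tsupport φ ⊆ Metric.ball 0 R ∧
    (∀ x, |φ x| ≤ C) ∧ ∀ x, ‖gradient φ x‖ ≤ C := by
  obtain ⟨C, hC⟩ := h.compact.exists_bound_of_continuous h.smooth.continuous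
  obtain ⟨C', hC'⟩ := (h.compact.fderiv (𝕜 := ℝ)).exists_bound_of_continuous h.continuous_fderiv
  obtain ⟨R, hR⟩ := h.compact.isCompact.isBounded.subset_ball 0
  exact ⟨max (max C C') 0, R, le_max_right _ _, hR,
    fun x => (hC x).trans ((le_max_left _ _).trans (le_max_left _ _)),
    fun x => (norm_gradient φ x).trans_le ((hC' x).trans ((le_max_right _ _).trans (le_max_left _ _)))⟩

end IsTest

lemma gradient_eq_zero_of_notMem {x : Euc d} (hx : x ∉ tsupport φ) : gradient φ x = 0 := by
  have : fderiv ℝ φ x = 0 := by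
    by_contra h
    exact hx (support_fderiv_subset ℝ (Function.mem_support.2 h))
  simp [gradient, this]

lemma gradient_add_mul {F : ℝ → ℝ} (hF : Differentiable ℝ F) (hφ : Differentiable ℝ φ)
    (hψ : Differentiable ℝ ψ) (x : Euc d) :
    gradient (fun y => F (φ y) * ψ y) x =
      (deriv F (φ x) * ψ x) • gradient φ x + F (φ x) • gradient ψ x := by
  refine ext_inner_right ℝ fun e => ?_
  have h1 : HasFDerivAt (fun y => F (φ y)) (deriv F (φ x) • fderiv ℝ φ x) x :=
    (hF (φ x)).hasDerivAt.comp_hasFDerivAt x (hφ x).hasFDerivAt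
  rw [inner_gradient_left, (h1.fun_mul (hψ x).hasFDerivAt).fderiv, inner_add_left, inner_smul_left,
    inner_smul_left, inner_gradient_left, inner_gradient_left]
  simp
  ring

end TestFunctions

/-! ### Energies of vector fields and form gradients. -/

section FormGradient

lemma bil_neg_neg {d : ℕ} (A : Matrix (Fin d) (Fin d) ℝ) (ξ : Euc d) :
    bil A (-ξ) (-ξ) = bil A ξ ξ := by
  simp [bil]

variable {d : ℕ} {a : Euc d → Matrix (Fin d) (Fin d) ℝ} {lam Lam : Euc d → ℝ}
  {G G' : Set (Euc d)} {u : Euc d → ℝ} {g g' : Euc d → Euc d}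

lemma IsIntegrableField.memLp_test (h : IsIntegrableField a lam Lam) {φ : Euc d → ℝ}
    (hφ : IsTest G φ) : MemLp φ 2 (weighted Lam) := by
  obtain ⟨C, R, hC, hR, hb, -⟩ := hφ.exists_bound
  have : IsFiniteMeasure ((weighted Lam).restrict (Metric.ball 0 R)) :=
    ⟨by simpa using h.weighted_ball_lt_top 0 R⟩
  have h1 : MemLp φ 2 ((weighted Lam).restrict (Metric.ball 0 R)) :=
    MemLp.of_bound hφ.smooth.continuous.aestronglyMeasurable C (Eventually.of_forall hb)
  rw [← memLp_indicator_iff_restrict measurableSet_ball] at h1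
  rwa [indicator_eq_self.2 ((subset_tsupport φ).trans hR)] at h1

/-- The `a`-energy `∫ ⟨a f, f⟩ dx` of a vector field. -/
def fieldEnergy (a : Euc d → Matrix (Fin d) (Fin d) ℝ) (f : Euc d → Euc d) : ℝ≥0∞ :=
  ∫⁻ x, ENNReal.ofReal (bil (a x) (f x) (f x))

lemma HasFormGradient.mono (hu : HasFormGradient a Lam G u g) (hG : G ⊆ G') :
    HasFormGradient a Lam G' u g := by
  obtain ⟨φ, h1, h2, h3⟩ := hu.approx
  exact ⟨hu.memLp, hu.measurable_grad, φ, fun n => (h1 n).mono hG, h2, h3⟩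

/-- The approximating sequence can be chosen to converge almost everywhere. -/
lemma HasFormGradient.exists_approx (h : IsIntegrableField a lam Lam)
    (hu : HasFormGradient a Lam G u g) : ∃ φ : ℕ → Euc d → ℝ, (∀ n, IsTest G (φ n)) ∧
      Tendsto (fun n => eLpNorm (fun x => φ n x - u x) 2 (weighted Lam)) atTop (𝓝 0) ∧
      Tendsto (fun n => fieldEnergy a fun x => gradient (φ n) x - g x) atTop (𝓝 0) ∧
      ∀ᵐ x, Tendsto (fun n => φ n x) atTop (𝓝 (u x)) := by
  obtain ⟨φ, h1, h2, h3⟩ := hu.approx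
  obtain ⟨ns, hns, hae⟩ := (tendstoInMeasure_of_tendsto_eLpNorm (by simp)
    (fun n => (h1 n).smooth.continuous.aestronglyMeasurable)
    hu.memLp.aestronglyMeasurable h2).exists_seq_tendsto_ae
  exact ⟨fun n => φ (ns n), fun n => h1 _, h2.comp hns.tendsto_atTop, h3.comp hns.tendsto_atTop,
    h.ae_weighted_iff.1 hae⟩

lemma IsIntegrableField.fieldEnergy_test_lt_top (h : IsIntegrableField a lam Lam)
    {φ : Euc d → ℝ} (hφ : IsTest G φ) : fieldEnergy a (gradient φ) < ∞ := by
  obtain ⟨C, R, hC, hR, -, hb⟩ := hφ.exists_bound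
  have h1 : fieldEnergy a (gradient φ) ≤
      ∫⁻ x, (Metric.ball 0 R).indicator
        (fun x => ENNReal.ofReal (C ^ 2) * ENNReal.ofReal (Lam x)) x := by
    refine lintegral_mono_ae ?_
    filter_upwards [h.bounds] with x hx
    by_cases hxR : x ∈ Metric.ball 0 R
    · rw [indicator_of_mem hxR, ← ENNReal.ofReal_mul (sq_nonneg C), mul_comm]
      refine ENNReal.ofReal_le_ofReal ((hx _).2.trans ?_)
      have := h.Lam_nonneg x
      gcongr
      exact hb x
    · rw [gradient_eq_zero_of_notMem fun hx' => hxR (hR hx')]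
      simp [bil]
  refine h1.trans_lt ?_
  rw [lintegral_indicator measurableSet_ball, lintegral_const_mul' _ _ ENNReal.ofReal_ne_top]
  exact ENNReal.mul_lt_top ENNReal.ofReal_lt_top (h.lintegral_Lam 0 R)

lemma IsEllipticField.fieldEnergy_add_le (h : IsEllipticField a lam Lam) {f k : Euc d → Euc d}
    (hf : AEStronglyMeasurable f volume) :
    fieldEnergy a (fun x => f x + k x) ≤ 2 * fieldEnergy a f + 2 * fieldEnergy a k := by
  unfold fieldEnergy
  rw [← lintegral_const_mul' _ _ (by simp), ← lintegral_const_mul' _ _ (by simp),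
    ← lintegral_add_left' ((h.aestronglyMeasurable_bil hf hf).aemeasurable.ennreal_ofReal.const_mul _)]
  refine lintegral_mono_ae ?_
  filter_upwards [h.isNonnegForm] with x hx
  refine (ENNReal.ofReal_le_ofReal (hx.add_le _ _)).trans (ENNReal.ofReal_add_le.trans ?_)
  rw [ENNReal.ofReal_mul zero_le_two, ENNReal.ofReal_mul zero_le_two, ENNReal.ofReal_ofNat]

lemma HasFormGradient.fieldEnergy_lt_top (h : IsIntegrableField a lam Lam)
    (hu : HasFormGradient a Lam G u g) : fieldEnergy a g < ∞ := by
  obtain ⟨φ, h1, -, h3⟩ := hu.approx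
  obtain ⟨n, hn⟩ := (h3.eventually (gt_mem_nhds one_pos)).exists
  have h4 := h.fieldEnergy_add_le (k := fun x => -(gradient (φ n) x - g x))
    (h1 n).continuous_gradient.aestronglyMeasurable
  have h5 : fieldEnergy a (fun x => -(gradient (φ n) x - g x)) =
      fieldEnergy a (fun x => gradient (φ n) x - g x) := by
    refine lintegral_congr fun x => ?_
    rw [← bil_neg_neg]
    simp
  rw [h5] at h4
  have h6 : (fun x => gradient (φ n) x + -(gradient (φ n) x - g x)) = g := by ext x; simp
  rw [h6] at h4
  refine h4.trans_lt (ENNReal.add_lt_top.2 ⟨ENNReal.mul_lt_top (by simp)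
    (h.fieldEnergy_test_lt_top (h1 n)), ENNReal.mul_lt_top (by simp) (hn.trans (by simp))⟩)

/-- Cauchy–Schwarz for `|f| ≤ (1/λ)^(1/2) k^(1/2)`. It turns control in energy, or in `L²(Λ)`, into
control in `L¹` on balls, where distributional arguments apply. -/
lemma IsIntegrableField.setLIntegral_enorm_le (h : IsIntegrableField a lam Lam)
    {V : Type*} [SeminormedAddCommGroup V] {f : Euc d → V} {k : Euc d → ℝ≥0∞}
    (hk : AEMeasurable k volume)
    (hf : ∀ᵐ x, ‖f x‖ₑ ^ (2 : ℝ) ≤ recip lam x * k x) (x : Euc d) (r : ℝ) :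
    ∫⁻ y in Metric.ball x r, ‖f y‖ₑ ≤
      (∫⁻ y in Metric.ball x r, recip lam y) ^ (1 / 2 : ℝ) * (∫⁻ y, k y) ^ (1 / 2 : ℝ) := by
  have hm := h.measurable_recip
  calc ∫⁻ y in Metric.ball x r, ‖f y‖ₑ
      ≤ ∫⁻ y in Metric.ball x r, ((fun y => recip lam y ^ (1 / 2 : ℝ)) *
          fun y => k y ^ (1 / 2 : ℝ)) y := by
        refine lintegral_mono_ae (ae_restrict_of_ae ?_)
        filter_upwards [hf] with y hy
        rw [Pi.mul_apply, ← ENNReal.mul_rpow_of_nonneg _ _ (by norm_num)]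
        calc ‖f y‖ₑ = (‖f y‖ₑ ^ (2 : ℝ)) ^ (1 / 2 : ℝ) := by
              rw [← ENNReal.rpow_mul]; norm_num
          _ ≤ _ := by gcongr
    _ ≤ _ := ENNReal.lintegral_mul_le_Lp_mul_Lq _ Real.HolderConjugate.two_two
        (hm.pow_const _).aemeasurable (hk.restrict.pow_const _)
    _ ≤ _ := by
        simp only [← ENNReal.rpow_mul]
        norm_num
        gcongr
        exact Measure.restrict_le_self

lemma IsIntegrableField.setLIntegral_field_le (h : IsIntegrableField a lam Lam)
    {f : Euc d → Euc d} (hf : AEStronglyMeasurable f volume) (x : Euc d) (r : ℝ) :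
    ∫⁻ y in Metric.ball x r, ‖f y‖ₑ ≤
      (∫⁻ y in Metric.ball x r, recip lam y) ^ (1 / 2 : ℝ) * fieldEnergy a f ^ (1 / 2 : ℝ) := by
  refine h.setLIntegral_enorm_le (h.aestronglyMeasurable_bil hf hf).aemeasurable.ennreal_ofReal
    ?_ x r
  filter_upwards [h.bounds, h.lam_pos] with y hy hl
  have h0 : ENNReal.ofReal (lam y) ≠ 0 := by simpa using hl
  rw [recip, ← ENNReal.mul_le_iff_le_inv h0 ENNReal.ofReal_ne_top, ← ofReal_norm,
    ENNReal.ofReal_rpow_of_nonneg (norm_nonneg _) (by norm_num), ← ENNReal.ofReal_mul hl.le]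
  refine ENNReal.ofReal_le_ofReal ?_
  simpa using (hy (f y)).1

/-- The bound `λ ≤ Λ` allows `k = |f|² Λ`. -/
lemma IsIntegrableField.setLIntegral_fun_le (h : IsIntegrableField a lam Lam)
    {f : Euc d → ℝ} (hf : AEStronglyMeasurable f volume) (x : Euc d) (r : ℝ) :
    ∫⁻ y in Metric.ball x r, ‖f y‖ₑ ≤
      (∫⁻ y in Metric.ball x r, recip lam y) ^ (1 / 2 : ℝ) * eLpNorm f 2 (weighted Lam) := by
  have h1 := h.setLIntegral_enorm_le (f := f) (k := fun y => ‖f y‖ₑ ^ (2 : ℝ) * ENNReal.ofReal (Lam y))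
    ((hf.enorm.pow_const _).mul h.measurable_ofReal_Lam.aemeasurable) ?_ x r
  · rwa [← h.lintegral_weighted, ← ENNReal.toReal_ofNat, ← eLpNorm_eq_lintegral_rpow_enorm_toReal (by simp) (by simp)] at h1
  · filter_upwards [h.lam_le_Lam h.dim_pos, h.lam_pos] with y hy hl
    have h0 : ENNReal.ofReal (lam y) ≠ 0 := by simpa using hl
    rw [recip, ← ENNReal.mul_le_iff_le_inv h0 ENNReal.ofReal_ne_top, mul_comm]
    gcongr

end FormGradient

lemma tendsto_integral_mul_of_lintegral_enorm {X : Type*} [MeasurableSpace X] {μ : Measure X}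
    {f : X → ℝ} {F : ℕ → X → ℝ} {ζ : X → ℝ} (hf : Integrable f μ) (hF : ∀ n, Integrable (F n) μ)
    (h : Tendsto (fun n => ∫⁻ x, ‖F n x - f x‖ₑ ∂μ) atTop (𝓝 0))
    (hζ : AEStronglyMeasurable ζ μ) {C : ℝ} (hC : ∀ x, ‖ζ x‖ ≤ C) :
    Tendsto (fun n => ∫ x, ζ x * F n x ∂μ) atTop (𝓝 (∫ x, ζ x * f x ∂μ)) := by
  refine tendsto_integral_of_L1 _ (hf.bdd_mul hζ (Eventually.of_forall hC)).1
    (Eventually.of_forall fun n => (hF n).bdd_mul hζ (Eventually.of_forall hC)) ?_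
  have h1 := ENNReal.Tendsto.const_mul (a := ENNReal.ofReal C) h (Or.inr ENNReal.ofReal_ne_top)
  rw [mul_zero] at h1
  refine tendsto_of_tendsto_of_tendsto_of_le_of_le tendsto_const_nhds h1 (fun _ => zero_le) ?_
  intro n
  dsimp only
  rw [← lintegral_const_mul' _ _ ENNReal.ofReal_ne_top]
  refine lintegral_mono fun x => ?_
  rw [← mul_sub, enorm_mul, ← ofReal_norm]
  gcongr
  exact hC x

/-! ### Form gradients are weak gradients; closability. -/

section WeakGradient

variable {d : ℕ} {a : Euc d → Matrix (Fin d) (Fin d) ℝ} {lam Lam : Euc d → ℝ}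
  {G G' : Set (Euc d)} {u : Euc d → ℝ} {g g' : Euc d → Euc d}

lemma IsIntegrableField.integrableOn_field (h : IsIntegrableField a lam Lam) {f : Euc d → Euc d}
    (hf : AEStronglyMeasurable f volume) (hfe : fieldEnergy a f < ∞) (x : Euc d) (r : ℝ) :
    IntegrableOn f (Metric.ball x r) volume :=
  ⟨hf.restrict, (h.setLIntegral_field_le hf x r).trans_lt (ENNReal.mul_lt_top
    (ENNReal.rpow_lt_top_of_nonneg (by norm_num) (h.lintegral_recip x r).ne)
    (ENNReal.rpow_lt_top_of_nonneg (by norm_num) hfe.ne))⟩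

lemma IsIntegrableField.integrableOn_fun (h : IsIntegrableField a lam Lam) {f : Euc d → ℝ}
    (hf : MemLp f 2 (weighted Lam)) (x : Euc d) (r : ℝ) :
    IntegrableOn f (Metric.ball x r) volume :=
  ⟨(hf.1.mono_ac h.volume_ac).restrict, (h.setLIntegral_fun_le
    (hf.1.mono_ac h.volume_ac) x r).trans_lt (ENNReal.mul_lt_top
    (ENNReal.rpow_lt_top_of_nonneg (by norm_num) (h.lintegral_recip x r).ne) hf.2)⟩

lemma tendsto_const_mul_rpow_half {K : ℝ≥0∞} (hK : K < ∞) {f : ℕ → ℝ≥0∞}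
    (hf : Tendsto f atTop (𝓝 0)) :
    Tendsto (fun n => K ^ (1 / 2 : ℝ) * f n ^ (1 / 2 : ℝ)) atTop (𝓝 0) := by
  have h1 := ENNReal.Tendsto.const_mul (a := K ^ (1 / 2 : ℝ)) (hf.ennrpow_const (1 / 2 : ℝ))
    (Or.inr (ENNReal.rpow_lt_top_of_nonneg (by norm_num) hK.ne).ne)
  simpa using h1

/-- The form gradient is the distributional gradient: the approximants and their gradients converge
in `L¹` on the ball carrying `ψ`, so integration by parts survives the limit. -/
lemma HasFormGradient.integral_mul_inner (h : IsIntegrableField a lam Lam)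
    (hu : HasFormGradient a Lam G u g) {ψ : Euc d → ℝ} (hψ : IsTest univ ψ) (e : Euc d) :
    ∫ x, ψ x * inner ℝ (g x) e = -∫ x, fderiv ℝ ψ x e * u x := by
  obtain ⟨φ, h1, h2, h3⟩ := hu.approx
  obtain ⟨C, R, hC, hR, hb, hb'⟩ := hψ.exists_bound
  have hum := hu.memLp.1.mono_ac h.volume_ac
  have hzero : ∀ x ∉ Metric.ball 0 R, ψ x = 0 ∧ fderiv ℝ ψ x e = 0 := fun x hx =>
    ⟨image_eq_zero_of_notMem_tsupport fun hx' => hx (hR hx'), by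
      rw [← inner_gradient_left, gradient_eq_zero_of_notMem fun hx' => hx (hR hx'),
        inner_zero_left]⟩
  have hball : ∀ f : Euc d → ℝ, ∫ x, ψ x * f x = ∫ x in Metric.ball 0 R, ψ x * f x := fun f =>
    (setIntegral_eq_integral_of_forall_compl_eq_zero fun x hx => by simp [(hzero x hx).1]).symm
  have hball' : ∀ f : Euc d → ℝ,
      ∫ x, fderiv ℝ ψ x e * f x = ∫ x in Metric.ball 0 R, fderiv ℝ ψ x e * f x := fun f =>
    (setIntegral_eq_integral_of_forall_compl_eq_zero fun x hx => by simp [(hzero x hx).2]).symm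
  have hint : ∀ {f : Euc d → Euc d}, IntegrableOn f (Metric.ball 0 R) volume →
      IntegrableOn (fun x => inner ℝ (f x) e) (Metric.ball 0 R) volume := fun hf =>
    hf.inner_const e
  have hgi := h.integrableOn_field hu.measurable_grad (hu.fieldEnergy_lt_top h) 0 R
  have hφg : ∀ n, IntegrableOn (gradient (φ n)) (Metric.ball 0 R) volume := fun n =>
    h.integrableOn_field (h1 n).continuous_gradient.aestronglyMeasurable
      (h.fieldEnergy_test_lt_top (h1 n)) 0 R
  have hL1 : Tendsto (fun n => ∫ x, ψ x * inner ℝ (gradient (φ n) x) e) atTop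
      (𝓝 (∫ x, ψ x * inner ℝ (g x) e)) := by
    simp only [hball]
    refine tendsto_integral_mul_of_lintegral_enorm (hint hgi) (fun n => hint (hφg n)) ?_
      hψ.smooth.continuous.aestronglyMeasurable hb
    have h5 := ENNReal.Tendsto.const_mul (a := ‖e‖ₑ)
      (tendsto_const_mul_rpow_half (h.lintegral_recip 0 R) h3) (Or.inr enorm_ne_top)
    rw [mul_zero] at h5
    refine tendsto_of_tendsto_of_tendsto_of_le_of_le tendsto_const_nhds h5 (fun _ => zero_le) ?_
    intro n
    refine le_trans ?_ (mul_le_mul_right (h.setLIntegral_field_le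
      ((h1 n).continuous_gradient.aestronglyMeasurable.sub hu.measurable_grad) 0 R) _)
    rw [← lintegral_const_mul' _ _ enorm_ne_top]
    refine lintegral_mono fun x => ?_
    rw [← inner_sub_left, mul_comm]
    rw [← ofReal_norm, ← ofReal_norm, ← ofReal_norm, ← ENNReal.ofReal_mul (norm_nonneg _)]
    exact ENNReal.ofReal_le_ofReal (norm_inner_le_norm _ _)
  have hL2 : Tendsto (fun n => ∫ x, fderiv ℝ ψ x e * φ n x) atTop
      (𝓝 (∫ x, fderiv ℝ ψ x e * u x)) := by
    simp only [hball']
    refine tendsto_integral_mul_of_lintegral_enorm (h.integrableOn_fun hu.memLp 0 R)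
      (fun n => h.integrableOn_fun (h.memLp_test (h1 n)) 0 R) ?_
      (hψ.continuous_fderiv.clm_apply continuous_const).aestronglyMeasurable (C := C * ‖e‖) ?_
    · have h5 := ENNReal.Tendsto.const_mul
        (a := (∫⁻ y in Metric.ball 0 R, recip lam y) ^ (1 / 2 : ℝ)) h2
        (Or.inr (ENNReal.rpow_lt_top_of_nonneg (by norm_num) (h.lintegral_recip 0 R).ne).ne)
      rw [mul_zero] at h5
      refine tendsto_of_tendsto_of_tendsto_of_le_of_le tendsto_const_nhds h5 (fun _ => zero_le) ?_
      intro n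
      exact h.setLIntegral_fun_le ((h1 n).smooth.continuous.aestronglyMeasurable.sub hum) 0 R
    · intro x
      refine (ContinuousLinearMap.le_opNorm _ _).trans ?_
      rw [← norm_gradient]
      gcongr
      exact hb' x
  refine tendsto_nhds_unique hL1 ?_
  refine hL2.neg.congr fun n => ?_
  simp only [inner_gradient_left]
  rw [integral_mul_fderiv_eq_neg_fderiv_mul_of_integrable _ _ _
    (fun x _ => hψ.differentiable x) (fun x _ => (h1 n).differentiable x)]
  · exact ((hψ.continuous_fderiv.clm_apply continuous_const).mul
      (h1 n).smooth.continuous).integrable_of_hasCompactSupport (h1 n).compact.mul_left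
  · exact (hψ.smooth.continuous.mul ((h1 n).continuous_fderiv.clm_apply
      continuous_const)).integrable_of_hasCompactSupport hψ.compact.mul_right
  · exact (hψ.smooth.continuous.mul
      (h1 n).smooth.continuous).integrable_of_hasCompactSupport hψ.compact.mul_right

/-- The form is closable: gradients are unique. -/
lemma HasFormGradient.unique (h : IsIntegrableField a lam Lam)
    (hu : HasFormGradient a Lam G u g) (hu' : HasFormGradient a Lam G' u g') : g =ᵐ[volume] g' := by
  have hloc : ∀ {G : Set (Euc d)} {g : Euc d → Euc d}, HasFormGradient a Lam G u g →
      ∀ e : Euc d, LocallyIntegrable (fun x => inner ℝ (g x) e) volume := by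
    intro G g hu e x
    exact ⟨Metric.ball x 1, Metric.ball_mem_nhds x one_pos,
      (h.integrableOn_field hu.measurable_grad (hu.fieldEnergy_lt_top h) x 1).inner_const e⟩
  have hcoord : ∀ i : Fin d, ∀ᵐ x, inner ℝ (g x) (EuclideanSpace.single i (1 : ℝ)) =
      inner ℝ (g' x) (EuclideanSpace.single i (1 : ℝ)) := by
    intro i
    refine ae_eq_of_integral_contDiff_smul_eq (hloc hu _) (hloc hu' _) fun ψ hψ hc => ?_
    have ht : IsTest univ ψ := ⟨hψ, hc, subset_univ _⟩
    simp only [smul_eq_mul]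
    rw [hu.integral_mul_inner h ht, hu'.integral_mul_inner h ht]
  filter_upwards [ae_all_iff.2 hcoord] with x hx
  ext i
  simpa [EuclideanSpace.inner_single_right] using hx i

lemma HasFormGradient.formGrad_ae_eq (h : IsIntegrableField a lam Lam)
    (hu : HasFormGradient a Lam G u g) : formGrad a Lam u =ᵐ[volume] g := by
  have hex : ∃ g, HasFormGradient a Lam univ u g := ⟨g, hu.mono (subset_univ _)⟩
  rw [formGrad, dif_pos hex]
  exact hex.choose_spec.unique h hu

lemma hasFormGradient_formGrad (hu : u ∈ FormDomain a Lam univ) :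
    HasFormGradient a Lam univ u (formGrad a Lam u) := by
  have hex : ∃ g, HasFormGradient a Lam univ u g := hu
  rw [formGrad, dif_pos hex]
  exact hex.choose_spec

end WeakGradient

/-! ### Chain and product rules in the form domain. -/

section ChainRule

/-- A smooth function, bounded together with its first two derivatives. -/
structure IsBddSmooth (F : ℝ → ℝ) (C : ℝ) : Prop where
  smooth : ContDiff ℝ (⊤ : ℕ∞) F
  bound : ∀ s, |F s| ≤ C
  bound_deriv : ∀ s, |deriv F s| ≤ C
  bound_deriv2 : ∀ s, |deriv (deriv F) s| ≤ C

namespace IsBddSmooth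

variable {F : ℝ → ℝ} {C : ℝ}

lemma nonneg (hF : IsBddSmooth F C) : 0 ≤ C := (abs_nonneg _).trans (hF.bound 0)

lemma differentiable (hF : IsBddSmooth F C) : Differentiable ℝ F :=
  hF.smooth.differentiable (by simp)

lemma contDiff_deriv (hF : IsBddSmooth F C) : ContDiff ℝ (⊤ : ℕ∞) (deriv F) :=
  ((contDiff_succ_iff_deriv (n := (⊤ : ℕ∞))).1 (by simpa using hF.smooth)).2.2

lemma continuous_deriv (hF : IsBddSmooth F C) : Continuous (deriv F) := hF.contDiff_deriv.continuous

lemma abs_sub_le (hF : IsBddSmooth F C) (s t : ℝ) : |F s - F t| ≤ C * |s - t| := by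
  have := Convex.norm_image_sub_le_of_norm_deriv_le (f := F) (C := C) (s := univ) (x := t) (y := s)
    (fun x _ => hF.differentiable x) (fun x _ => hF.bound_deriv x) convex_univ (mem_univ _)
    (mem_univ _)
  simpa using this

lemma abs_deriv_sub_le (hF : IsBddSmooth F C) (s t : ℝ) :
    |deriv F s - deriv F t| ≤ C * |s - t| := by
  have := Convex.norm_image_sub_le_of_norm_deriv_le (f := deriv F) (C := C) (s := univ)
    (x := t) (y := s) (fun x _ => hF.contDiff_deriv.differentiable (by simp) x)
    (fun x _ => hF.bound_deriv2 x) convex_univ (mem_univ _) (mem_univ _)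
  simpa using this

/-- The mean value inequality on the segment from `t` to `s`, applied to the remainder, whose
derivative is at most `C |s - t|` there. The quadratic order is what the chain rule in time needs.
-/
lemma abs_taylor_le (hF : IsBddSmooth F C) (s t : ℝ) :
    |F s - F t - deriv F t * (s - t)| ≤ C * (s - t) ^ 2 := by
  have hd : ∀ x, HasDerivAt (fun x => F x - deriv F t * (x - t)) (deriv F x - deriv F t) x :=
    fun x => by
      have h1 := (hF.differentiable x).hasDerivAt.fun_sub
        (((hasDerivAt_id x).sub_const t).const_mul (deriv F t))
      simpa using h1
  have := Convex.norm_image_sub_le_of_norm_deriv_le (f := fun x => F x - deriv F t * (x - t))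
    (C := C * |s - t|) (s := uIcc t s) (x := t) (y := s)
    (fun x _ => (hd x).differentiableAt) (fun x hx => by
      rw [(hd x).deriv]
      refine (hF.abs_deriv_sub_le x t).trans (mul_le_mul_of_nonneg_left ?_ hF.nonneg)
      exact abs_sub_left_of_mem_uIcc hx) (convex_uIcc _ _) left_mem_uIcc right_mem_uIcc
  simp only [Real.norm_eq_abs, sub_self, mul_zero, sub_zero] at this
  rw [mul_assoc, abs_mul_abs_self, ← sq] at this
  convert this using 2
  ring

end IsBddSmooth

variable {d : ℕ} {a : Euc d → Matrix (Fin d) (Fin d) ℝ} {lam Lam : Euc d → ℝ}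
  {G : Set (Euc d)} {u : Euc d → ℝ} {g : Euc d → Euc d}

lemma IsIntegrableField.memLp_of_bound (h : IsIntegrableField a lam Lam) {f : Euc d → ℝ}
    (hf : AEStronglyMeasurable f (weighted Lam)) {C R : ℝ} (hC : ∀ x, |f x| ≤ C)
    (hR : ∀ x ∉ Metric.ball 0 R, f x = 0) (p : ℝ≥0∞) : MemLp f p (weighted Lam) := by
  have : IsFiniteMeasure ((weighted Lam).restrict (Metric.ball 0 R)) :=
    ⟨by simpa using h.weighted_ball_lt_top 0 R⟩
  have h1 : MemLp f p ((weighted Lam).restrict (Metric.ball 0 R)) :=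
    MemLp.of_bound hf.restrict C (Eventually.of_forall hC)
  rw [← memLp_indicator_iff_restrict measurableSet_ball] at h1
  rwa [indicator_eq_self.2 (Function.support_subset_iff'.2 hR)] at h1

lemma IsEllipticField.fieldEnergy_add_three_le (h : IsEllipticField a lam Lam)
    {f k l : Euc d → Euc d} (hf : AEStronglyMeasurable f volume)
    (hk : AEStronglyMeasurable k volume) :
    fieldEnergy a (fun x => f x + k x + l x) ≤
      3 * fieldEnergy a f + 3 * fieldEnergy a k + 3 * fieldEnergy a l := by
  unfold fieldEnergy
  rw [← lintegral_const_mul' _ _ (by simp), ← lintegral_const_mul' _ _ (by simp),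
    ← lintegral_const_mul' _ _ (by simp),
    ← lintegral_add_left' ((h.aestronglyMeasurable_bil hf hf).aemeasurable.ennreal_ofReal.const_mul _),
    ← lintegral_add_left' (AEMeasurable.fun_add ((h.aestronglyMeasurable_bil hf hf).aemeasurable.ennreal_ofReal.const_mul
      _) ((h.aestronglyMeasurable_bil hk hk).aemeasurable.ennreal_ofReal.const_mul _))]
  refine lintegral_mono_ae ?_
  filter_upwards [h.isNonnegForm] with x hx
  refine (ENNReal.ofReal_le_ofReal (hx.add_three_le _ _ _)).trans (ENNReal.ofReal_add_le.trans
    ((add_le_add_left ENNReal.ofReal_add_le _).trans ?_))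
  rw [ENNReal.ofReal_mul zero_le_three, ENNReal.ofReal_mul zero_le_three,
    ENNReal.ofReal_mul zero_le_three, ENNReal.ofReal_ofNat]

lemma IsEllipticField.fieldEnergy_smul_le (h : IsEllipticField a lam Lam) {c : Euc d → ℝ}
    {C : ℝ} (hc : ∀ x, |c x| ≤ C) (f : Euc d → Euc d) :
    fieldEnergy a (fun x => c x • f x) ≤ ENNReal.ofReal (C ^ 2) * fieldEnergy a f := by
  unfold fieldEnergy
  rw [← lintegral_const_mul' _ _ ENNReal.ofReal_ne_top]
  refine lintegral_mono_ae ?_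
  filter_upwards [h.isNonnegForm] with x hx
  rw [bil_smul_left, bil_smul_right, ← mul_assoc, ← sq, ← ENNReal.ofReal_mul (sq_nonneg C)]
  refine ENNReal.ofReal_le_ofReal (mul_le_mul_of_nonneg_right ?_ (hx.nonneg _))
  exact sq_le_sq' (by linarith [neg_abs_le (c x), hc x]) ((le_abs_self _).trans (hc x))

lemma IsIntegrableField.fieldEnergy_le_eLpNorm (h : IsIntegrableField a lam Lam)
    (f : Euc d → Euc d) : fieldEnergy a f ≤ eLpNorm f 2 (weighted Lam) ^ (2 : ℝ) := by
  rw [eLpNorm_eq_lintegral_rpow_enorm_toReal (by simp) (by simp), ENNReal.toReal_ofNat,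
    ← ENNReal.rpow_mul, h.lintegral_weighted]
  norm_num
  refine lintegral_mono_ae ?_
  filter_upwards [h.bounds] with x hx
  rw [← ofReal_norm, ← ENNReal.ofReal_pow (norm_nonneg _),
    ← ENNReal.ofReal_mul (sq_nonneg _), mul_comm]
  exact ENNReal.ofReal_le_ofReal (hx _).2

lemma tendsto_const_mul_zero {K : ℝ≥0∞} (hK : K ≠ ∞) {f : ℕ → ℝ≥0∞}
    (hf : Tendsto f atTop (𝓝 0)) : Tendsto (fun n => K * f n) atTop (𝓝 0) := by
  simpa using ENNReal.Tendsto.const_mul (a := K) hf (Or.inr hK)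

lemma tendsto_zero_of_le {f k : ℕ → ℝ≥0∞} (hk : Tendsto k atTop (𝓝 0)) (h : ∀ n, f n ≤ k n) :
    Tendsto f atTop (𝓝 0) :=
  tendsto_of_tendsto_of_tendsto_of_le_of_le tendsto_const_nhds hk (fun _ => zero_le) h

/-- The chain and product rules for `F(u) ψ`, where `ψ ∈ C_0^∞(G)`. -/
lemma HasFormGradient.comp_mul_test (h : IsIntegrableField a lam Lam)
    (hu : HasFormGradient a Lam univ u g) {F : ℝ → ℝ} {C : ℝ} (hF : IsBddSmooth F C)
    {ψ : Euc d → ℝ} (hψ : IsTest G ψ) :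
    HasFormGradient a Lam G (fun x => F (u x) * ψ x)
      (fun x => (deriv F (u x) * ψ x) • g x + F (u x) • gradient ψ x) := by
  obtain ⟨φ, h1, h2, h3, h4⟩ := hu.exists_approx h
  obtain ⟨C', R, hC', hR, hb, hb'⟩ := hψ.exists_bound
  have hC := hF.nonneg
  have hum := hu.memLp.1.mono_ac h.volume_ac
  have hFc := hF.smooth.continuous
  have hF'c := hF.continuous_deriv
  have hψc := hψ.smooth.continuous
  have hgm := hu.measurable_grad
  refine ⟨h.memLp_of_bound (C := C * C') (R := R) ((hFc.comp_aestronglyMeasurable hu.memLp.1).mul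
    hψc.aestronglyMeasurable) (fun x => ?_) (fun x hx => ?_) 2, ?_,
    fun n x => F (φ n x) * ψ x, fun n => ?_, ?_, ?_⟩
  · rw [Pi.mul_apply, abs_mul]; exact mul_le_mul (hF.bound _) (hb x) (abs_nonneg _) hC
  · rw [Pi.mul_apply, image_eq_zero_of_notMem_tsupport fun hx' => hx (hR hx'), mul_zero]
  · exact (((hF'c.comp_aestronglyMeasurable hum).mul hψc.aestronglyMeasurable).smul hgm).add
      ((hFc.comp_aestronglyMeasurable hum).smul hψ.continuous_gradient.aestronglyMeasurable)
  · exact ⟨(hF.smooth.comp (h1 n).smooth).mul hψ.smooth, hψ.compact.mul_left,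
      (tsupport_mul_subset_right).trans hψ.support⟩
  · refine tendsto_zero_of_le (tendsto_const_mul_zero (K := ENNReal.ofReal (C * C'))
      ENNReal.ofReal_ne_top h2) fun n => ?_
    refine eLpNorm_le_mul_eLpNorm_of_ae_le_mul (c := C * C') (Eventually.of_forall fun x => ?_) 2
    rw [← sub_mul, norm_mul, mul_right_comm]
    exact mul_le_mul (hF.abs_sub_le _ _) (hb x) (abs_nonneg _) (by positivity)
  -- The three errors have different causes: convergence of the gradients in energy, convergence of
  -- `F'(φ n)` almost everywhere only, and convergence of `φ n` in `L²(Λ)`.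
  · have hdecomp : ∀ n x, gradient (fun x => F (φ n x) * ψ x) x -
        ((deriv F (u x) * ψ x) • g x + F (u x) • gradient ψ x) =
        (deriv F (φ n x) * ψ x) • (gradient (φ n) x - g x) +
          ((deriv F (φ n x) - deriv F (u x)) * ψ x) • g x +
          (F (φ n x) - F (u x)) • gradient ψ x := by
      intro n x
      rw [gradient_add_mul hF.differentiable (h1 n).differentiable hψ.differentiable]
      module
    simp only [hdecomp]
    have hsum : ∀ n, _ := fun n => h.fieldEnergy_add_three_le
      (f := fun x => (deriv F (φ n x) * ψ x) • (gradient (φ n) x - g x))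
      (k := fun x => ((deriv F (φ n x) - deriv F (u x)) * ψ x) • g x)
      (l := fun x => (F (φ n x) - F (u x)) • gradient ψ x)
      ((((hF'c.comp (h1 n).smooth.continuous).mul hψc).aestronglyMeasurable).smul
        ((h1 n).continuous_gradient.aestronglyMeasurable.sub hgm))
      ((((hF'c.comp (h1 n).smooth.continuous).aestronglyMeasurable.sub
        (hF'c.comp_aestronglyMeasurable hum)).mul hψc.aestronglyMeasurable).smul hgm)
    refine tendsto_zero_of_le ?_ hsum
    have t1 : Tendsto (fun n => fieldEnergy a fun x =>
        (deriv F (φ n x) * ψ x) • (gradient (φ n) x - g x)) atTop (𝓝 0) := by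
      refine tendsto_zero_of_le (tendsto_const_mul_zero ENNReal.ofReal_ne_top h3) fun n =>
        h.fieldEnergy_smul_le (C := C * C') (fun x => ?_) _
      rw [abs_mul]; exact mul_le_mul (hF.bound_deriv _) (hb x) (abs_nonneg _) hC
    have t3 : Tendsto (fun n => fieldEnergy a fun x =>
        (F (φ n x) - F (u x)) • gradient ψ x) atTop (𝓝 0) := by
      refine tendsto_zero_of_le ?_ fun n => h.fieldEnergy_le_eLpNorm _
      have h5 := (tendsto_const_mul_zero (K := ENNReal.ofReal (C * C'))
        ENNReal.ofReal_ne_top h2).ennrpow_const 2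
      rw [ENNReal.zero_rpow_of_pos two_pos] at h5
      refine tendsto_zero_of_le h5 fun n => ENNReal.rpow_le_rpow ?_ zero_le_two
      refine eLpNorm_le_mul_eLpNorm_of_ae_le_mul (Eventually.of_forall fun x => ?_) 2
      rw [norm_smul, mul_right_comm]
      exact mul_le_mul (hF.abs_sub_le _ _) (hb' x) (norm_nonneg _) (by positivity)
    -- Here `F'(φ n) - F'(u)` multiplies the fixed field `g`, and smallness in `L²(Λ)` does not
    -- suffice; dominated convergence applies because `g` has finite energy.
    have t2 : Tendsto (fun n => fieldEnergy a fun x =>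
        ((deriv F (φ n x) - deriv F (u x)) * ψ x) • g x) atTop (𝓝 0) := by
      have hz : ∫⁻ _ : Euc d, (0 : ℝ≥0∞) = 0 := lintegral_zero
      rw [← hz]
      refine tendsto_lintegral_of_dominated_convergence'
        (fun x => ENNReal.ofReal ((2 * C * C') ^ 2) * ENNReal.ofReal (bil (a x) (g x) (g x)))
        (fun n => ?_) (fun n => ?_) ?_ ?_
      · have hm := (((hF'c.comp (h1 n).smooth.continuous).aestronglyMeasurable.sub
          (hF'c.comp_aestronglyMeasurable hum)).mul hψc.aestronglyMeasurable).smul hgm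
        exact (h.aestronglyMeasurable_bil hm hm).aemeasurable.ennreal_ofReal
      · filter_upwards [h.isNonnegForm] with x hx
        rw [bil_smul_left, bil_smul_right, ← mul_assoc, ← sq, ← ENNReal.ofReal_mul (sq_nonneg _)]
        refine ENNReal.ofReal_le_ofReal (mul_le_mul_of_nonneg_right ?_ (hx.nonneg _))
        refine sq_le_sq.2 ?_
        rw [abs_mul, abs_of_nonneg (by positivity : 0 ≤ 2 * C * C')]
        refine mul_le_mul ((abs_sub _ _).trans ?_) (hb x) (abs_nonneg _) (by positivity)
        linarith [hF.bound_deriv (φ n x), hF.bound_deriv (u x)]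
      · rw [lintegral_const_mul' _ _ ENNReal.ofReal_ne_top]
        exact ENNReal.mul_ne_top ENNReal.ofReal_ne_top (hu.fieldEnergy_lt_top h).ne
      · filter_upwards [h4] with x hx
        have h6 : Tendsto (fun n => deriv F (φ n x) - deriv F (u x)) atTop (𝓝 0) := by
          simpa using ((hF'c.tendsto (u x)).comp hx).sub_const (deriv F (u x))
        have h7 : Tendsto (fun n => ((deriv F (φ n x) - deriv F (u x)) * ψ x) *
            (((deriv F (φ n x) - deriv F (u x)) * ψ x) * bil (a x) (g x) (g x))) atTop (𝓝 0) := by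
          have h8 := h6.mul_const (ψ x)
          rw [zero_mul] at h8
          simpa using h8.mul (h8.mul_const (bil (a x) (g x) (g x)))
        simp only [bil_smul_left, bil_smul_right]
        simpa [Function.comp_def] using (ENNReal.continuous_ofReal.tendsto 0).comp h7
    have h9 := ((tendsto_const_mul_zero (K := 3) (by simp) t1).add
      (tendsto_const_mul_zero (K := 3) (by simp) t2)).add
      (tendsto_const_mul_zero (K := 3) (by simp) t3)
    simpa using h9

end ChainRule

/-! ### Arithmetic of the exponents `p*`, `ρ`, `ν`. -/

section Exponents

/-- The relations between the exponents used throughout. -/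
structure IsAdmissible (d : ℕ) (p q : ℝ≥0∞) : Prop where
  two_le : 2 ≤ d
  one_le_p : 1 ≤ p
  one_le_q : 1 ≤ q
  sum_lt : p⁻¹ + q⁻¹ < 2 / (d : ℝ≥0∞)
  ne_top : ¬ (d = 2 ∧ q = ⊤)

namespace IsAdmissible

variable {d : ℕ} {p q : ℝ≥0∞}

lemma dim_pos (h : IsAdmissible d p q) : (0 : ℝ) < d := by
  exact_mod_cast zero_lt_two.trans_le h.two_le

lemma inv_p_ne_top (h : IsAdmissible d p q) : p⁻¹ ≠ ∞ := by
  simpa using (zero_lt_one.trans_le h.one_le_p).ne'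

lemma inv_q_ne_top (h : IsAdmissible d p q) : q⁻¹ ≠ ∞ := by
  simpa using (zero_lt_one.trans_le h.one_le_q).ne'

lemma sum_toReal_lt (h : IsAdmissible d p q) : p⁻¹.toReal + q⁻¹.toReal < 2 / d := by
  have h1 := h.sum_lt
  rw [← ENNReal.toReal_add h.inv_p_ne_top h.inv_q_ne_top]
  have hd : (d : ℝ≥0∞) ≠ 0 := by
    have := h.two_le
    simp; omega
  have h2 : (2 / (d : ℝ≥0∞)).toReal = 2 / d := by simp [ENNReal.toReal_div]
  rw [← h2]
  exact (ENNReal.toReal_lt_toReal (ENNReal.add_ne_top.2 ⟨h.inv_p_ne_top, h.inv_q_ne_top⟩)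
    (ENNReal.div_ne_top (by simp) hd)).2 h1

lemma inv_q_le (h : IsAdmissible d p q) : q⁻¹.toReal ≤ 1 := by
  have h1 : q⁻¹ ≤ 1 := ENNReal.inv_le_one.2 h.one_le_q
  simpa using ENNReal.toReal_mono ENNReal.one_ne_top h1

lemma inv_p_lt (h : IsAdmissible d p q) : p⁻¹.toReal < 1 := by
  have h1 := h.sum_toReal_lt
  have h2 : (2 : ℝ) / d ≤ 1 := by
    rw [div_le_one h.dim_pos]; exact_mod_cast h.two_le
  have h3 : 0 ≤ q⁻¹.toReal := ENNReal.toReal_nonneg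
  linarith

/-- For `d > 2` the term `d - 2` is positive; for `d = 2` positivity rests on `1/q > 0`, which is
why `(2, ∞)` is excluded. -/
lemma rho_denom_pos (h : IsAdmissible d p q) : 0 < (d : ℝ) - 2 + d * q⁻¹.toReal := by
  have h0 : 0 ≤ q⁻¹.toReal := ENNReal.toReal_nonneg
  have h1 := mul_nonneg h.dim_pos.le h0
  rcases h.two_le.eq_or_lt with h2 | h2
  · have hq : q ≠ ⊤ := fun hq => h.ne_top ⟨h2.symm, hq⟩
    have h3 : 0 < q⁻¹.toReal := ENNReal.toReal_pos (by simpa using hq) h.inv_q_ne_top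
    have : (d : ℝ) = 2 := by exact_mod_cast h2.symm
    rw [this]
    linarith
  · have : (2 : ℝ) < d := by exact_mod_cast h2
    linarith

lemma rho_pos (h : IsAdmissible d p q) : 0 < rho d q :=
  div_pos (mul_pos two_pos h.dim_pos) h.rho_denom_pos

/-- This exhibits `ρ` as the Sobolev conjugate of `2 / (1 + 1/q)`, the exponent to which the
gradient is integrable. -/
lemma inv_rho (h : IsAdmissible d p q) : (rho d q)⁻¹ = (1 + q⁻¹.toReal) / 2 - (d : ℝ)⁻¹ := by
  have := h.dim_pos
  rw [rho, inv_div]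
  field_simp
  ring

lemma pStar_pos (h : IsAdmissible d p q) : 0 < pStar p :=
  one_div_pos.2 (sub_pos.2 h.inv_p_lt)

lemma two_mul_pStar_div_rho (h : IsAdmissible d p q) :
    2 * pStar p / rho d q = (1 + q⁻¹.toReal - 2 / d) / (1 - p⁻¹.toReal) := by
  have h1 := sub_pos.2 h.inv_p_lt
  rw [div_eq_mul_inv, h.inv_rho, pStar]
  field_simp

/-- Rewriting `2 p*/ρ` as `(1 + 1/q - 2/d) / (1 - 1/p)` shows that `2 p*/ρ < 1` is equivalent to
`1/p + 1/q < 2/d`. -/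
lemma one_lt_nu (h : IsAdmissible d p q) : 1 < nu d p q := by
  have h1 := sub_pos.2 h.inv_p_lt
  have h2 := h.sum_toReal_lt
  rw [nu, h.two_mul_pStar_div_rho]
  have : (1 + q⁻¹.toReal - 2 / d) / (1 - p⁻¹.toReal) < 1 := by
    rw [div_lt_one h1]; linarith
  linarith

lemma two_sub_nu (d : ℕ) (p q : ℝ≥0∞) : 2 - nu d p q = 2 * pStar p / rho d q := by
  rw [nu]; ring

lemma nu_lt_two (h : IsAdmissible d p q) : nu d p q < 2 := by
  have := two_sub_nu d p q
  have h1 : 0 < 2 * pStar p / rho d q :=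
    div_pos (mul_pos two_pos h.pStar_pos) h.rho_pos
  linarith

/-- The power of the volume in the averaged Sobolev inequality. -/
lemma volume_exponent (h : IsAdmissible d p q) :
    q⁻¹.toReal + p⁻¹.toReal * (2 - nu d p q) = 1 - nu d p q + 2 / d := by
  have h1 := sub_pos.2 h.inv_p_lt
  have h2 : (2 - nu d p q) * (1 - p⁻¹.toReal) = 1 + q⁻¹.toReal - 2 / d := by
    rw [two_sub_nu, h.two_mul_pStar_div_rho, div_mul_cancel₀ _ h1.ne']
  linarith

lemma pStar_mul (h : IsAdmissible d p q) : pStar p * (2 / (2 - nu d p q)) = rho d q := by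
  have h1 := h.pStar_pos
  have h2 := h.rho_pos
  rw [two_sub_nu]
  field_simp

lemma holderTriple_p (h : IsAdmissible d p q) :
    ENNReal.HolderTriple (ENNReal.ofReal (pStar p)) p 1 := by
  refine ⟨?_⟩
  have h1 := sub_pos.2 h.inv_p_lt
  have h2 : p⁻¹ = ENNReal.ofReal p⁻¹.toReal := (ENNReal.ofReal_toReal h.inv_p_ne_top).symm
  rw [← ENNReal.ofReal_inv_of_pos h.pStar_pos, h2, ← ENNReal.ofReal_add
    (inv_nonneg.2 h.pStar_pos.le) ENNReal.toReal_nonneg, pStar, one_div, inv_inv]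
  simp

lemma holderTriple_q (h : IsAdmissible d p q) :
    ENNReal.HolderTriple (2 * q) 2 (ENNReal.ofReal (2 / (1 + q⁻¹.toReal))) := by
  refine ⟨?_⟩
  have h0 : 0 ≤ q⁻¹.toReal := ENNReal.toReal_nonneg
  have h2 : q⁻¹ = ENNReal.ofReal q⁻¹.toReal := (ENNReal.ofReal_toReal h.inv_q_ne_top).symm
  have h3 : (2 : ℝ≥0∞)⁻¹ = ENNReal.ofReal 2⁻¹ := by
    rw [ENNReal.ofReal_inv_of_pos two_pos, ENNReal.ofReal_ofNat]
  rw [ENNReal.mul_inv (Or.inl (by simp)) (Or.inl (by simp)), h2, h3, ← ENNReal.ofReal_mul (by simp),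
    ← ENNReal.ofReal_add (by positivity) (by simp), ← ENNReal.ofReal_inv_of_pos (by positivity)]
  rw [ENNReal.toReal_ofReal h0]
  congr 1
  field_simp
  ring

end IsAdmissible

end Exponents

/-! ### The weighted Sobolev inequality. -/

section Sobolev

variable {d : ℕ} {a : Euc d → Matrix (Fin d) (Fin d) ℝ} {lam Lam : Euc d → ℝ} {p q : ℝ≥0∞}

/-- Gagliardo–Nirenberg–Sobolev for the exponent `rho`. -/
lemma exists_eLpNorm_rho_le (hpq : IsAdmissible d p q) : ∃ C : NNReal, ∀ φ : Euc d → ℝ,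
    IsTest univ φ → eLpNorm φ (ENNReal.ofReal (rho d q)) volume ≤
      C * eLpNorm (gradient φ) (ENNReal.ofReal (2 / (1 + q⁻¹.toReal))) volume := by
  have h0 : 0 ≤ q⁻¹.toReal := ENNReal.toReal_nonneg
  refine ⟨eLpNormLESNormFDerivOfEqInnerConst (volume : Measure (Euc d))
    (2 / (1 + q⁻¹.toReal)).toNNReal, fun φ hφ => ?_⟩
  have h1 := eLpNorm_le_eLpNorm_fderiv_of_eq_inner (volume : Measure (Euc d)) (u := φ)
    (hφ.smooth.of_le (by simp)) hφ.compact (p := (2 / (1 + q⁻¹.toReal)).toNNReal)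
    (p' := (rho d q).toNNReal) ?_ ?_ ?_
  · refine h1.trans_eq ?_
    congr 1
    exact eLpNorm_congr_norm_ae (Eventually.of_forall fun x => (norm_gradient φ x).symm)
  · rw [← NNReal.coe_le_coe, Real.coe_toNNReal _ (by positivity), NNReal.coe_one,
      le_div_iff₀ (by positivity)]
    linarith [hpq.inv_q_le]
  · rw [finrank_euclideanSpace_fin]
    exact zero_lt_two.trans_le hpq.two_le
  · rw [finrank_euclideanSpace_fin, Real.coe_toNNReal _ hpq.rho_pos.le,
      NNReal.coe_inv, Real.coe_toNNReal _ (by positivity), hpq.inv_rho, inv_div]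

/-- Hölder with exponents `2q` and `2` for `|∇φ| = λ^(-1/2) · λ^(1/2)|∇φ|`; ellipticity bounds the
square of the second factor by the energy density. -/
lemma IsIntegrableField.eLpNorm_gradient_le (h : IsIntegrableField a lam Lam)
    (hpq : IsAdmissible d p q) {φ : Euc d → ℝ} {x : Euc d} {r : ℝ}
    (hφ : IsTest (Metric.ball x r) φ) :
    eLpNorm (gradient φ) (ENNReal.ofReal (2 / (1 + q⁻¹.toReal))) volume ≤
      eLpNorm (recip lam) q (volume.restrict (Metric.ball x r)) ^ (1 / 2 : ℝ) *
        fieldEnergy a (gradient φ) ^ (1 / 2 : ℝ) := by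
  have := hpq.holderTriple_q
  have hsupp : Function.support (gradient φ) ⊆ Metric.ball x r := fun y hy => by
    by_contra hn
    exact hy (gradient_eq_zero_of_notMem fun hy' => hn (hφ.support hy'))
  rw [← eLpNorm_restrict_eq_of_support_subset hsupp]
  have hm1 : Measurable fun y => ‖(lam y)⁻¹‖ ^ (1 / 2 : ℝ) :=
    (h.measurable_lam.inv.norm).pow_const _
  have hm2 : AEStronglyMeasurable (fun y => (lam y) ^ (1 / 2 : ℝ) • gradient φ y)
      (volume.restrict (Metric.ball x r)) :=
    (h.measurable_lam.pow_const _).aestronglyMeasurable.smul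
      hφ.continuous_gradient.aestronglyMeasurable
  calc eLpNorm (gradient φ) (ENNReal.ofReal (2 / (1 + q⁻¹.toReal)))
        (volume.restrict (Metric.ball x r))
      = eLpNorm ((fun y => ‖(lam y)⁻¹‖ ^ (1 / 2 : ℝ)) •
          fun y => (lam y) ^ (1 / 2 : ℝ) • gradient φ y) (ENNReal.ofReal (2 / (1 + q⁻¹.toReal)))
        (volume.restrict (Metric.ball x r)) := by
        refine eLpNorm_congr_ae (ae_restrict_of_ae ?_)
        filter_upwards [h.lam_pos] with y hy
        simp only [Pi.smul_apply', smul_smul]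
        rw [norm_inv, Real.norm_of_nonneg hy.le, ← Real.mul_rpow (by positivity) hy.le,
          inv_mul_cancel₀ hy.ne', Real.one_rpow, one_smul]
    _ ≤ _ := eLpNorm_smul_le_mul_eLpNorm (p := 2 * q) (q := 2) hm2 hm1.aestronglyMeasurable
    _ ≤ _ := by
        gcongr
        · rw [eLpNorm_norm_rpow _ (by norm_num)]
          refine ENNReal.rpow_le_rpow (le_of_eq ?_) (by norm_num)
          have h2 : 2 * q * ENNReal.ofReal (1 / 2) = q := by
            rw [mul_right_comm, one_div, ENNReal.ofReal_inv_of_pos two_pos, ENNReal.ofReal_ofNat,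
              ENNReal.mul_inv_cancel (by simp) (by simp), one_mul]
          rw [h2]
          refine eLpNorm_congr_enorm_ae (ae_restrict_of_ae ?_)
          filter_upwards [h.lam_pos] with y hy
          rw [recip, ← ENNReal.ofReal_inv_of_pos hy, Real.enorm_eq_ofReal (by positivity)]
          simp
        · refine (eLpNorm_restrict_le _ _ _ _).trans ?_
          rw [eLpNorm_eq_lintegral_rpow_enorm_toReal (by simp) (by simp), ENNReal.toReal_ofNat]
          refine ENNReal.rpow_le_rpow (lintegral_mono_ae ?_) (by norm_num)
          filter_upwards [h.bounds, h.lam_pos] with y hy hl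
          rw [← ofReal_norm, ENNReal.ofReal_rpow_of_nonneg (norm_nonneg _) zero_le_two]
          refine ENNReal.ofReal_le_ofReal (le_trans (le_of_eq ?_) (hy _).1)
          rw [norm_smul, Real.norm_of_nonneg (by positivity), Real.rpow_two, mul_pow,
            ← Real.rpow_two, ← Real.rpow_mul hl.le]
          norm_num

/-- Hölder with exponents `p*` and `p` for `|φ|^m Λ`, where `m = 2/(2-ν)` is chosen so that `m p* =
ρ`. -/
lemma IsIntegrableField.eLpNorm_weighted_le (h : IsIntegrableField a lam Lam)
    (hpq : IsAdmissible d p q) {φ : Euc d → ℝ} {x : Euc d} {r : ℝ}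
    (hφ : IsTest (Metric.ball x r) φ) :
    eLpNorm φ (ENNReal.ofReal (2 / (2 - nu d p q))) (weighted Lam) ≤
      eLpNorm φ (ENNReal.ofReal (rho d q)) volume *
        eLpNorm Lam p (volume.restrict (Metric.ball x r)) ^ ((2 - nu d p q) / 2) := by
  have := hpq.holderTriple_p
  have hν := sub_pos.2 hpq.nu_lt_two
  have hm : 0 < 2 / (2 - nu d p q) := div_pos two_pos hν
  have hsupp : Function.support φ ⊆ Metric.ball x r := (subset_tsupport φ).trans hφ.support
  rw [← eLpNorm_restrict_eq_of_support_subset hsupp, eLpNorm_eq_lintegral_rpow_enorm_toReal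
    (by simpa using hm) (by simp), ENNReal.toReal_ofReal hm.le,
    h.setLIntegral_weighted _ measurableSet_ball]
  have h1 : ∫⁻ y in Metric.ball x r, ‖φ y‖ₑ ^ (2 / (2 - nu d p q)) * ENNReal.ofReal (Lam y) ≤
      eLpNorm φ (ENNReal.ofReal (rho d q)) volume ^ (2 / (2 - nu d p q)) *
        eLpNorm Lam p (volume.restrict (Metric.ball x r)) := by
    calc ∫⁻ y in Metric.ball x r, ‖φ y‖ₑ ^ (2 / (2 - nu d p q)) * ENNReal.ofReal (Lam y)
        = eLpNorm ((fun y => ‖φ y‖ ^ (2 / (2 - nu d p q))) • Lam) 1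
            (volume.restrict (Metric.ball x r)) := by
          rw [eLpNorm_one_eq_lintegral_enorm]
          refine lintegral_congr fun y => ?_
          rw [Pi.smul_apply', enorm_smul, Real.enorm_eq_ofReal (h.Lam_nonneg y),
            Real.enorm_eq_ofReal (Real.rpow_nonneg (norm_nonneg _) _),
            ← ENNReal.ofReal_rpow_of_nonneg (norm_nonneg _) hm.le, ofReal_norm]
      _ ≤ _ := eLpNorm_smul_le_mul_eLpNorm (p := ENNReal.ofReal (pStar p)) (q := p)
          h.measurable_Lam.aestronglyMeasurable
          ((hφ.smooth.continuous.norm.rpow_const fun _ => Or.inr hm.le).aestronglyMeasurable)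
      _ ≤ _ := by
          gcongr
          rw [eLpNorm_norm_rpow _ hm, ← ENNReal.ofReal_mul hpq.pStar_pos.le, hpq.pStar_mul]
          exact ENNReal.rpow_le_rpow (eLpNorm_restrict_le _ _ _ _) hm.le
  refine (ENNReal.rpow_le_rpow h1 (by positivity)).trans (le_of_eq ?_)
  rw [one_div_div, ENNReal.mul_rpow_of_nonneg _ _ (by positivity), ← ENNReal.rpow_mul]
  congr 1
  rw [div_mul_div_comm, mul_comm, div_self (by positivity), ENNReal.rpow_one]

/-- The weighted local Sobolev inequality. -/
lemma exists_sobolev (hpq : IsAdmissible d p q) : ∃ C : NNReal, ∀ (a : Euc d → Matrix (Fin d) (Fin d) ℝ)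
    (lam Lam : Euc d → ℝ), IsIntegrableField a lam Lam → ∀ (x : Euc d) (r : ℝ) (v : Euc d → ℝ)
    (g : Euc d → Euc d), HasFormGradient a Lam (Metric.ball x r) v g →
    eLpNorm (recip lam) q (volume.restrict (Metric.ball x r)) ≠ ∞ →
    eLpNorm Lam p (volume.restrict (Metric.ball x r)) ≠ ∞ →
    eLpNorm v (ENNReal.ofReal (2 / (2 - nu d p q))) (weighted Lam) ^ (2 : ℝ) ≤
      C * (eLpNorm (recip lam) q (volume.restrict (Metric.ball x r)) *
        eLpNorm Lam p (volume.restrict (Metric.ball x r)) ^ (2 - nu d p q)) *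
        fieldEnergy a g := by
  obtain ⟨C, hC⟩ := exists_eLpNorm_rho_le hpq
  refine ⟨2 * C ^ 2, fun a lam Lam h x r v g hv hNt hMt => ?_⟩
  set N := eLpNorm (recip lam) q (volume.restrict (Metric.ball x r)) with hN
  set M := eLpNorm Lam p (volume.restrict (Metric.ball x r)) with hM
  have htest : ∀ φ : Euc d → ℝ, IsTest (Metric.ball x r) φ →
      eLpNorm φ (ENNReal.ofReal (2 / (2 - nu d p q))) (weighted Lam) ^ (2 : ℝ) ≤
        C ^ 2 * (N * M ^ (2 - nu d p q)) * fieldEnergy a (gradient φ) := by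
    intro φ hφ
    have h1 := h.eLpNorm_weighted_le hpq hφ
    have h2 := (hC φ (hφ.mono (subset_univ _))).trans
      (mul_le_mul_right (h.eLpNorm_gradient_le hpq hφ) _)
    have h3 := ENNReal.rpow_le_rpow (h1.trans (mul_le_mul_left h2 _)) (zero_le_two (α := ℝ))
    refine h3.trans (le_of_eq ?_)
    rw [ENNReal.mul_rpow_of_nonneg _ _ zero_le_two, ENNReal.mul_rpow_of_nonneg _ _ zero_le_two,
      ENNReal.mul_rpow_of_nonneg _ _ zero_le_two, ← ENNReal.rpow_mul, ← ENNReal.rpow_mul,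
      ← ENNReal.rpow_mul]
    norm_num
    ring
  obtain ⟨φ, h1, -, h3, h4⟩ := hv.exists_approx h
  -- Fatou's lemma along the almost everywhere convergent approximants extends the inequality from
  -- test functions to `v`. Splitting the energy of `∇φ n` costs the factor `2` in the constant.
  have hlim := Lp.eLpNorm_lim_le_liminf_eLpNorm (μ := weighted Lam)
    (p := ENNReal.ofReal (2 / (2 - nu d p q)))
    (fun n => (h1 n).smooth.continuous.aestronglyMeasurable) v (h.ae_weighted_iff.2 h4)
  set K : ℝ≥0∞ := C ^ 2 * (N * M ^ (2 - nu d p q))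
  have hle : ∀ n, eLpNorm (φ n) (ENNReal.ofReal (2 / (2 - nu d p q))) (weighted Lam) ≤
      (K * (2 * fieldEnergy a g + 2 * fieldEnergy a fun x => gradient (φ n) x - g x))
        ^ (1 / 2 : ℝ) := by
    intro n
    have h5 := h.fieldEnergy_add_le (k := fun x => gradient (φ n) x - g x) hv.measurable_grad
    simp only [add_sub_cancel] at h5
    have h6 := ENNReal.rpow_le_rpow ((htest _ (h1 n)).trans (mul_le_mul_right h5 K))
      (by norm_num : (0 : ℝ) ≤ 1 / 2)
    rw [← ENNReal.rpow_mul] at h6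
    norm_num at h6
    simpa using h6
  have hK : K ≠ ∞ := ENNReal.mul_ne_top (by simp) (ENNReal.mul_ne_top hNt
    (ENNReal.rpow_lt_top_of_nonneg (sub_pos.2 hpq.nu_lt_two).le hMt).ne)
  have htend : Tendsto (fun n => (K * (2 * fieldEnergy a g +
      2 * fieldEnergy a fun x => gradient (φ n) x - g x)) ^ (1 / 2 : ℝ)) atTop
      (𝓝 ((K * (2 * fieldEnergy a g + 2 * 0)) ^ (1 / 2 : ℝ))) := by
    refine Tendsto.ennrpow_const _ (ENNReal.Tendsto.const_mul (tendsto_const_nhds.add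
      (ENNReal.Tendsto.const_mul h3 (Or.inr (by simp)))) (Or.inr hK))
  have h7 := hlim.trans ((liminf_le_liminf (Eventually.of_forall hle)).trans_eq htend.liminf_eq)
  have h8 := ENNReal.rpow_le_rpow h7 (zero_le_two (α := ℝ))
  rw [← ENNReal.rpow_mul] at h8
  refine h8.trans (le_of_eq ?_)
  norm_num [K]
  ring

end Sobolev

/-! ### Weak differentiability in time and the chain rule. -/

section WeakDifferentiability

variable {X : Type*} [MeasurableSpace X] {μ : Measure X} {I : Set ℝ} {u : ℝ → X → ℝ}

/-- `t ↦ u t` is weakly differentiable in `L²(μ)` on `I`. -/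
structure IsWeaklyDiff (μ : Measure X) (I : Set ℝ) (u : ℝ → X → ℝ) : Prop where
  memLp : ∀ t ∈ I, MemLp (u t) 2 μ
  diff : ∀ φ, MemLp φ 2 μ → ∀ t ∈ I, DifferentiableAt ℝ (fun t' => ∫ x, u t' x * φ x ∂μ) t

/-- Weakly differentiable functions are Lipschitz at each point, by the uniform boundedness
principle. -/
lemma IsWeaklyDiff.exists_lipschitz (h : IsWeaklyDiff μ I u) (hI : IsOpen I) {t : ℝ} (ht : t ∈ I) :
    ∃ C : ℝ, 0 ≤ C ∧ ∀ᶠ t' in 𝓝 t, t' ∈ I ∧ ∫ x, (u t' x - u t x) ^ 2 ∂μ ≤ C * (t' - t) ^ 2 := by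
  classical
  set U : ℝ → Lp ℝ 2 μ := fun t => if ht : t ∈ I then (h.memLp t ht).toLp (u t) else 0 with hU
  have hUae : ∀ t ∈ I, U t =ᵐ[μ] u t := fun t ht => by
    simp only [hU, dif_pos ht]; exact MemLp.coeFn_toLp _
  have hinner : ∀ t ∈ I, ∀ φ : Lp ℝ 2 μ, inner ℝ (U t) φ = ∫ x, u t x * φ x ∂μ := by
    intro t ht φ
    rw [L2.inner_def]
    refine integral_congr_ae ?_
    filter_upwards [hUae t ht] with x hx
    rw [hx, RCLike.inner_apply, mul_comm]
    rfl
  have hnorm : ∀ t' ∈ I, ‖U t' - U t‖ ^ 2 = ∫ x, (u t' x - u t x) ^ 2 ∂μ := by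
    intro t' ht'
    rw [← real_inner_self_eq_norm_sq, L2.inner_def]
    refine integral_congr_ae ?_
    filter_upwards [hUae t ht, hUae t' ht', Lp.coeFn_sub (U t') (U t)] with x h1 h2 h3
    rw [h3, Pi.sub_apply, h1, h2, RCLike.inner_apply, sq]
    rfl
  -- If no Lipschitz bound held at `t`, some sequence `s n → t` would have difference quotients of
  -- norm above `n`. Tested against any fixed function they converge, so Banach–Steinhaus bounds
  -- their norms, a contradiction.
  have key : ∃ C : ℝ, 0 ≤ C ∧ ∀ᶠ t' in 𝓝 t, t' ∈ I ∧ ‖U t' - U t‖ ≤ C * |t' - t| := by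
    by_contra hcon
    push Not at hcon
    have hseq : ∀ n : ℕ, ∃ t', dist t' t < 1 / ((n : ℝ) + 1) ∧ t' ∈ I ∧
        (n : ℝ) * |t' - t| < ‖U t' - U t‖ := by
      intro n
      have h1 := hcon n n.cast_nonneg
      have h2 : ∀ᶠ t' in 𝓝 t, dist t' t < 1 / ((n : ℝ) + 1) ∧ t' ∈ I :=
        Filter.inter_mem (Metric.ball_mem_nhds t (by positivity)) (hI.mem_nhds ht)
      obtain ⟨t', h3, h4⟩ := (h1.and_eventually h2).exists
      exact ⟨t', h4.1, h4.2, h3 h4.2⟩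
    choose s hs1 hs2 hs3 using hseq
    have hst : Tendsto s atTop (𝓝 t) := tendsto_iff_dist_tendsto_zero.2
      (squeeze_zero (fun _ => dist_nonneg) (fun n => (hs1 n).le) tendsto_one_div_add_atTop_nhds_zero_nat)
    have hsne : ∀ n, s n ≠ t := fun n hn => by
      have := hs3 n
      rw [hn] at this
      simp at this
    have hstn : Tendsto s atTop (𝓝[≠] t) :=
      tendsto_nhdsWithin_iff.2 ⟨hst, Eventually.of_forall hsne⟩
    obtain ⟨C, hC⟩ := banach_steinhaus
      (g := fun n => innerSL ℝ ((s n - t)⁻¹ • (U (s n) - U t))) (fun φ => by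
        have h1 := (h.diff φ (Lp.memLp φ) t ht).hasDerivAt.tendsto_slope.comp hstn
        obtain ⟨C, hC⟩ := h1.norm.bddAbove_range
        refine ⟨C, fun n => le_of_eq_of_le ?_ (hC (mem_range_self n))⟩
        rw [innerSL_apply_apply, inner_smul_left, inner_sub_left, hinner _ (hs2 n), hinner _ ht]
        simp [slope])
    obtain ⟨n, hn⟩ := exists_nat_gt C
    have h1 := hC n
    rw [innerSL_apply_norm, norm_smul, norm_inv, Real.norm_eq_abs] at h1
    have h2 : 0 < |s n - t| := abs_pos.2 (sub_ne_zero.2 (hsne n))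
    have h3 := (inv_mul_le_iff₀ h2).1 h1
    nlinarith [hs3 n]
  obtain ⟨C, hC0, hC⟩ := key
  refine ⟨C ^ 2, sq_nonneg C, hC.mono fun t' ht' => ⟨ht'.1, ?_⟩⟩
  rw [← hnorm t' ht'.1, ← sq_abs (t' - t), ← mul_pow]
  exact pow_le_pow_left₀ (norm_nonneg _) ht'.2 2

/-- The time derivative of a functional `∫ F(u t) ψ dμ`. -/
lemma IsWeaklyDiff.hasDerivAt_comp [IsFiniteMeasure μ] (h : IsWeaklyDiff μ I u) (hI : IsOpen I)
    {F : ℝ → ℝ} {C : ℝ} (hF : IsBddSmooth F C) {ψ : X → ℝ} (hψ : AEStronglyMeasurable ψ μ)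
    {K : ℝ} (hK0 : 0 ≤ K) (hK : ∀ x, |ψ x| ≤ K) {t : ℝ} (ht : t ∈ I) :
    HasDerivAt (fun t' => ∫ x, F (u t' x) * ψ x ∂μ)
      (deriv (fun t' => ∫ x, u t' x * (deriv F (u t x) * ψ x) ∂μ) t) t := by
  obtain ⟨L, hL0, hL⟩ := h.exists_lipschitz hI ht
  have hmeas : ∀ t ∈ I, AEStronglyMeasurable (u t) μ := fun t ht => (h.memLp t ht).1
  have hφ : MemLp (fun x => deriv F (u t x) * ψ x) 2 μ := by
    refine MemLp.of_bound ((hF.continuous_deriv.comp_aestronglyMeasurable (hmeas t ht)).mul hψ)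
      (C * K) (Eventually.of_forall fun x => ?_)
    rw [norm_mul]
    exact mul_le_mul (hF.bound_deriv _) (hK x) (norm_nonneg _) hF.nonneg
  have hint : ∀ t ∈ I, Integrable (fun x => F (u t x) * ψ x) μ := fun t ht => by
    refine Integrable.of_bound ((hF.smooth.continuous.comp_aestronglyMeasurable (hmeas t ht)).mul hψ)
      (C * K) (Eventually.of_forall fun x => ?_)
    rw [norm_mul]
    exact mul_le_mul (hF.bound _) (hK x) (norm_nonneg _) hF.nonneg
  have hint' : ∀ t' ∈ I, Integrable (fun x => u t' x * (deriv F (u t x) * ψ x)) μ := fun t' ht' =>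
    MemLp.integrable_mul (h.memLp t' ht') hφ
  set k : ℝ → ℝ := fun t' => ∫ x, u t' x * (deriv F (u t x) * ψ x) ∂μ with hk
  set f : ℝ → ℝ := fun t' => ∫ x, F (u t' x) * ψ x ∂μ with hf
  have hk' : HasDerivAt k (deriv k t) t := (h.diff _ hφ t ht).hasDerivAt
  -- `F(u t')` is compared with its linearization at `u t`. The Taylor remainder is at most `C (u t'
  -- - u t)²`, whose integral is `O(|t' - t|²)` by the Lipschitz bound.
  have hrem : HasDerivAt (fun t' => f t' - f t - (k t' - k t)) 0 t := by
    have h1 : (fun t' => f t' - f t - (k t' - k t)) =O[𝓝 t] fun t' => ‖t' - t‖ ^ 2 := by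
      refine Asymptotics.IsBigO.of_bound (C * K * L) (hL.mono fun t' ht' => ?_)
      obtain ⟨ht'I, ht'L⟩ := ht'
      have h2 : f t' - f t - (k t' - k t) =
          ∫ x, (F (u t' x) - F (u t x) - deriv F (u t x) * (u t' x - u t x)) * ψ x ∂μ := by
        have e1 : Integrable (fun x => F (u t' x) * ψ x - F (u t x) * ψ x) μ :=
          (hint t' ht'I).sub (hint t ht)
        have e2 : Integrable (fun x => u t' x * (deriv F (u t x) * ψ x) -
            u t x * (deriv F (u t x) * ψ x)) μ := (hint' t' ht'I).sub (hint' t ht)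
        rw [hf, hk]
        dsimp only
        rw [← integral_sub (hint t' ht'I) (hint t ht), ← integral_sub (hint' t' ht'I) (hint' t ht),
          ← integral_sub e1 e2]
        exact integral_congr_ae (Eventually.of_forall fun x => by ring)
      have hsq : Integrable (fun x => (u t' x - u t x) ^ 2) μ :=
        ((h.memLp t' ht'I).sub (h.memLp t ht)).integrable_sq
      rw [h2, norm_pow, norm_norm, Real.norm_eq_abs (t' - t), sq_abs]
      calc ‖∫ x, (F (u t' x) - F (u t x) - deriv F (u t x) * (u t' x - u t x)) * ψ x ∂μ‖
          ≤ ∫ x, C * K * (u t' x - u t x) ^ 2 ∂μ := by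
            refine norm_integral_le_of_norm_le (hsq.const_mul _) (Eventually.of_forall fun x => ?_)
            rw [norm_mul, mul_right_comm]
            exact mul_le_mul (hF.abs_taylor_le _ _) (hK x) (norm_nonneg _)
              (mul_nonneg hF.nonneg (sq_nonneg _))
        _ = C * K * ∫ x, (u t' x - u t x) ^ 2 ∂μ := integral_const_mul _ _
        _ ≤ C * K * L * (t' - t) ^ 2 := by
            rw [mul_assoc (C * K)]
            exact mul_le_mul_of_nonneg_left ht'L (mul_nonneg hF.nonneg hK0)
    exact (h1.hasFDerivAt one_lt_two).hasDerivAt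
  have h3 := (hrem.add hk').add_const (f t - k t)
  simp only [zero_add] at h3
  refine h3.congr_of_eventuallyEq (Eventually.of_forall fun t' => ?_)
  simp only [Pi.add_apply]
  ring

end WeakDifferentiability

/-! ### Smooth bounded substitutes for negative powers. -/

section ShiftedPowers

lemma exists_bound_of_continuous_of_tails {G : ℝ → ℝ} (hG : Continuous G) {A b c : ℝ}
    (h1 : ∀ s < b, |G s| ≤ A) (h2 : ∀ s > c, |G s| ≤ A) : ∃ C, ∀ s, |G s| ≤ C := by
  obtain ⟨B, hB⟩ := (isCompact_Icc (a := b) (b := c)).exists_bound_of_continuousOn hG.continuousOn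
  refine ⟨max A B, fun s => ?_⟩
  rcases lt_or_ge s b with h | h
  · exact (h1 s h).trans (le_max_left _ _)
  · rcases le_or_gt s c with h' | h'
    · exact (hB s ⟨h, h'⟩).trans (le_max_right _ _)
    · exact (h2 s h').trans (le_max_left _ _)

/-- A smooth positive function on `ℝ` which is `s + ε` for `s ≥ 0`. -/
def regShift (ε s : ℝ) : ℝ := ε / 2 + Real.smoothTransition (1 + 2 / ε * s) * (s + ε / 2)

/-- A smooth bounded function on `ℝ` which is `(s + ε) ^ (-β)` for `s ≥ 0`. -/
def shiftPow (ε β s : ℝ) : ℝ := regShift ε s ^ (-β)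

variable {ε β s : ℝ}

lemma regShift_of_nonneg (hε : 0 < ε) (hs : 0 ≤ s) : regShift ε s = s + ε := by
  rw [regShift, Real.smoothTransition.one_of_one_le]
  · ring
  · have : 0 ≤ 2 / ε * s := by positivity
    linarith

lemma regShift_of_le (hε : 0 < ε) (hs : s ≤ -(ε / 2)) : regShift ε s = ε / 2 := by
  rw [regShift, Real.smoothTransition.zero_of_nonpos]
  · ring
  · have h1 : 2 / ε * s ≤ 2 / ε * -(ε / 2) := by gcongr
    have h2 : 2 / ε * -(ε / 2) = -1 := by field_simp
    linarith

lemma half_le_regShift (hε : 0 < ε) : ε / 2 ≤ regShift ε s := by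
  rcases le_total s (-(ε / 2)) with h | h
  · exact (regShift_of_le hε h).ge
  · have := mul_nonneg (Real.smoothTransition.nonneg (1 + 2 / ε * s))
      (by linarith : 0 ≤ s + ε / 2)
    rw [regShift]
    linarith

lemma regShift_pos (hε : 0 < ε) : 0 < regShift ε s := (half_pos hε).trans_le (half_le_regShift hε)

lemma shiftPow_pos (hε : 0 < ε) : 0 < shiftPow ε β s := Real.rpow_pos_of_pos (regShift_pos hε) _

lemma shiftPow_of_nonneg (hε : 0 < ε) (hs : 0 ≤ s) : shiftPow ε β s = (s + ε) ^ (-β) := by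
  rw [shiftPow, regShift_of_nonneg hε hs]

lemma shiftPow_rpow (hε : 0 < ε) (γ : ℝ) : shiftPow ε β s ^ γ = shiftPow ε (β * γ) s := by
  rw [shiftPow, shiftPow, ← Real.rpow_mul (regShift_pos hε).le]
  congr 1
  ring

lemma contDiff_shiftPow (hε : 0 < ε) : ContDiff ℝ (⊤ : ℕ∞) (shiftPow ε β) := by
  have h1 : ContDiff ℝ (⊤ : ℕ∞) (regShift ε) := by
    refine contDiff_const.add ((Real.smoothTransition.contDiff.comp ?_).mul ?_)
    · exact contDiff_const.add (contDiff_const.mul contDiff_id)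
    · exact contDiff_id.add contDiff_const
  exact h1.rpow_const_of_ne fun s => (regShift_pos hε).ne'

lemma hasDerivAt_shiftPow (hε : 0 < ε) (hs : 0 < s) :
    HasDerivAt (shiftPow ε β) (-β * (s + ε) ^ (-β - 1)) s := by
  have h1 : HasDerivAt (fun s => (s + ε) ^ (-β)) (-β * (s + ε) ^ (-β - 1)) s := by
    simpa using ((hasDerivAt_id s).add_const ε).rpow_const (p := -β) (Or.inl (by simp; linarith))
  refine h1.congr_of_eventuallyEq ?_
  filter_upwards [lt_mem_nhds hs] with t ht
  exact shiftPow_of_nonneg hε ht.le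

lemma hasDerivAt_deriv_shiftPow (hε : 0 < ε) (hs : 0 < s) :
    HasDerivAt (deriv (shiftPow ε β)) (-β * ((-β - 1) * (s + ε) ^ (-β - 1 - 1))) s := by
  have h1 : HasDerivAt (fun s => -β * (s + ε) ^ (-β - 1))
      (-β * ((-β - 1) * (s + ε) ^ (-β - 1 - 1))) s := by
    simpa using (((hasDerivAt_id s).add_const ε).rpow_const (p := -β - 1)
      (Or.inl (by simp; linarith))).const_mul (-β)
  refine h1.congr_of_eventuallyEq ?_
  filter_upwards [lt_mem_nhds hs] with t ht
  exact (hasDerivAt_shiftPow hε ht).deriv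

lemma deriv_shiftPow_of_lt (hε : 0 < ε) (hs : s < -(ε / 2)) : deriv (shiftPow ε β) s = 0 := by
  have h1 : shiftPow ε β =ᶠ[𝓝 s] fun _ => (ε / 2) ^ (-β) := by
    filter_upwards [gt_mem_nhds hs] with t ht
    rw [shiftPow, regShift_of_le hε ht.le]
  rw [h1.deriv_eq, deriv_const]

lemma deriv_deriv_shiftPow_of_lt (hε : 0 < ε) (hs : s < -(ε / 2)) :
    deriv (deriv (shiftPow ε β)) s = 0 := by
  have h1 : deriv (shiftPow ε β) =ᶠ[𝓝 s] fun _ => 0 := by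
    filter_upwards [gt_mem_nhds hs] with t ht
    exact deriv_shiftPow_of_lt hε ht
  rw [h1.deriv_eq, deriv_const]

/-- Both derivatives vanish below `-ε/2`, are dominated for `s > 0` by their size at `0`, and are
continuous on the compact interval between. Boundedness on all of `ℝ` matters because `u` has no
prescribed sign outside the cylinder. -/
lemma exists_isBddSmooth_shiftPow (hε : 0 < ε) (hβ : 0 < β) :
    ∃ C, IsBddSmooth (shiftPow ε β) C := by
  have hsm := contDiff_shiftPow (β := β) hε
  have hd1 : ContDiff ℝ (⊤ : ℕ∞) (deriv (shiftPow ε β)) :=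
    ((contDiff_succ_iff_deriv (n := (⊤ : ℕ∞))).1 (by simpa using hsm)).2.2
  have hd2 : ContDiff ℝ (⊤ : ℕ∞) (deriv (deriv (shiftPow ε β))) :=
    ((contDiff_succ_iff_deriv (n := (⊤ : ℕ∞))).1 (by simpa using hd1)).2.2
  have hpow : ∀ γ : ℝ, γ ≤ 0 → ∀ s > 0, (s + ε) ^ γ ≤ ε ^ γ := fun γ hγ s hs =>
    Real.rpow_le_rpow_of_nonpos hε (by linarith) hγ
  obtain ⟨C1, hC1⟩ := exists_bound_of_continuous_of_tails hd1.continuous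
    (A := β * ε ^ (-β - 1)) (b := -(ε / 2)) (c := 0)
    (fun s hs => by rw [deriv_shiftPow_of_lt hε hs, abs_zero]; positivity)
    (fun s hs => by
      rw [(hasDerivAt_shiftPow hε hs).deriv, abs_mul, abs_neg, abs_of_pos hβ,
        abs_of_nonneg (Real.rpow_nonneg (by linarith) _)]
      exact mul_le_mul_of_nonneg_left (hpow _ (by linarith) s hs) hβ.le)
  obtain ⟨C2, hC2⟩ := exists_bound_of_continuous_of_tails hd2.continuous
    (A := β * ((β + 1) * ε ^ (-β - 1 - 1))) (b := -(ε / 2)) (c := 0)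
    (fun s hs => by rw [deriv_deriv_shiftPow_of_lt hε hs, abs_zero]; positivity)
    (fun s hs => by
      rw [(hasDerivAt_deriv_shiftPow hε hs).deriv, abs_mul, abs_mul, abs_neg, abs_of_pos hβ,
        abs_of_nonneg (Real.rpow_nonneg (by linarith) _), abs_of_neg (by linarith : -β - 1 < 0)]
      have := hpow (-β - 1 - 1) (by linarith) s hs
      rw [show -(-β - 1) = β + 1 by ring]
      gcongr)
  refine ⟨max (max C1 C2) ((ε / 2) ^ (-β)), hsm, fun s => ?_, fun s => ?_, fun s => ?_⟩
  · rw [abs_of_pos (shiftPow_pos hε)]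
    exact (Real.rpow_le_rpow_of_nonpos (half_pos hε) (half_le_regShift hε) (by linarith)).trans
      (le_max_right _ _)
  · exact (hC1 s).trans ((le_max_left _ _).trans (le_max_left _ _))
  · exact (hC2 s).trans ((le_max_right _ _).trans (le_max_left _ _))

/-- The algebra of the powers in the Caccioppoli estimate: with `w = (s + ε) ^ (-β / 2)`. -/
lemma shiftPow_identities (hε : 0 < ε) (hβ : 0 < β) (hs : 0 < s) :
    deriv (shiftPow ε β) s = -β * shiftPow ε (β + 1) s ∧
    β * deriv (shiftPow ε (β + 1)) s =
      -(4 * (β + 1) / β) * deriv (shiftPow ε (β / 2)) s ^ 2 ∧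
    β * shiftPow ε (β + 1) s = -2 * (deriv (shiftPow ε (β / 2)) s * shiftPow ε (β / 2) s) := by
  have hy : 0 < s + ε := by linarith
  simp only [(hasDerivAt_shiftPow hε hs).deriv, shiftPow_of_nonneg hε hs.le]
  have e1 : (s + ε) ^ (-β - 1) = (s + ε) ^ (-(β + 1)) := by congr 1; ring
  have e2 : ((s + ε) ^ (-(β / 2) - 1)) ^ 2 = (s + ε) ^ (-(β + 1) - 1) := by
    rw [← Real.rpow_natCast, ← Real.rpow_mul hy.le]; congr 1; push_cast; ring
  have e3 : (s + ε) ^ (-(β / 2) - 1) * (s + ε) ^ (-(β / 2)) = (s + ε) ^ (-(β + 1)) := by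
    rw [← Real.rpow_add hy]; congr 1; ring
  refine ⟨by rw [e1], ?_, ?_⟩
  · rw [mul_pow, e2]; field_simp; ring
  · rw [mul_assoc, e3]; ring

end ShiftedPowers

/-! ### Smooth cutoffs between concentric balls. -/

section Cutoff

lemma exists_deriv_smoothTransition_bound : ∃ C : ℝ, 0 < C ∧
    ∀ s, |deriv Real.smoothTransition s| ≤ C := by
  have hd : ContDiff ℝ (⊤ : ℕ∞) (deriv Real.smoothTransition) :=
    ((contDiff_succ_iff_deriv (n := (⊤ : ℕ∞))).1
      (by simpa using Real.smoothTransition.contDiff (n := (⊤ : ℕ∞)))).2.2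
  obtain ⟨C, hC⟩ := exists_bound_of_continuous_of_tails hd.continuous (A := 0) (b := 0) (c := 1)
    (fun s hs => by
      have h1 : Real.smoothTransition =ᶠ[𝓝 s] fun _ => 0 := by
        filter_upwards [gt_mem_nhds hs] with t ht
        exact Real.smoothTransition.zero_of_nonpos ht.le
      rw [h1.deriv_eq, deriv_const, abs_zero])
    (fun s hs => by
      have h1 : Real.smoothTransition =ᶠ[𝓝 s] fun _ => 1 := by
        filter_upwards [lt_mem_nhds hs] with t ht
        exact Real.smoothTransition.one_of_one_le ht.le
      rw [h1.deriv_eq, deriv_const, abs_zero])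
  exact ⟨C + 1, by linarith [(abs_nonneg _).trans (hC 0)], fun s => (hC s).trans (by linarith)⟩

/-- Cutoff functions between concentric balls. -/
structure IsCutoff {d : ℕ} (x : Euc d) (R' R L : ℝ) (η : Euc d → ℝ) : Prop where
  test : IsTest (Metric.ball x R) η
  nonneg : ∀ y, 0 ≤ η y
  le_one : ∀ y, η y ≤ 1
  eq_one : ∀ y ∈ Metric.ball x R', η y = 1
  gradient_le : ∀ y, ‖gradient η y‖ ≤ L

lemma exists_cutoff : ∃ C : ℝ, 0 < C ∧ ∀ (d : ℕ) (x : Euc d) (R' R : ℝ), 0 < R' → R' < R →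
    ∃ η, IsCutoff x R' R (C / (R - R')) η := by
  obtain ⟨C, hC0, hC⟩ := exists_deriv_smoothTransition_bound
  refine ⟨4 * C, by positivity, fun d x R' R hR' hR => ?_⟩
  -- Stopping at the midpoint radius keeps the closed support inside the open ball of radius `R`; it
  -- accounts for a factor `2` in the constant `4 * C`.
  set R₁ := (R + R') / 2 with hR₁
  have h1 : R' < R₁ := by rw [hR₁]; linarith
  have h2 : R₁ < R := by rw [hR₁]; linarith
  have hden : 0 < R₁ ^ 2 - R' ^ 2 := by nlinarith
  -- The squared norm keeps the profile smooth at the centre. Its slope is at most `2 R₁ / (R₁² -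
  -- R'²) ≤ 2 / (R₁ - R') = 4 / (R - R')`.
  set z : Euc d → ℝ := fun y => (R₁ ^ 2 - ‖y - x‖ ^ 2) * (R₁ ^ 2 - R' ^ 2)⁻¹ with hz
  have hzs : ContDiff ℝ (⊤ : ℕ∞) z :=
    (contDiff_const.sub ((contDiff_id.sub contDiff_const).norm_sq ℝ)).mul contDiff_const
  set η : Euc d → ℝ := fun y => Real.smoothTransition (z y) with hη
  have hsupp : tsupport η ⊆ Metric.closedBall x R₁ := by
    refine closure_minimal (fun y hy => ?_) Metric.isClosed_closedBall
    by_contra hn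
    rw [Metric.mem_closedBall, not_le, dist_eq_norm] at hn
    refine hy (Real.smoothTransition.zero_of_nonpos ?_)
    exact mul_nonpos_of_nonpos_of_nonneg (by nlinarith) (by positivity)
  have htest : IsTest (Metric.ball x R) η :=
    ⟨Real.smoothTransition.contDiff.comp hzs,
      (isCompact_closedBall x R₁).of_isClosed_subset (isClosed_tsupport _) hsupp,
      hsupp.trans (Metric.closedBall_subset_ball h2)⟩
  refine ⟨η, htest, fun y => Real.smoothTransition.nonneg _, fun y => Real.smoothTransition.le_one _,
    fun y hy => Real.smoothTransition.one_of_one_le ?_, fun y => ?_⟩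
  · rw [Metric.mem_ball, dist_eq_norm] at hy
    rw [hz]
    dsimp only
    rw [← div_eq_mul_inv, one_le_div hden]
    nlinarith [norm_nonneg (y - x)]
  · by_cases hy : y ∈ tsupport η
    · have hy' := hsupp hy
      rw [Metric.mem_closedBall, dist_eq_norm] at hy'
      have hst : HasDerivAt Real.smoothTransition (deriv Real.smoothTransition (z y)) (z y) :=
        ((Real.smoothTransition.contDiff (n := 1)).differentiable (by simp) _).hasDerivAt
      have hnz : HasFDerivAt z ((R₁ ^ 2 - R' ^ 2)⁻¹ •
          (-((2 : ℕ) • innerSL ℝ (y - x)) : Euc d →L[ℝ] ℝ)) y := by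
        have h3 := (((hasFDerivAt_id y).sub_const x).norm_sq.const_sub (R₁ ^ 2)).mul_const
          (R₁ ^ 2 - R' ^ 2)⁻¹
        simpa using h3
      have h4 := (hst.comp_hasFDerivAt y hnz).fderiv
      rw [norm_gradient, show η = Real.smoothTransition ∘ z from rfl, h4, norm_smul, norm_smul,
        norm_neg, Real.norm_eq_abs, norm_inv, Real.norm_of_nonneg hden.le]
      have h5 : ‖(2 : ℕ) • innerSL ℝ (y - x)‖ ≤ 2 * R₁ := by
        refine (norm_nsmul_le).trans ?_
        rw [innerSL_apply_norm]
        push_cast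
        gcongr
      calc |deriv Real.smoothTransition (z y)| * ((R₁ ^ 2 - R' ^ 2)⁻¹ * ‖(2 : ℕ) • innerSL ℝ (y - x)‖)
          ≤ C * ((R₁ ^ 2 - R' ^ 2)⁻¹ * (2 * R₁)) := by
            gcongr
            exact hC _
        _ ≤ 4 * C / (R - R') := by
            have h6 : R - R' = 2 * (R₁ - R') := by rw [hR₁]; ring
            have h7 : R₁ ^ 2 - R' ^ 2 = (R₁ - R') * (R₁ + R') := by ring
            have h8 : 0 < R₁ - R' := by linarith
            have h9 : 0 < R₁ + R' := by linarith
            rw [h6, h7, mul_inv, div_eq_mul_inv, mul_inv]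
            have h10 : (R₁ + R')⁻¹ * R₁ ≤ 1 := by
              rw [inv_mul_le_iff₀ h9]; linarith
            have h11 : C * ((R₁ - R')⁻¹ * (R₁ + R')⁻¹ * (2 * R₁)) =
              2 * C * (R₁ - R')⁻¹ * ((R₁ + R')⁻¹ * R₁) := by ring
            have h12 : 4 * C * (2⁻¹ * (R₁ - R')⁻¹) = 2 * C * (R₁ - R')⁻¹ * 1 := by ring
            rw [h11, h12]
            gcongr
    · rw [gradient_eq_zero_of_notMem hy, norm_zero]
      have : 0 < R - R' := by linarith
      positivity

end Cutoff

/-! ### Integrability of energy densities. -/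

section FiniteEnergy

variable {d : ℕ} {a : Euc d → Matrix (Fin d) (Fin d) ℝ} {lam Lam : Euc d → ℝ}
  {f k : Euc d → Euc d}

lemma IsEllipticField.integrable_bil_self (h : IsEllipticField a lam Lam)
    (hf : AEStronglyMeasurable f volume) (hfe : fieldEnergy a f < ∞) :
    Integrable (fun x => bil (a x) (f x) (f x)) :=
  (lintegral_ofReal_ne_top_iff_integrable (h.aestronglyMeasurable_bil hf hf)
    (h.isNonnegForm.mono fun _ hx => hx.nonneg _)).1 hfe.ne

lemma IsEllipticField.integral_bil_self (h : IsEllipticField a lam Lam)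
    (hf : AEStronglyMeasurable f volume) :
    ∫ x, bil (a x) (f x) (f x) = (fieldEnergy a f).toReal :=
  integral_eq_lintegral_of_nonneg_ae (h.isNonnegForm.mono fun _ hx => hx.nonneg _)
    (h.aestronglyMeasurable_bil hf hf)

lemma IsEllipticField.integrable_bil (h : IsEllipticField a lam Lam)
    (hf : AEStronglyMeasurable f volume) (hfe : fieldEnergy a f < ∞)
    (hk : AEStronglyMeasurable k volume) (hke : fieldEnergy a k < ∞) :
    Integrable (fun x => bil (a x) (f x) (k x)) := by
  refine ((h.integrable_bil_self hf hfe).add (h.integrable_bil_self hk hke)).mono'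
    (h.aestronglyMeasurable_bil hf hk) ?_
  filter_upwards [h.isNonnegForm] with x hx
  have := hx.two_mul_abs_le (f x) (k x)
  have := abs_nonneg (bil (a x) (f x) (k x))
  rw [Real.norm_eq_abs, Pi.add_apply]
  linarith

end FiniteEnergy

/-! ### The Caccioppoli estimate for negative powers. -/

section Caccioppoli

variable {d : ℕ} {a : Euc d → Matrix (Fin d) (Fin d) ℝ} {lam Lam : Euc d → ℝ}
  {x : Euc d} {r R L : ℝ} {I : Set ℝ} {u : ℝ → Euc d → ℝ} {η : Euc d → ℝ} {ε β t : ℝ}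

lemma IsIntegrableField.isFiniteMeasure_restrict (h : IsIntegrableField a lam Lam) (x : Euc d)
    (r : ℝ) : IsFiniteMeasure ((weighted Lam).restrict (Metric.ball x r)) :=
  ⟨by simpa using h.weighted_ball_lt_top x r⟩

lemma IsSupercaloric.isWeaklyDiff {G : Set (Euc d)} (hu : IsSupercaloric a Lam I G u) :
    IsWeaklyDiff ((weighted Lam).restrict G) I u where
  memLp t ht := by
    obtain ⟨g, hg⟩ := hu.mem_domain t ht
    exact hg.memLp.restrict G
  diff φ hφ t ht := hu.differentiable φ hφ t ht

lemma IsTest.sq {G : Set (Euc d)} (hη : IsTest G η) : IsTest G fun y => η y ^ 2 where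
  smooth := hη.smooth.pow 2
  compact := by
    have : (fun y => η y ^ 2) = η * η := by ext y; simp [_root_.sq]
    rw [this]; exact hη.compact.mul_left
  support := by
    have : (fun y => η y ^ 2) = fun y => η y * η y := by ext y; simp [_root_.sq]
    rw [this]; exact tsupport_mul_subset_right.trans hη.support

lemma gradient_sq (hη : Differentiable ℝ η) (y : Euc d) :
    gradient (fun y => η y ^ 2) y = (2 * η y) • gradient η y := by
  have h1 := gradient_add_mul differentiable_id hη hη y
  rw [deriv_id, one_mul, id, ← add_smul, ← two_mul] at h1
  simpa only [_root_.sq, id] using h1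

/-- The pointwise inequality behind the Caccioppoli estimate. -/
lemma caccioppoli_pointwise {A : Matrix (Fin d) (Fin d) ℝ} (hA : IsNonnegForm A) (hβ : 0 < β)
    {F F' W W' e : ℝ} (hF' : β * F' = -(4 * (β + 1) / β) * W' ^ 2) (hF : β * F = -2 * (W' * W))
    (ξ ζ : Euc d) :
    β * bil A ξ ((F' * e ^ 2) • ξ + F • ((2 * e) • ζ)) +
      bil A ((W' * e) • ξ + W • ζ) ((W' * e) • ξ + W • ζ) ≤ 4 * (W ^ 2 * bil A ζ ζ) := by
  have h1 := hA.two_mul_abs_le ((W' * e) • ξ) (W • ζ)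
  have h2 := neg_abs_le (bil A ((W' * e) • ξ) (W • ζ))
  have h3 := hA.nonneg ((W' * e) • ξ)
  have h7 := hA.nonneg (W • ζ)
  simp only [bil_add_left, bil_add_right, bil_smul_left, bil_smul_right] at h1 h2 h3 h7 ⊢
  rw [bil_comm hA.symm ζ ξ]
  have h4 : β * (F' * e ^ 2 * bil A ξ ξ + F * (2 * e * bil A ξ ζ)) =
      (β * F') * (e ^ 2 * bil A ξ ξ) + (β * F) * (2 * e * bil A ξ ζ) := by ring
  rw [h4, hF', hF]
  have h5 : 4 * (β + 1) / β = 4 + 4 / β := by field_simp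
  rw [h5]
  -- With `P = W' e ξ` and `Q = W ζ`, the left side is `-(3 + 4/β) A(P,P) - 2 A(P,Q) + A(Q,Q)`.
  -- Dropping the `4/β` term makes the final constant independent of `β`.
  have h6 : 0 ≤ 4 / β * (W' * e * (W' * e * bil A ξ ξ)) := by positivity
  generalize 4 / β = c at h6 ⊢
  linarith

/-- The Caccioppoli estimate for negative powers of a positive supercaloric function. -/
lemma IsSupercaloric.caccioppoli (h : IsIntegrableField a lam Lam) (hI : IsOpen I)
    (hu : IsSupercaloric a Lam I (Metric.ball x r) u)
    (hpos : ∀ t ∈ I, ∀ᵐ y ∂(volume.restrict (Metric.ball x r)), 0 < u t y)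
    (hη : IsTest (Metric.ball x r) η) (hηR : tsupport η ⊆ Metric.ball x R) (hRr : R ≤ r)
    (hL : ∀ y, ‖gradient η y‖ ≤ L)
    (hε : 0 < ε) (hβ : 0 < β) (ht : t ∈ I) :
    ∃ g, HasFormGradient a Lam (Metric.ball x r) (fun y => shiftPow ε (β / 2) (u t y) * η y) g ∧
      deriv (fun t' => ∫ y in Metric.ball x r, shiftPow ε β (u t' y) * η y ^ 2 ∂(weighted Lam)) t +
        (fieldEnergy a g).toReal ≤
      4 * L ^ 2 * ∫ y in Metric.ball x R, shiftPow ε β (u t y) ∂(weighted Lam) := by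
  have := h.isFiniteMeasure_restrict x r
  have := h.isFiniteMeasure_restrict x R
  obtain ⟨C, hC⟩ := exists_isBddSmooth_shiftPow hε hβ
  obtain ⟨C₁, hC₁⟩ := exists_isBddSmooth_shiftPow hε (by linarith : 0 < β + 1)
  obtain ⟨C₂, hC₂⟩ := exists_isBddSmooth_shiftPow hε (half_pos hβ)
  have hgr := hasFormGradient_formGrad (hu.mem_domain t ht)
  set g := formGrad a Lam (u t) with hg
  have hw := hgr.comp_mul_test h hC₂ hη
  have hφ := hgr.comp_mul_test h hC₁ hη.sq
  refine ⟨_, hw, ?_⟩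
  set gw : Euc d → Euc d := fun y => (deriv (shiftPow ε (β / 2)) (u t y) * η y) • g y +
    shiftPow ε (β / 2) (u t y) • gradient η y with hgw
  set gφ : Euc d → Euc d := fun y => (deriv (shiftPow ε (β + 1)) (u t y) * η y ^ 2) • g y +
    shiftPow ε (β + 1) (u t y) • gradient (fun y => η y ^ 2) y with hgφ
  set φ : Euc d → ℝ := fun y => shiftPow ε (β + 1) (u t y) * η y ^ 2 with hφdef
  have hposB := hpos t ht
  have hposμ := (h.ae_weighted_restrict_iff x r).2 hposB
  rw [ae_restrict_iff' measurableSet_ball] at hposB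
  obtain ⟨Cη, -, -, -, hCη, -⟩ := hη.sq.exists_bound
  have hE := (hu.isWeaklyDiff.hasDerivAt_comp hI hC (ψ := fun y => η y ^ 2)
    hη.sq.smooth.continuous.aestronglyMeasurable ((abs_nonneg _).trans (hCη x)) hCη ht).deriv
  -- Up to the factor `-β`, the linearization is the functional `(u t', φ)_Λ` with `φ` frozen at
  -- time `t`. Positivity of `u t` is needed only at this one time.
  have hD : deriv (fun t' => ∫ y in Metric.ball x r, u t' y *
      (deriv (shiftPow ε β) (u t y) * η y ^ 2) ∂(weighted Lam)) t =
      -β * deriv (fun t' => ∫ y in Metric.ball x r, u t' y * φ y ∂(weighted Lam)) t := by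
    rw [← deriv_const_mul_field]
    congr 1
    ext t'
    rw [← integral_const_mul]
    refine integral_congr_ae ?_
    filter_upwards [hposμ] with y hy
    rw [(shiftPow_identities hε hβ hy).1]
    simp only [hφdef]
    ring
  have hineq := hu.inequality φ ⟨gφ, hφ⟩ (Eventually.of_forall fun y =>
    mul_nonneg (shiftPow_pos hε).le (sq_nonneg _)) t ht
  have hen : energy a Lam (u t) φ = ∫ y, bil (a y) (g y) (gφ y) := by
    refine integral_congr_ae ?_
    filter_upwards [hφ.formGrad_ae_eq h] with y hy
    rw [hy]
  rw [hE, hD]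
  have hi1 : Integrable (fun y => bil (a y) (g y) (gφ y)) := h.integrable_bil hgr.measurable_grad
    (hgr.fieldEnergy_lt_top h) hφ.measurable_grad (hφ.fieldEnergy_lt_top h)
  have hi2 : Integrable (fun y => bil (a y) (gw y) (gw y)) :=
    h.integrable_bil_self hw.measurable_grad (hw.fieldEnergy_lt_top h)
  have hi3 : IntegrableOn (fun y => shiftPow ε β (u t y)) (Metric.ball x R) (weighted Lam) := by
    refine Integrable.of_bound (hC.smooth.continuous.comp_aestronglyMeasurable
      hgr.memLp.1.restrict) C (Eventually.of_forall fun y => hC.bound _)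
  -- The energy is an integral against `dx` and the mass one against `Λ dx`; moving `Λ` into the
  -- integrand allows a pointwise comparison.
  have hi4 : IntegrableOn (fun y => (ENNReal.ofReal (Lam y)).toReal • shiftPow ε β (u t y))
      (Metric.ball x R) volume := by
    rw [IntegrableOn, weighted, restrict_withDensity measurableSet_ball] at hi3
    exact (integrable_withDensity_iff_integrable_smul' h.measurable_ofReal_Lam
      (Eventually.of_forall fun y => ENNReal.ofReal_lt_top)).1 hi3
  have hint : ∫ y in Metric.ball x R, shiftPow ε β (u t y) ∂(weighted Lam) =
      ∫ y in Metric.ball x R, (ENNReal.ofReal (Lam y)).toReal • shiftPow ε β (u t y) :=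
    setIntegral_withDensity_eq_setIntegral_toReal_smul h.measurable_ofReal_Lam
      (Eventually.of_forall fun y => ENNReal.ofReal_lt_top) _ measurableSet_ball
  have hmain : β * energy a Lam (u t) φ + (fieldEnergy a gw).toReal ≤
      4 * L ^ 2 * ∫ y in Metric.ball x R, shiftPow ε β (u t y) ∂(weighted Lam) := by
    rw [hen, ← h.integral_bil_self hw.measurable_grad, ← integral_const_mul, hint,
      ← integral_const_mul, ← integral_indicator measurableSet_ball,
      ← integral_add (hi1.const_mul β) hi2]
    refine integral_mono_ae ((hi1.const_mul β).add hi2)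
      ((integrable_indicator_iff measurableSet_ball).2 (hi4.const_mul _)) ?_
    filter_upwards [hposB, h.isNonnegForm, h.bounds] with y hy hA hb
    by_cases hyR : y ∈ Metric.ball x R
    · have hy' := hy (Metric.ball_subset_ball hRr hyR)
      obtain ⟨-, h2, h3⟩ := shiftPow_identities hε hβ hy'
      have h4 := caccioppoli_pointwise hA hβ h2 h3 (e := η y) (g y) (gradient η y)
      rw [indicator_of_mem hyR]
      simp only [hgφ, hgw, gradient_sq hη.differentiable]
      refine h4.trans ?_
      rw [ENNReal.toReal_ofReal (h.Lam_nonneg y), smul_eq_mul, ← Real.rpow_natCast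
        (shiftPow ε (β / 2) (u t y)), shiftPow_rpow hε]
      have h5 : bil (a y) (gradient η y) (gradient η y) ≤ Lam y * L ^ 2 := by
        refine (hb _).2.trans (mul_le_mul_of_nonneg_left ?_ (h.Lam_nonneg y))
        exact pow_le_pow_left₀ (norm_nonneg _) (hL y) 2
      have h6 : β / 2 * ((2 : ℕ) : ℝ) = β := by push_cast; ring
      rw [h6]
      have h7 := mul_le_mul_of_nonneg_left h5 (shiftPow_pos hε (β := β) (s := u t y)).le
      linarith
    · have h5 : y ∉ tsupport η := fun hy' => hyR (hηR hy')
      rw [indicator_of_notMem hyR]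
      simp only [hgφ, hgw, gradient_sq hη.differentiable, gradient_eq_zero_of_notMem h5,
        image_eq_zero_of_notMem_tsupport h5]
      simp [bil]
  nlinarith

/-- The weighted Sobolev inequality for cut off negative powers. -/
lemma shiftPow_sobolev {p q : ℝ≥0∞} (hpq : IsAdmissible d p q) (h : IsIntegrableField a lam Lam)
    {v : Euc d → ℝ} (hv : AEStronglyMeasurable v (weighted Lam))
    (hη : IsTest (Metric.ball x r) η) (hη0 : ∀ y, 0 ≤ η y) (hη1 : ∀ y, η y ≤ 1)
    (hε : 0 < ε) (hβ : 0 < β) {K : ℝ} (hK : 0 ≤ K) {e : ℝ≥0∞} (he : e < ∞)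
    (hS : eLpNorm (fun y => shiftPow ε (β / 2) (v y) * η y)
      (ENNReal.ofReal (2 / (2 - nu d p q))) (weighted Lam) ^ (2 : ℝ) ≤ ENNReal.ofReal K * e) :
    (∫ y in Metric.ball x r, shiftPow ε (β / (2 - nu d p q)) (v y) * η y ^ (2 / (2 - nu d p q))
      ∂(weighted Lam)) ^ (2 - nu d p q) ≤ K * e.toReal := by
  have := h.isFiniteMeasure_restrict x r
  have hν := sub_pos.2 hpq.nu_lt_two
  have hm : 0 < 2 / (2 - nu d p q) := div_pos two_pos hν
  obtain ⟨C, hC⟩ := exists_isBddSmooth_shiftPow hε (div_pos hβ hν)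
  have hnn : ∀ y, 0 ≤ shiftPow ε (β / (2 - nu d p q)) (v y) * η y ^ (2 / (2 - nu d p q)) :=
    fun y => mul_nonneg (shiftPow_pos hε).le (Real.rpow_nonneg (hη0 y) _)
  have hint : IntegrableOn (fun y => shiftPow ε (β / (2 - nu d p q)) (v y) *
      η y ^ (2 / (2 - nu d p q))) (Metric.ball x r) (weighted Lam) := by
    refine Integrable.of_bound ((hC.smooth.continuous.comp_aestronglyMeasurable hv.restrict).mul
      (hη.smooth.continuous.rpow_const fun _ => Or.inr hm.le).aestronglyMeasurable) C
      (Eventually.of_forall fun y => ?_)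
    rw [norm_mul]
    have h1 : ‖η y ^ (2 / (2 - nu d p q))‖ ≤ 1 := by
      rw [Real.norm_of_nonneg (Real.rpow_nonneg (hη0 y) _)]
      exact Real.rpow_le_one (hη0 y) (hη1 y) hm.le
    exact (mul_le_mul (hC.bound _) h1 (norm_nonneg _) hC.nonneg).trans_eq (mul_one C)
  have hsupp : (Function.support fun y => shiftPow ε (β / 2) (v y) * η y) ⊆ Metric.ball x r :=
    fun y hy => hη.support (subset_tsupport _ (right_ne_zero_of_mul hy))
  rw [← eLpNorm_restrict_eq_of_support_subset hsupp, eLpNorm_eq_lintegral_rpow_enorm_toReal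
    (by simpa using hm) (by simp), ENNReal.toReal_ofReal hm.le, ← ENNReal.rpow_mul] at hS
  have h2 : ∀ y, ‖shiftPow ε (β / 2) (v y) * η y‖ₑ ^ (2 / (2 - nu d p q)) =
      ENNReal.ofReal (shiftPow ε (β / (2 - nu d p q)) (v y) * η y ^ (2 / (2 - nu d p q))) := by
    intro y
    rw [Real.enorm_eq_ofReal (mul_nonneg (shiftPow_pos hε).le (hη0 y)),
      ENNReal.ofReal_rpow_of_nonneg (mul_nonneg (shiftPow_pos hε).le (hη0 y)) hm.le,
      Real.mul_rpow (shiftPow_pos hε).le (hη0 y), shiftPow_rpow hε]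
    congr 3
    field_simp
  simp only [h2] at hS
  rw [← ofReal_integral_eq_lintegral_ofReal hint (Eventually.of_forall hnn)] at hS
  have h3 : 1 / (2 / (2 - nu d p q)) * 2 = 2 - nu d p q := by field_simp
  have h0 : 0 ≤ ∫ y in Metric.ball x r, shiftPow ε (β / (2 - nu d p q)) (v y) *
      η y ^ (2 / (2 - nu d p q)) ∂(weighted Lam) := integral_nonneg hnn
  rw [h3, ENNReal.ofReal_rpow_of_nonneg h0 hν.le] at hS
  have h4 := ENNReal.toReal_mono (ENNReal.mul_ne_top ENNReal.ofReal_ne_top he.ne) hS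
  rwa [ENNReal.toReal_mul, ENNReal.toReal_ofReal (Real.rpow_nonneg h0 _),
    ENNReal.toReal_ofReal hK] at h4

end Caccioppoli

/-! ### Integrating the energy inequality in time. -/

section TimeStep

/-- Integrating a differential inequality in time, starting from a good time slice. -/
lemma time_step {t₁ t₂ s K M : ℝ} (h12 : t₁ < t₂) (h2s : t₂ < s) (hK : 0 < K) (hM : 0 ≤ M)
    {E E' φ S : ℝ → ℝ} (hE : ∀ t ∈ Ioo t₁ s, HasDerivAt E (E' t) t)
    (hE' : ∀ t ∈ Ioo t₁ s, E' t + S t / K ≤ M * φ t) (hE0 : ∀ t ∈ Ioo t₁ s, 0 ≤ E t)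
    (hEφ : ∀ t ∈ Ioo t₁ s, E t ≤ φ t) (hS0 : ∀ t ∈ Ioo t₁ s, 0 ≤ S t)
    (hS : ContinuousOn S (Ioo t₁ s)) (hφ : IntegrableOn φ (Ioo t₁ s)) {T : ℝ} (hT : T ∈ Ioo t₂ s) :
    E T ≤ (1 / (t₂ - t₁) + M) * ∫ t in Ioo t₁ s, φ t ∧
      ∫ t in t₂..T, S t ≤ K * ((1 / (t₂ - t₁) + M) * ∫ t in Ioo t₁ s, φ t) := by
  set V := ∫ t in Ioo t₁ s, φ t with hV
  have hφ0 : ∀ t ∈ Ioo t₁ s, 0 ≤ φ t := fun t ht => (hE0 t ht).trans (hEφ t ht)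
  have hsub : Ioo t₁ t₂ ⊆ Ioo t₁ s := Ioo_subset_Ioo_right h2s.le
  have hmono : ∀ {J : Set ℝ}, MeasurableSet J → J ⊆ Ioo t₁ s → ∫ t in J, φ t ≤ V :=
    fun hJ hJs => setIntegral_mono_set hφ
      ((ae_restrict_iff' measurableSet_Ioo).2 (Eventually.of_forall hφ0)) hJs.eventuallyLE
  -- A time at which `φ` is at most its average over `(t₁, t₂)`. Starting there replaces a cutoff in
  -- time and produces the term `1 / (t₂ - t₁)`.
  obtain ⟨t₀, ht₀, ht₀V⟩ : ∃ t₀ ∈ Ioo t₁ t₂, φ t₀ ≤ 1 / (t₂ - t₁) * V := by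
    obtain ⟨t₀, ht₀, h1⟩ := exists_le_setAverage (μ := volume) (s := Ioo t₁ t₂) (f := φ)
      (by simpa using h12) (by simp) (hφ.mono_set hsub)
    refine ⟨t₀, ht₀, h1.trans ?_⟩
    rw [setAverage_eq, smul_eq_mul, measureReal_def, Real.volume_Ioo,
      ENNReal.toReal_ofReal (by linarith), one_div]
    exact mul_le_mul_of_nonneg_left (hmono measurableSet_Ioo hsub) (by
      rw [inv_nonneg]; linarith)
  have h0T : t₀ < T := ht₀.2.trans hT.1
  have hIcc : Icc t₀ T ⊆ Ioo t₁ s := fun t ht => ⟨ht₀.1.trans_le ht.1, ht.2.trans_lt hT.2⟩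
  have hSi : IntegrableOn S (Icc t₀ T) := (hS.mono hIcc).integrableOn_Icc
  have hφi : IntegrableOn φ (Icc t₀ T) := hφ.mono_set hIcc
  -- Only the upper bound on `E'` has to be integrable; nothing is known about integrability of `E'`
  -- itself.
  have h3 := intervalIntegral.sub_le_integral_of_hasDeriv_right_of_le h0T.le
    (fun t ht => (hE t (hIcc ht)).continuousAt.continuousWithinAt)
    (fun t ht => (hE t (hIcc (Ioo_subset_Icc_self ht))).hasDerivWithinAt)
    (φ := fun t => M * φ t - S t / K)
    ((hφi.const_mul M).sub (hSi.div_const K))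
    (fun t ht => by linarith [hE' t (hIcc (Ioo_subset_Icc_self ht))])
  have hSii : IntervalIntegrable S volume t₀ T :=
    (intervalIntegrable_iff_integrableOn_Icc_of_le h0T.le).2 hSi
  have hφii : IntervalIntegrable φ volume t₀ T :=
    (intervalIntegrable_iff_integrableOn_Icc_of_le h0T.le).2 hφi
  rw [intervalIntegral.integral_sub (hφii.const_mul M) (hSii.div_const K),
    intervalIntegral.integral_const_mul, intervalIntegral.integral_div] at h3
  have h4 : ∫ t in t₀..T, φ t ≤ V := by
    rw [intervalIntegral.integral_of_le h0T.le]
    exact hmono measurableSet_Ioc (Ioc_subset_Icc_self.trans hIcc)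
  have h5 : ∫ t in t₂..T, S t ≤ ∫ t in t₀..T, S t := by
    rw [intervalIntegral.integral_of_le h0T.le, intervalIntegral.integral_of_le hT.1.le]
    refine setIntegral_mono_set (hSi.mono_set Ioc_subset_Icc_self)
      ((ae_restrict_iff' measurableSet_Ioc).2 (Eventually.of_forall fun t ht =>
        hS0 t (hIcc (Ioc_subset_Icc_self ht)))) (Ioc_subset_Ioc_left ht₀.2.le).eventuallyLE
  have h6 : 0 ≤ ∫ t in t₂..T, S t := by
    rw [intervalIntegral.integral_of_le hT.1.le]
    exact setIntegral_nonneg measurableSet_Ioc fun t ht =>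
      hS0 t ⟨h12.trans ht.1, ht.2.trans_lt hT.2⟩
  have h7 : M * ∫ t in t₀..T, φ t ≤ M * V := mul_le_mul_of_nonneg_left h4 hM
  have h8 := hEφ t₀ (hsub ht₀)
  have h9 : 0 ≤ (∫ t in t₀..T, S t) / K := div_nonneg (h6.trans h5) hK.le
  have h10 := hE0 T ⟨h12.trans hT.1, hT.2⟩
  constructor
  · linarith
  · have h11 : (∫ t in t₀..T, S t) / K ≤ (1 / (t₂ - t₁) + M) * V := by linarith
    rw [div_le_iff₀ hK] at h11
    linarith

/-- Continuity of the primitive at the endpoint. It is needed because `time_step` only reaches times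
`T < s`, where the interval stays compactly inside the cylinder. -/
lemma setIntegral_Ioo_le_of_forall {t₂ s A : ℝ} (h2s : t₂ < s) {ψ : ℝ → ℝ}
    (hψ : IntegrableOn ψ (Ioo t₂ s)) (h : ∀ T ∈ Ioo t₂ s, ∫ t in t₂..T, ψ t ≤ A) :
    ∫ t in Ioo t₂ s, ψ t ≤ A := by
  have hi : IntegrableOn ψ (uIcc t₂ s) := by
    rw [uIcc_of_le h2s.le]
    rwa [integrableOn_Icc_iff_integrableOn_Ioo]
  have h1 := (intervalIntegral.continuousOn_primitive_interval hi) s right_mem_uIcc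
  rw [uIcc_of_le h2s.le] at h1
  have h2 : Tendsto (fun T => ∫ t in t₂..T, ψ t) (𝓝[Ioo t₂ s] s) (𝓝 (∫ t in t₂..s, ψ t)) :=
    h1.mono Ioo_subset_Icc_self
  rw [intervalIntegral.integral_of_le h2s.le, integral_Ioc_eq_integral_Ioo] at h2
  have : (𝓝[Ioo t₂ s] s).NeBot := by
    rw [nhdsWithin_Ioo_eq_nhdsLT h2s]; infer_instance
  exact le_of_tendsto h2 (eventually_mem_nhdsWithin.mono fun T hT => h T hT)

end TimeStep

/-! ### One step of the iteration. -/

section MoserStep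

variable {d : ℕ} {a : Euc d → Matrix (Fin d) (Fin d) ℝ} {lam Lam : Euc d → ℝ}
  {x : Euc d} {r : ℝ} {I : Set ℝ} {u : ℝ → Euc d → ℝ} {η : Euc d → ℝ} {ε β δ δ' : ℝ}

/-- The weighted integral of `(u t + ε) ^ (-β)` over the ball of radius `R`. -/
def slice (Lam : Euc d → ℝ) (u : ℝ → Euc d → ℝ) (x : Euc d) (ε β R t : ℝ) : ℝ :=
  ∫ y in Metric.ball x R, shiftPow ε β (u t y) ∂(weighted Lam)

lemma slice_nonneg (hε : 0 < ε) (R t : ℝ) : 0 ≤ slice Lam u x ε β R t :=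
  integral_nonneg fun _ => (shiftPow_pos hε).le

lemma IsSupercaloric.aestronglyMeasurable {G : Set (Euc d)} (hu : IsSupercaloric a Lam I G u)
    {t : ℝ} (ht : t ∈ I) : AEStronglyMeasurable (u t) (weighted Lam) := by
  obtain ⟨g, hg⟩ := hu.mem_domain t ht
  exact hg.memLp.1

lemma IsIntegrableField.integrableOn_shiftPow (h : IsIntegrableField a lam Lam) {v : Euc d → ℝ}
    (hv : AEStronglyMeasurable v (weighted Lam)) (hε : 0 < ε) (hβ : 0 < β) (R : ℝ) :
    IntegrableOn (fun y => shiftPow ε β (v y)) (Metric.ball x R) (weighted Lam) := by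
  have := h.isFiniteMeasure_restrict x R
  obtain ⟨C, hC⟩ := exists_isBddSmooth_shiftPow hε hβ
  exact Integrable.of_bound (hC.smooth.continuous.comp_aestronglyMeasurable hv.restrict) C
    (Eventually.of_forall fun y => hC.bound _)

lemma IsSupercaloric.differentiableAt_shiftPow (h : IsIntegrableField a lam Lam) (hI : IsOpen I)
    (hu : IsSupercaloric a Lam I (Metric.ball x r) u) (hε : 0 < ε) (hβ : 0 < β) {ψ : Euc d → ℝ}
    (hψ : Measurable ψ) {C : ℝ} (hC0 : 0 ≤ C) (hC : ∀ y, |ψ y| ≤ C) {t : ℝ} (ht : t ∈ I) :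
    DifferentiableAt ℝ (fun t => ∫ y in Metric.ball x r, shiftPow ε β (u t y) * ψ y
      ∂(weighted Lam)) t := by
  have := h.isFiniteMeasure_restrict x r
  obtain ⟨C', hC'⟩ := exists_isBddSmooth_shiftPow hε hβ
  exact (hu.isWeaklyDiff.hasDerivAt_comp hI hC' hψ.aestronglyMeasurable hC0 hC ht).differentiableAt

/-- The chain rule in time admits any bounded measurable `ψ`, in particular the indicator of the
ball, so the slice is continuous in time; it is also bounded. No joint measurability of `u` is
required. -/
lemma IsSupercaloric.integrableOn_slice (h : IsIntegrableField a lam Lam) (hI : IsOpen I)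
    (hIf : volume I ≠ ∞)
    (hu : IsSupercaloric a Lam I (Metric.ball x r) u) (hε : 0 < ε) (hβ : 0 < β) {R : ℝ}
    (hR : R ≤ r) : IntegrableOn (slice Lam u x ε β R) I := by
  have hind : ∀ t, slice Lam u x ε β R t = ∫ y in Metric.ball x r, shiftPow ε β (u t y) *
      (Metric.ball x R).indicator (fun _ => (1 : ℝ)) y ∂(weighted Lam) := by
    intro t
    have h1 : (fun y => shiftPow ε β (u t y) * (Metric.ball x R).indicator (fun _ => (1 : ℝ)) y) =
        (Metric.ball x R).indicator fun y => shiftPow ε β (u t y) := by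
      ext y
      by_cases hy : y ∈ Metric.ball x R <;> simp [hy]
    rw [slice, h1, setIntegral_indicator measurableSet_ball,
      inter_eq_self_of_subset_right (Metric.ball_subset_ball hR)]
  obtain ⟨C, hC⟩ := exists_isBddSmooth_shiftPow hε hβ
  have := h.isFiniteMeasure_restrict x R
  have hcont : ContinuousOn (slice Lam u x ε β R) I := by
    intro t ht
    have h2 := (hu.differentiableAt_shiftPow h hI hε hβ (ψ := (Metric.ball x R).indicator fun _ => (1 : ℝ))
      (measurable_const.indicator measurableSet_ball) zero_le_one (fun y => by
        by_cases hy : y ∈ Metric.ball x R <;> simp [hy]) ht).continuousAt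
    rw [funext hind]
    exact h2.continuousWithinAt
  have : IsFiniteMeasure (volume.restrict I) := ⟨by simpa using hIf.lt_top⟩
  refine Integrable.of_bound (hcont.aestronglyMeasurable hI.measurableSet)
    (C * ((weighted Lam).restrict (Metric.ball x R)).real univ) (Eventually.of_forall fun t => ?_)
  exact norm_integral_le_of_norm_le_const (Eventually.of_forall fun y => hC.bound _)

/-- Interpolation between the energy and the Sobolev exponent on a time slice. -/
lemma slice_nu_le {p q : ℝ≥0∞} (hpq : IsAdmissible d p q) (h : IsIntegrableField a lam Lam)
    {R : ℝ} {t : ℝ} (hv : AEStronglyMeasurable (u t) (weighted Lam)) (hε : 0 < ε) (hβ : 0 < β) :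
    slice Lam u x ε (nu d p q * β) R t ≤ slice Lam u x ε β R t ^ (nu d p q - 1) *
      slice Lam u x ε (β / (2 - nu d p q)) R t ^ (2 - nu d p q) := by
  set ν := nu d p q
  have h1 : 0 < ν - 1 := sub_pos.2 hpq.one_lt_nu
  have h2 : 0 < 2 - ν := sub_pos.2 hpq.nu_lt_two
  have hν : 0 < ν := by linarith
  have := h.isFiniteMeasure_restrict x R
  -- Hölder for `(u+ε)^(-νβ) = (u+ε)^(-β(ν-1)) (u+ε)^(-β)`; the exponents are conjugate because
  -- `(ν-1) + (2-ν) = 1`.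
  have hconj : (1 / (ν - 1)).HolderConjugate (1 / (2 - ν)) := by
    refine ⟨by simp; ring, by positivity, by positivity⟩
  have hmem : ∀ γ > 0, ∀ p, MemLp (fun y => shiftPow ε γ (u t y)) p
      ((weighted Lam).restrict (Metric.ball x R)) := by
    intro γ hγ p
    obtain ⟨C, hC⟩ := exists_isBddSmooth_shiftPow hε hγ
    exact MemLp.of_bound (hC.smooth.continuous.comp_aestronglyMeasurable hv.restrict) C
      (Eventually.of_forall fun y => hC.bound _)
  have h3 := integral_mul_le_Lp_mul_Lq_of_nonneg (μ := (weighted Lam).restrict (Metric.ball x R))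
    hconj (f := fun y => shiftPow ε (β * (ν - 1)) (u t y)) (g := fun y => shiftPow ε β (u t y))
    (Eventually.of_forall fun y => (shiftPow_pos hε).le)
    (Eventually.of_forall fun y => (shiftPow_pos hε).le)
    (hmem _ (by positivity) _) (hmem _ hβ _)
  have e1 : ∀ y, shiftPow ε (β * (ν - 1)) (u t y) * shiftPow ε β (u t y) =
      shiftPow ε (ν * β) (u t y) := by
    intro y
    rw [shiftPow, shiftPow, shiftPow, ← Real.rpow_add (regShift_pos hε)]
    congr 1
    ring
  have e2 : β * (ν - 1) * (1 / (ν - 1)) = β := by field_simp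
  have e3 : β * (1 / (2 - ν)) = β / (2 - ν) := by ring
  simp only [e1, shiftPow_rpow hε, e2, e3, one_div_one_div] at h3
  exact h3

/-- One step of the Moser iteration. -/
lemma IsSupercaloric.moser_step {p q : ℝ≥0∞} (hpq : IsAdmissible d p q)
    (h : IsIntegrableField a lam Lam) {τ s : ℝ} (hτ : 0 < τ) (hr : 0 < r)
    (hu : IsSupercaloric a Lam (cylTime τ s r 1) (Metric.ball x r) u)
    (hpos : ∀ t ∈ cylTime τ s r 1, ∀ᵐ y ∂(volume.restrict (Metric.ball x r)), 0 < u t y)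
    {K : ℝ} (hK : 0 < K) (hS : ∀ v g, HasFormGradient a Lam (Metric.ball x r) v g →
      eLpNorm v (ENNReal.ofReal (2 / (2 - nu d p q))) (weighted Lam) ^ (2 : ℝ) ≤
        ENNReal.ofReal K * fieldEnergy a g)
    (hδ' : 0 < δ') (hδδ' : δ' < δ) (hδ : δ ≤ 1) (hε : 0 < ε) (hβ : 0 < β) {L : ℝ}
    (hη : IsCutoff x (δ' * r) (δ * r) L η) {X : ℝ}
    (hX : (1 / ((δ - δ') * τ * r ^ 2) + 4 * L ^ 2) *
      ∫ t in cylTime τ s r δ, slice Lam u x ε β (δ * r) t ≤ X) :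
    (∀ T ∈ cylTime τ s r δ', slice Lam u x ε β (δ' * r) T ≤ X) ∧
      ∫ t in cylTime τ s r δ', slice Lam u x ε (nu d p q * β) (δ' * r) t ≤ K * X ^ nu d p q := by
  have hI : IsOpen (cylTime τ s r 1) := isOpen_Ioo
  set ν := nu d p q with hν
  have h1 : 0 < ν - 1 := sub_pos.2 hpq.one_lt_nu
  have h2 : 0 < 2 - ν := sub_pos.2 hpq.nu_lt_two
  have hm : 0 < 2 / (2 - ν) := div_pos two_pos h2
  have hδ0 : 0 < δ := hδ'.trans hδδ'
  have hc : 0 < τ * r ^ 2 := by positivity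
  have hδr : δ * r ≤ r := by nlinarith
  have hδ'r : δ' * r ≤ δ * r := by nlinarith
  have ht12 : s - δ * τ * r ^ 2 < s - δ' * τ * r ^ 2 := by nlinarith
  have ht2s : s - δ' * τ * r ^ 2 < s := by nlinarith
  have hsub1 : cylTime τ s r δ ⊆ cylTime τ s r 1 := Ioo_subset_Ioo_left (by nlinarith)
  have hsub2 : cylTime τ s r δ' ⊆ cylTime τ s r δ := Ioo_subset_Ioo_left ht12.le
  have hηB : IsTest (Metric.ball x r) η := hη.test.mono (Metric.ball_subset_ball hδr)
  have hηm : Continuous fun y => η y ^ (2 / (2 - ν)) :=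
    hη.test.smooth.continuous.rpow_const fun _ => Or.inr hm.le
  have hη1 : ∀ y, |η y ^ (2 / (2 - ν))| ≤ 1 := fun y => by
    rw [abs_of_nonneg (Real.rpow_nonneg (hη.nonneg y) _)]
    exact Real.rpow_le_one (hη.nonneg y) (hη.le_one y) hm.le
  have hη2 : ∀ y, |η y ^ 2| ≤ 1 := fun y => by
    rw [abs_of_nonneg (sq_nonneg _)]
    exact pow_le_one₀ (hη.nonneg y) (hη.le_one y)
  have := h.isFiniteMeasure_restrict x r
  set E : ℝ → ℝ := fun t => ∫ y in Metric.ball x r, shiftPow ε β (u t y) * η y ^ 2 ∂(weighted Lam)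
    with hEdef
  set P : ℝ → ℝ := fun t => ∫ y in Metric.ball x r,
    shiftPow ε (β / (2 - ν)) (u t y) * η y ^ (2 / (2 - ν)) ∂(weighted Lam) with hPdef
  have hP0 : ∀ t, 0 ≤ P t := fun t => integral_nonneg fun y =>
    mul_nonneg (shiftPow_pos hε).le (Real.rpow_nonneg (hη.nonneg y) _)
  have hEd : ∀ t ∈ cylTime τ s r 1, DifferentiableAt ℝ E t := fun t ht =>
    hu.differentiableAt_shiftPow h hI hε hβ (hη.test.smooth.continuous.pow 2).measurable zero_le_one hη2 ht
  have hPc : ContinuousOn P (cylTime τ s r 1) := fun t ht =>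
    (hu.differentiableAt_shiftPow h hI hε (div_pos hβ h2) hηm.measurable zero_le_one hη1
      ht).continuousAt.continuousWithinAt
  have hint : ∀ γ > 0, ∀ t ∈ cylTime τ s r 1, ∀ R, IntegrableOn (fun y => shiftPow ε γ (u t y))
      (Metric.ball x R) (weighted Lam) := fun γ hγ t ht R =>
    h.integrableOn_shiftPow (hu.aestronglyMeasurable ht) hε hγ R
  have hlow : ∀ γ > 0, ∀ ψ : Euc d → ℝ, Continuous ψ → (∀ y, 0 ≤ ψ y) → (∀ y, |ψ y| ≤ 1) →
      (∀ y ∈ Metric.ball x (δ' * r), ψ y = 1) → ∀ t ∈ cylTime τ s r 1,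
      slice Lam u x ε γ (δ' * r) t ≤
        ∫ y in Metric.ball x r, shiftPow ε γ (u t y) * ψ y ∂(weighted Lam) := by
    intro γ hγ ψ hψc hψ0 hψ1 hψ t ht
    have e1 : slice Lam u x ε γ (δ' * r) t =
        ∫ y in Metric.ball x (δ' * r), shiftPow ε γ (u t y) * ψ y ∂(weighted Lam) :=
      setIntegral_congr_fun measurableSet_ball fun y hy => by simp [hψ y hy]
    rw [e1]
    refine setIntegral_mono_set ?_ (Eventually.of_forall fun y =>
      mul_nonneg (shiftPow_pos hε).le (hψ0 y)) (Metric.ball_subset_ball (hδ'r.trans hδr)).eventuallyLE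
    exact (hint γ hγ t ht r).mul_bdd (c := 1) hψc.aestronglyMeasurable (Eventually.of_forall hψ1)
  have hup : ∀ t ∈ cylTime τ s r 1, E t ≤ slice Lam u x ε β (δ * r) t := by
    intro t ht
    have e1 : slice Lam u x ε β (δ * r) t = ∫ y in Metric.ball x r,
        (Metric.ball x (δ * r)).indicator (fun y => shiftPow ε β (u t y)) y ∂(weighted Lam) := by
      rw [slice, setIntegral_indicator measurableSet_ball,
        inter_eq_self_of_subset_right (Metric.ball_subset_ball hδr)]
    rw [e1]
    refine integral_mono ?_ ?_ fun y => ?_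
    · exact (hint β hβ t ht r).mul_bdd (c := 1) (hη.test.smooth.continuous.pow 2).aestronglyMeasurable
        (Eventually.of_forall hη2)
    · exact (hint β hβ t ht r).indicator measurableSet_ball
    · by_cases hy : y ∈ Metric.ball x (δ * r)
      · rw [indicator_of_mem hy]
        exact mul_le_of_le_one_right (shiftPow_pos hε).le ((le_abs_self _).trans (hη2 y))
      · rw [indicator_of_notMem hy]
        have : η y = 0 := image_eq_zero_of_notMem_tsupport fun hy' => hy (hη.test.support hy')
        simp [this]
  have hdiff : ∀ t ∈ cylTime τ s r 1, deriv E t + P t ^ (2 - ν) / K ≤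
      4 * L ^ 2 * slice Lam u x ε β (δ * r) t := by
    intro t ht
    obtain ⟨g, hg, hg'⟩ := hu.caccioppoli h hI hpos hηB hη.test.support hδr hη.gradient_le hε hβ ht
    have h3 := shiftPow_sobolev hpq h (hu.aestronglyMeasurable ht) hηB hη.nonneg hη.le_one hε hβ
      hK.le (hg.fieldEnergy_lt_top h) (hS _ _ hg)
    have h4 : P t ^ (2 - ν) / K ≤ (fieldEnergy a g).toReal := by
      rw [div_le_iff₀ hK, mul_comm]; exact h3
    exact (add_le_add_right h4 _).trans hg'
  have hI1 : volume (cylTime τ s r 1) ≠ ∞ := by simp [cylTime]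
  have hstep : ∀ T ∈ cylTime τ s r δ', _ := fun T hT => time_step (E := E) (E' := deriv E)
    (φ := slice Lam u x ε β (δ * r)) (S := fun t => P t ^ (2 - ν)) (M := 4 * L ^ 2) ht12 ht2s hK
    (by positivity) (fun t ht => (hEd t (hsub1 ht)).hasDerivAt) (fun t ht => hdiff t (hsub1 ht))
    (fun t ht => integral_nonneg fun y => mul_nonneg (shiftPow_pos hε).le (sq_nonneg _))
    (fun t ht => hup t (hsub1 ht)) (fun t ht => Real.rpow_nonneg (hP0 t) _)
    ((hPc.mono hsub1).rpow_const fun t ht => Or.inr h2.le)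
    ((hu.integrableOn_slice h hI hI1 hε hβ hδr).mono_set hsub1) hT
  have hgap : s - δ' * τ * r ^ 2 - (s - δ * τ * r ^ 2) = (δ - δ') * τ * r ^ 2 := by ring
  rw [hgap] at hstep
  have hX0 : 0 ≤ X := by
    refine le_trans (mul_nonneg ?_ (setIntegral_nonneg measurableSet_Ioo fun t _ =>
      slice_nonneg hε _ _)) hX
    have : 0 < δ - δ' := sub_pos.2 hδδ'
    positivity
  have hfirst : ∀ T ∈ cylTime τ s r δ', slice Lam u x ε β (δ' * r) T ≤ X := fun T hT =>
    (hlow β hβ (fun y => η y ^ 2) (hη.test.smooth.continuous.pow 2) (fun y => sq_nonneg _) hη2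
      (fun y hy => by rw [hη.eq_one y hy, one_pow]) T (hsub1 (hsub2 hT))).trans
      ((hstep T hT).1.trans hX)
  refine ⟨hfirst, ?_⟩
  -- The mass factor is bounded uniformly in time by `X`, and the Sobolev factor by `P`, whose power
  -- `2 - ν` has time integral at most `K X`. Together they give `X^(ν-1) · K X = K X^ν`.
  have hslice : ∀ t ∈ cylTime τ s r δ', slice Lam u x ε (ν * β) (δ' * r) t ≤
      X ^ (ν - 1) * P t ^ (2 - ν) := by
    intro t ht
    refine (slice_nu_le hpq h (hu.aestronglyMeasurable (hsub1 (hsub2 ht))) hε hβ).trans ?_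
    exact mul_le_mul (Real.rpow_le_rpow (slice_nonneg hε _ _) (hfirst t ht) h1.le)
      (Real.rpow_le_rpow (slice_nonneg hε _ _) (hlow _ (div_pos hβ h2) _ hηm
        (fun y => Real.rpow_nonneg (hη.nonneg y) _) hη1
        (fun y hy => by rw [hη.eq_one y hy, Real.one_rpow]) t (hsub1 (hsub2 ht))) h2.le)
      (Real.rpow_nonneg (slice_nonneg hε _ _) _) (Real.rpow_nonneg hX0 _)
  have hνβ : 0 < ν * β := mul_pos (by linarith) hβ
  refine setIntegral_Ioo_le_of_forall ht2s ((hu.integrableOn_slice h hI hI1 hε hνβ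
    (hδ'r.trans hδr)).mono_set (hsub2.trans hsub1)) fun T hT => ?_
  have hIcc : Icc (s - δ' * τ * r ^ 2) T ⊆ cylTime τ s r δ := fun t ht =>
    ⟨ht12.trans_le ht.1, ht.2.trans_lt hT.2⟩
  have hle : s - δ' * τ * r ^ 2 ≤ T := hT.1.le
  have hPi : IntervalIntegrable (fun t => P t ^ (2 - ν)) volume (s - δ' * τ * r ^ 2) T :=
    (intervalIntegrable_iff_integrableOn_Icc_of_le hle).2
      (((hPc.mono (hIcc.trans hsub1)).rpow_const fun t ht => Or.inr h2.le).integrableOn_Icc)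
  calc ∫ t in (s - δ' * τ * r ^ 2)..T, slice Lam u x ε (ν * β) (δ' * r) t
      ≤ ∫ t in (s - δ' * τ * r ^ 2)..T, X ^ (ν - 1) * P t ^ (2 - ν) := by
        refine intervalIntegral.integral_mono_on_of_le_Ioo hle ?_ (hPi.const_mul _) fun t ht =>
          hslice t ⟨ht.1, ht.2.trans hT.2⟩
        exact (intervalIntegrable_iff_integrableOn_Icc_of_le hle).2
          ((hu.integrableOn_slice h hI hI1 hε hνβ (hδ'r.trans hδr)).mono_set (hIcc.trans hsub1))
    _ = X ^ (ν - 1) * ∫ t in (s - δ' * τ * r ^ 2)..T, P t ^ (2 - ν) :=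
        intervalIntegral.integral_const_mul _ _
    _ ≤ X ^ (ν - 1) * (K * X) := by
        gcongr
        exact (hstep T hT).2.trans (mul_le_mul_of_nonneg_left hX hK.le)
    _ = K * X ^ ν := by
        have e1 : X ^ ν = X ^ (ν - 1) * X := by
          rcases hX0.eq_or_lt with h0 | h0
          · rw [← h0, Real.zero_rpow (by linarith), mul_zero]
          · rw [← Real.rpow_add_one h0.ne', sub_add_cancel]
        rw [e1]; ring

end MoserStep

/-! ### The nonlinear recursion and the passage to `L^∞`. -/

section Iteration

/-- The limit constant of the iteration `V (k + 1) ≤ A (b ^ k D V k) ^ ν`. -/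
def iterConst (b A D ν : ℝ) : ℝ := (b ^ (ν / (ν - 1)) * A * D ^ ν) ^ (1 / (ν - 1))

variable {b A D ν : ℝ}

lemma iterConst_pos (hb : 0 < b) (hA : 0 < A) (hD : 0 < D) : 0 < iterConst b A D ν :=
  Real.rpow_pos_of_pos (mul_pos (mul_pos (Real.rpow_pos_of_pos hb _) hA)
    (Real.rpow_pos_of_pos hD _)) _

/-- With `c = b^(ν/(ν-1))`, the identities `c^(ν-1) = b^ν` and `l^(ν-1) = c A D^ν` for `l =
iterConst b A D ν` absorb all constants: `l c^k V k` satisfies the bare recursion `Y (k+1) ≤ (Y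
k)^ν`. -/
lemma le_of_iteration (hb : 0 < b) (hA : 0 < A) (hD : 0 < D) (hν : 1 < ν) {V : ℕ → ℝ}
    (hV0 : ∀ k, 0 ≤ V k) (hV : ∀ k, V (k + 1) ≤ A * (b ^ k * D * V k) ^ ν) (k : ℕ) :
    iterConst b A D ν * (b ^ (ν / (ν - 1))) ^ k * V k ≤ (iterConst b A D ν * V 0) ^ (ν ^ k) := by
  set l := iterConst b A D ν with hl
  set c := b ^ (ν / (ν - 1)) with hc
  have hl0 : 0 < l := iterConst_pos hb hA hD
  have hc0 : 0 < c := Real.rpow_pos_of_pos hb _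
  have hν1 : 0 < ν - 1 := sub_pos.2 hν
  have hlν : l ^ ν = l * (c * A * D ^ ν) := by
    have h1 : l ^ (ν - 1) = c * A * D ^ ν := by
      rw [hl, iterConst, ← Real.rpow_mul (by positivity), one_div, inv_mul_cancel₀ hν1.ne',
        Real.rpow_one]
    rw [← h1, ← Real.rpow_one_add' hl0.le (by linarith)]
    congr 1
    ring
  have hcν : c ^ ν = c * b ^ ν := by
    have h1 : c ^ (ν - 1) = b ^ ν := by
      rw [hc, ← Real.rpow_mul hb.le, div_mul_cancel₀ _ hν1.ne']
    rw [← h1, ← Real.rpow_one_add' hc0.le (by linarith)]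
    congr 1
    ring
  induction k with
  | zero => simp
  | succ k ih =>
    have h0 : 0 ≤ l * c ^ k * V k := mul_nonneg (by positivity) (hV0 k)
    calc l * c ^ (k + 1) * V (k + 1) ≤ l * c ^ (k + 1) * (A * (b ^ k * D * V k) ^ ν) := by
          gcongr
          exact hV k
      _ = (l * c ^ k * V k) ^ ν := by
          rw [Real.mul_rpow (by positivity) (hV0 k), Real.mul_rpow (by positivity) (hV0 k),
            Real.mul_rpow (by positivity) (by positivity),
            Real.mul_rpow (by positivity) (by positivity), hlν, ← Real.rpow_pow_comm hb.le,
            ← Real.rpow_pow_comm hc0.le, hcν, mul_pow, pow_succ]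
          ring
      _ ≤ ((l * V 0) ^ (ν ^ k)) ^ ν := Real.rpow_le_rpow h0 ih (by linarith)
      _ = (l * V 0) ^ (ν ^ (k + 1)) := by
          rw [← Real.rpow_mul (mul_nonneg hl0.le (hV0 0)), pow_succ]

/-- For `N' > N`, Chebyshev's inequality bounds the measure of `{f ≥ N'}` by `M (N/N')^(ν^k)`, which
tends to `0`. The prefactor `M` leaves no trace in the limit. -/
lemma ae_le_of_integral_rpow_le {X : Type*} [MeasurableSpace X] {μ : Measure X} [IsFiniteMeasure μ]
    {f : X → ℝ} (hf : ∀ y, 0 ≤ f y) (hν : 1 < ν) {M N : ℝ} (hN : 0 ≤ N)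
    (hfi : ∀ k : ℕ, Integrable (fun y => f y ^ (ν ^ k)) μ)
    (h : ∀ k : ℕ, ∫ y, f y ^ (ν ^ k) ∂μ ≤ M * N ^ (ν ^ k)) : ∀ᵐ y ∂μ, f y ≤ N := by
  have hν0 : 0 < ν := by linarith
  have key : ∀ n : ℕ, ∀ᵐ y ∂μ, f y < N + 1 / ((n : ℝ) + 1) := by
    intro n
    set N' := N + 1 / ((n : ℝ) + 1) with hN'
    have hn : 0 < 1 / ((n : ℝ) + 1) := by positivity
    have hN0 : 0 < N' := by linarith
    have hle : ∀ k : ℕ, μ.real {y | N' ≤ f y} ≤ M * (N / N') ^ (ν ^ k) := by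
      intro k
      have hk : 0 < ν ^ k := pow_pos hν0 k
      have h1 := mul_meas_ge_le_integral_of_nonneg (μ := μ) (f := fun y => f y ^ (ν ^ k))
        (Eventually.of_forall fun y => Real.rpow_nonneg (hf y) _) (hfi k) (N' ^ (ν ^ k))
      have h2 : {y | N' ^ (ν ^ k) ≤ f y ^ (ν ^ k)} = {y | N' ≤ f y} := by
        ext y
        exact Real.rpow_le_rpow_iff hN0.le (hf y) hk
      rw [h2] at h1
      have h3 : 0 < N' ^ (ν ^ k) := Real.rpow_pos_of_pos hN0 _
      rw [Real.div_rpow hN hN0.le, ← mul_div_assoc, le_div_iff₀ h3, mul_comm]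
      exact h1.trans (h k)
    have hlim : Tendsto (fun k : ℕ => M * (N / N') ^ (ν ^ k)) atTop (𝓝 (M * 0)) := by
      refine Tendsto.const_mul _ ((tendsto_rpow_atTop_of_base_lt_one _ ?_ ?_).comp
        (tendsto_pow_atTop_atTop_of_one_lt hν))
      · exact lt_of_lt_of_le (by norm_num) (div_nonneg hN hN0.le)
      · rw [div_lt_one hN0]; linarith
    rw [mul_zero] at hlim
    have h4 : μ.real {y | N' ≤ f y} = 0 :=
      le_antisymm (ge_of_tendsto' hlim hle) measureReal_nonneg
    rw [measureReal_eq_zero_iff] at h4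
    rw [ae_iff]
    simpa using h4
  filter_upwards [ae_all_iff.2 key] with y hy
  refine le_of_forall_pos_lt_add fun e he => ?_
  obtain ⟨n, hn⟩ := exists_nat_one_div_lt he
  exact (hy n).trans (by linarith)

end Iteration

/-! ### The maximal inequality for truncated powers. -/

section MoserIteration

variable {d : ℕ} {a : Euc d → Matrix (Fin d) (Fin d) ℝ} {lam Lam : Euc d → ℝ}
  {x : Euc d} {r : ℝ} {u : ℝ → Euc d → ℝ} {ε α : ℝ}

/-- The truncated version of the maximal inequality. -/
lemma IsSupercaloric.ae_shiftPow_le {p q : ℝ≥0∞} (hpq : IsAdmissible d p q)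
    (h : IsIntegrableField a lam Lam) {τ s : ℝ} (hτ : 0 < τ) (hr : 0 < r)
    (hu : IsSupercaloric a Lam (cylTime τ s r 1) (Metric.ball x r) u)
    (hpos : ∀ t ∈ cylTime τ s r 1, ∀ᵐ y ∂(volume.restrict (Metric.ball x r)), 0 < u t y)
    {K : ℝ} (hK : 0 < K) (hS : ∀ v g, HasFormGradient a Lam (Metric.ball x r) v g →
      eLpNorm v (ENNReal.ofReal (2 / (2 - nu d p q))) (weighted Lam) ^ (2 : ℝ) ≤
        ENNReal.ofReal K * fieldEnergy a g)
    {Cη : ℝ} (hCη : ∀ (x : Euc d) (R' R : ℝ), 0 < R' → R' < R →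
      ∃ η, IsCutoff x R' R (Cη / (R - R')) η)
    {σ' σ : ℝ} (hσ' : 1 / 2 ≤ σ') (hσσ' : σ' < σ) (hσ : σ ≤ 1) (hε : 0 < ε) (hα : 0 < α)
    {T : ℝ} (hT : T ∈ cylTime τ s r σ') :
    ∀ᵐ y ∂(weighted Lam).restrict (Metric.ball x (σ' * r)), shiftPow ε α (u T y) ≤
      iterConst 4 K ((2 + 16 * Cη ^ 2) * ((1 + τ⁻¹) / (σ - σ') ^ 2) / r ^ 2) (nu d p q) *
        ∫ t in cylTime τ s r σ, slice Lam u x ε α (σ * r) t := by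
  set ν := nu d p q with hν
  have hν1 : 1 < ν := hpq.one_lt_nu
  have hν0 : 0 < ν := by linarith
  have hgap : 0 < σ - σ' := sub_pos.2 hσσ'
  set D := (2 + 16 * Cη ^ 2) * ((1 + τ⁻¹) / (σ - σ') ^ 2) / r ^ 2 with hD
  have hD0 : 0 < D := by positivity
  -- Radii halve their distance to `σ'`, so each step costs at most `4^k`, up to the fixed constant
  -- `D`.
  set δ : ℕ → ℝ := fun k => σ' + (σ - σ') / 2 ^ k with hδ
  set V : ℕ → ℝ := fun k => ∫ t in cylTime τ s r (δ k), slice Lam u x ε (α * ν ^ k) (δ k * r) t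
    with hV
  have hδ' : ∀ k, σ' < δ k := fun k => by
    have : 0 < (σ - σ') / 2 ^ k := by positivity
    simp only [hδ]; linarith
  have hδsub : ∀ k, δ k - δ (k + 1) = (σ - σ') / 2 ^ (k + 1) := fun k => by
    simp only [hδ]; rw [pow_succ]; field_simp; ring
  have hδlt : ∀ k, δ (k + 1) < δ k := fun k => by
    have : 0 < (σ - σ') / 2 ^ (k + 1) := by positivity
    linarith [hδsub k]
  have hδle : ∀ k, δ k ≤ 1 := fun k => by
    have : (σ - σ') / 2 ^ k ≤ σ - σ' := div_le_self hgap.le (one_le_pow₀ one_le_two)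
    simp only [hδ]; linarith
  have hV0 : ∀ k, 0 ≤ V k := fun k =>
    setIntegral_nonneg measurableSet_Ioo fun t _ => slice_nonneg hε _ _
  have hβ : ∀ k : ℕ, 0 < α * ν ^ k := fun k => by positivity
  have hconst : ∀ k, 1 / ((δ k - δ (k + 1)) * τ * r ^ 2) +
      4 * (Cη / (δ k * r - δ (k + 1) * r)) ^ 2 ≤ 4 ^ k * D := by
    intro k
    rw [← sub_mul, hδsub, hD]
    have h1 : 1 / ((σ - σ') / 2 ^ (k + 1) * τ * r ^ 2) ≤
        4 ^ k * (2 * (τ⁻¹ / (σ - σ') ^ 2) / r ^ 2) := by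
      have e1 : 1 / ((σ - σ') / 2 ^ (k + 1) * τ * r ^ 2) =
          2 ^ k * (2 * (τ⁻¹ / (σ - σ') ^ 2) / r ^ 2) * (σ - σ') := by
        rw [pow_succ]; field_simp
      rw [e1, mul_assoc, show (4 : ℝ) ^ k = 2 ^ k * 2 ^ k by rw [← mul_pow]; norm_num,
        mul_assoc ((2 : ℝ) ^ k)]
      have h2 : σ - σ' ≤ 2 ^ k := by
        have : (1 : ℝ) ≤ 2 ^ k := one_le_pow₀ one_le_two
        linarith
      rw [mul_comm ((2 : ℝ) ^ k) (2 * (τ⁻¹ / (σ - σ') ^ 2) / r ^ 2)]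
      gcongr
    have h2 : 4 * (Cη / ((σ - σ') / 2 ^ (k + 1) * r)) ^ 2 =
        4 ^ k * (16 * Cη ^ 2 * (1 / (σ - σ') ^ 2) / r ^ 2) := by
      rw [show (4 : ℝ) ^ k = 2 ^ k * 2 ^ k by rw [← mul_pow]; norm_num, pow_succ]
      field_simp
      ring
    rw [h2]
    refine (add_le_add_left h1 _).trans ?_
    rw [← mul_add]
    refine mul_le_mul_of_nonneg_left ?_ (by positivity)
    rw [← add_div]
    refine div_le_div_of_nonneg_right ?_ (by positivity)
    have h3 : 0 ≤ Cη ^ 2 * (τ⁻¹ / (σ - σ') ^ 2) := by positivity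
    have h4 : 0 ≤ 1 / (σ - σ') ^ 2 := by positivity
    rw [add_div]
    nlinarith
  have hstep : ∀ k, (∀ T ∈ cylTime τ s r (δ (k + 1)),
      slice Lam u x ε (α * ν ^ k) (δ (k + 1) * r) T ≤ 4 ^ k * D * V k) ∧
      V (k + 1) ≤ K * (4 ^ k * D * V k) ^ ν := by
    intro k
    have hk0 : 0 < δ (k + 1) := by linarith [hδ' (k + 1)]
    obtain ⟨η, hη⟩ := hCη x (δ (k + 1) * r) (δ k * r) (by positivity)
      (mul_lt_mul_of_pos_right (hδlt k) hr)
    have h1 := hu.moser_step hpq h hτ hr hpos hK hS hk0 (hδlt k) (hδle k) hε (hβ k) hη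
      (mul_le_mul_of_nonneg_right (hconst k) (hV0 k))
    refine ⟨h1.1, ?_⟩
    have h2 := h1.2
    rwa [show nu d p q * (α * ν ^ k) = α * ν ^ (k + 1) by rw [pow_succ, ← hν]; ring] at h2
  have hiter := le_of_iteration (b := 4) (by norm_num) hK hD0 hν1 hV0 fun k => (hstep k).2
  have hV00 : V 0 = ∫ t in cylTime τ s r σ, slice Lam u x ε α (σ * r) t := by
    simp [hV, hδ]
  rw [← hV00]
  set l := iterConst 4 K D ν with hl
  have hl0 : 0 < l := iterConst_pos (by norm_num) hK hD0
  have := h.isFiniteMeasure_restrict x (σ' * r)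
  -- The fixed time `T` lies in every cylinder of the sequence, so the mass bounds of all steps
  -- apply to the same slice.
  have hTk : ∀ k, T ∈ cylTime τ s r (δ k) := fun k =>
    Ioo_subset_Ioo_left (by
      have : σ' * (τ * r ^ 2) ≤ δ k * (τ * r ^ 2) :=
        mul_le_mul_of_nonneg_right (hδ' k).le (by positivity)
      linarith) hT
  have hT1 : T ∈ cylTime τ s r 1 := Ioo_subset_Ioo_left (by
      have : δ 0 * (τ * r ^ 2) ≤ 1 * (τ * r ^ 2) :=
        mul_le_mul_of_nonneg_right (hδle 0) (by positivity)
      linarith) (hTk 0)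
  have hum := hu.aestronglyMeasurable hT1
  refine ae_le_of_integral_rpow_le (fun y => (shiftPow_pos hε).le) hν1 (M := D / l)
    (mul_nonneg hl0.le (hV0 0)) (fun k => ?_) fun k => ?_
  · simp only [shiftPow_rpow hε]
    exact h.integrableOn_shiftPow hum hε (hβ k) _
  · simp only [shiftPow_rpow hε]
    have h1 : ∫ y in Metric.ball x (σ' * r), shiftPow ε (α * ν ^ k) (u T y) ∂(weighted Lam) ≤
        slice Lam u x ε (α * ν ^ k) (δ (k + 1) * r) T :=
      setIntegral_mono_set (h.integrableOn_shiftPow hum hε (hβ k) _)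
        (Eventually.of_forall fun y => (shiftPow_pos hε).le)
        (Metric.ball_subset_ball (mul_le_mul_of_nonneg_right (hδ' _).le hr.le)).eventuallyLE
    refine h1.trans (((hstep k).1 T (hTk _)).trans ?_)
    -- The geometric factor of the mass bound is absorbed by the larger weight carried in
    -- `le_of_iteration`, since `ν/(ν-1) ≥ 1`.
    have h2 : (4 : ℝ) ^ k ≤ ((4 : ℝ) ^ (ν / (ν - 1))) ^ k := by
      refine pow_le_pow_left₀ (by norm_num) ?_ k
      refine Real.self_le_rpow_of_one_le (by norm_num) ?_
      rw [one_le_div (sub_pos.2 hν1)]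
      linarith
    calc 4 ^ k * D * V k = D / l * (l * 4 ^ k * V k) := by field_simp
      _ ≤ D / l * (l * ((4 : ℝ) ^ (ν / (ν - 1))) ^ k * V k) := by
          have := hV0 k
          gcongr
      _ ≤ D / l * (l * V 0) ^ (ν ^ k) :=
          mul_le_mul_of_nonneg_left (hiter k) (by positivity)

end MoserIteration

/-! ### Scaling of the constants. -/

section Constants

variable {d : ℕ} {a : Euc d → Matrix (Fin d) (Fin d) ℝ} {lam Lam : Euc d → ℝ} {p q : ℝ≥0∞}

/-- Used with `b` the volume of the ball, `w * ρ = b^(2/d)`, `ρ = r²` and `s` the Sobolev constant.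
The outer power `1/(ν-1)` turns `(b ρ)^(1-ν)` into `(b ρ)⁻¹`, precisely the normalization of the
averaged norm up to the factor `τ`. -/
lemma iterConst_eq {ν c C b w ρ s e M : ℝ} (hν : 1 < ν) (hc : 0 < c) (hC : 0 < C) (hb : 0 < b)
    (hw : 0 < w) (hρ : 0 < ρ) (hs : 0 < s) (he : 0 < e) (hM : 0 < M) :
    iterConst c (C * (b ^ (1 - ν) * (w * ρ) * s)) (e * M / ρ) ν =
      (c ^ (ν / (ν - 1)) * C * w * e ^ ν) ^ (1 / (ν - 1)) * s ^ (1 / (ν - 1)) *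
        M ^ (ν / (ν - 1)) * (b⁻¹ * ρ⁻¹) := by
  have hν1 : 0 < ν - 1 := sub_pos.2 hν
  have h1 : M ^ (ν / (ν - 1)) = (M ^ ν) ^ (1 / (ν - 1)) := by
    rw [← Real.rpow_mul hM.le, mul_one_div]
  have h2 : b⁻¹ * ρ⁻¹ = ((b * ρ) ^ (1 - ν)) ^ (1 / (ν - 1)) := by
    rw [← Real.rpow_mul (by positivity), ← mul_inv, ← Real.rpow_neg_one]
    congr 1
    field_simp
    ring
  rw [h1, h2, ← Real.mul_rpow (by positivity) hs.le, ← Real.mul_rpow (by positivity) (by positivity),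
    ← Real.mul_rpow (by positivity) (by positivity), iterConst]
  congr 1
  rw [Real.div_rpow (by positivity) hρ.le, Real.mul_rpow he.le hM.le, Real.mul_rpow hb.le hρ.le,
    Real.rpow_sub hρ, Real.rpow_one]
  ring

lemma volume_ball_rpow (hd : 0 < d) (x : Euc d) {r : ℝ} (hr : 0 < r) :
    (volume (Metric.ball x r)).toReal ^ (2 / d : ℝ) =
      (volume (Metric.ball (0 : Euc d) 1)).toReal ^ (2 / d : ℝ) * r ^ 2 := by
  have hd' : (d : ℝ) ≠ 0 := by exact_mod_cast hd.ne'
  rw [Measure.addHaar_ball_of_pos _ _ hr, finrank_euclideanSpace_fin, ENNReal.toReal_mul,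
    ENNReal.toReal_ofReal (by positivity),
    Real.mul_rpow (by positivity) ENNReal.toReal_nonneg, mul_comm, ← Real.rpow_natCast r d,
    ← Real.rpow_mul hr.le, mul_div_cancel₀ _ hd', Real.rpow_two]

lemma volume_ball_toReal_pos (x : Euc d) {r : ℝ} (hr : 0 < r) :
    0 < (volume (Metric.ball x r)).toReal :=
  ENNReal.toReal_pos (Metric.measure_ball_pos volume x hr).ne' measure_ball_lt_top.ne

lemma ballAvg_ne_zero (x : Euc d) {r : ℝ} (hr : 0 < r) : ballAvg x r ≠ 0 := by
  intro h0
  have h1 : (volume (Metric.ball x r))⁻¹ * volume (Metric.ball x r) = 0 := by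
    have := congrArg (fun m : Measure (Euc d) => m univ) h0
    simpa [ballAvg] using this
  rw [ENNReal.inv_mul_cancel (Metric.measure_ball_pos volume x hr).ne' measure_ball_lt_top.ne] at h1
  exact one_ne_zero h1

lemma ae_ballAvg_of_ae {P : Euc d → Prop} (x : Euc d) (r : ℝ) (h : ∀ᵐ y, P y) :
    ∀ᵐ y ∂ballAvg x r, P y :=
  Measure.ae_smul_measure (ae_restrict_of_ae h) _

/-- `1/λ` never vanishes, `λ` being finite, and `Λ > 0` almost everywhere. Positivity makes the
Sobolev factor `K` admissible as a divisor. -/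
lemma sobolevConst_pos (hpq : IsAdmissible d p q) (h : IsIntegrableField a lam Lam)
    (x : Euc d) {r : ℝ} (hr : 0 < r) (hfin : eLpNorm Lam p (ballAvg x r) ≠ ∞) :
    0 < sobolevConst p q lam Lam x r := by
  have hp0 : p ≠ 0 := (zero_lt_one.trans_le hpq.one_le_p).ne'
  have hq0 : q ≠ 0 := (zero_lt_one.trans_le hpq.one_le_q).ne'
  have : (ae (ballAvg x r)).NeBot := ae_neBot.2 (ballAvg_ne_zero x hr)
  have h1 : eLpNorm (recip lam) q (ballAvg x r) ≠ 0 := by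
    rw [Ne, eLpNorm_eq_zero_iff h.measurable_recip.aestronglyMeasurable hq0]
    intro h0
    obtain ⟨y, hy⟩ := h0.exists
    simp [recip] at hy
  have h2 : eLpNorm Lam p (ballAvg x r) ≠ 0 := by
    rw [Ne, eLpNorm_eq_zero_iff h.measurable_Lam.aestronglyMeasurable hp0]
    intro h0
    obtain ⟨y, hy, hy'⟩ := (h0.and (ae_ballAvg_of_ae x r h.Lam_pos)).exists
    exact hy'.ne' hy
  exact ENNReal.mul_pos h1 (ENNReal.rpow_pos (pos_iff_ne_zero.2 h2) hfin).ne'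

/-- The Sobolev constant in terms of averaged norms. -/
lemma eLpNorm_mul_eq_sobolevConst (hpq : IsAdmissible d p q) (x : Euc d) {r : ℝ} (hr : 0 < r) :
    eLpNorm (recip lam) q (volume.restrict (Metric.ball x r)) *
      eLpNorm Lam p (volume.restrict (Metric.ball x r)) ^ (2 - nu d p q) =
    volume (Metric.ball x r) ^ (1 - nu d p q + 2 / d) * sobolevConst p q lam Lam x r := by
  have h0 : volume (Metric.ball x r) ≠ 0 := (Metric.measure_ball_pos volume x hr).ne'
  have ht : volume (Metric.ball x r) ≠ ∞ := measure_ball_lt_top.ne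
  have hν := (sub_pos.2 hpq.nu_lt_two).le
  rw [eLpNorm_restrict_ball _ _ _ hr, eLpNorm_restrict_ball _ _ _ hr,
    ENNReal.mul_rpow_of_nonneg _ _ hν, ← ENNReal.rpow_mul, sobolevConst, ← IsAdmissible.two_sub_nu,
    ← hpq.volume_exponent, ENNReal.rpow_add _ _ h0 ht]
  simp only [one_div]
  ring

end Constants

/-! ### Comparison with the averaged space-time norm. -/

section Conclusion

variable {d : ℕ} {a : Euc d → Matrix (Fin d) (Fin d) ℝ} {lam Lam : Euc d → ℝ} {p q : ℝ≥0∞}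
  {x : Euc d} {r : ℝ} {u : ℝ → Euc d → ℝ} {ε α : ℝ}

lemma ofReal_slice_le (h : IsIntegrableField a lam Lam) {t R : ℝ}
    (hu : AEStronglyMeasurable (u t) (weighted Lam)) (hR : R ≤ r)
    (hpos : ∀ᵐ y ∂(volume.restrict (Metric.ball x r)), 0 < u t y) (hε : 0 < ε) (hα : 0 < α) :
    ENNReal.ofReal (slice Lam u x ε α R t) ≤
      ∫⁻ y in Metric.ball x R, ‖(u t y)⁻¹‖ₑ ^ α * ENNReal.ofReal (Lam y) := by
  rw [slice, ofReal_integral_eq_lintegral_ofReal (h.integrableOn_shiftPow hu hε hα R)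
    (Eventually.of_forall fun y => (shiftPow_pos hε).le),
    ← h.setLIntegral_weighted _ measurableSet_ball]
  refine lintegral_mono_ae ?_
  rw [h.ae_weighted_restrict_iff]
  filter_upwards [ae_restrict_of_ae_restrict_of_subset (Metric.ball_subset_ball hR) hpos] with y hy
  rw [Real.enorm_eq_ofReal (by positivity), ENNReal.ofReal_rpow_of_nonneg (by positivity) hα.le,
    shiftPow_of_nonneg hε hy.le, Real.inv_rpow hy.le, ← Real.rpow_neg hy.le]
  exact ENNReal.ofReal_le_ofReal
    (Real.rpow_le_rpow_of_nonpos hy (by linarith) (by linarith))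

/-- Follows from `(u + ε)^(-α) ≤ u^(-α)`, slice by slice. The bound is uniform in `ε`, and its right
side may be infinite. -/
lemma ofReal_integral_slice_le (h : IsIntegrableField a lam Lam) {τ s σ : ℝ} (hτ : 0 < τ)
    (hr : 0 < r) (hσ : σ ≤ 1)
    (hu : IsSupercaloric a Lam (cylTime τ s r 1) (Metric.ball x r) u)
    (hpos : ∀ t ∈ cylTime τ s r 1, ∀ᵐ y ∂(volume.restrict (Metric.ball x r)), 0 < u t y)
    (hε : 0 < ε) (hα : 0 < α) :
    ENNReal.ofReal (∫ t in cylTime τ s r σ, slice Lam u x ε α (σ * r) t) ≤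
      ∫⁻ t in cylTime τ s r σ, ∫⁻ y in Metric.ball x (σ * r),
        ‖(u t y)⁻¹‖ₑ ^ α * ENNReal.ofReal (Lam y) := by
  have hsub : cylTime τ s r σ ⊆ cylTime τ s r 1 := Ioo_subset_Ioo_left (by
    have : σ * (τ * r ^ 2) ≤ 1 * (τ * r ^ 2) := mul_le_mul_of_nonneg_right hσ (by positivity)
    linarith)
  have hσr : σ * r ≤ r := by nlinarith
  have hI : IsOpen (cylTime τ s r 1) := isOpen_Ioo
  rw [ofReal_integral_eq_lintegral_ofReal ((hu.integrableOn_slice h hI (by simp [cylTime]) hε hα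
    hσr).mono_set hsub) (Eventually.of_forall fun t => slice_nonneg hε _ _)]
  refine setLIntegral_mono' measurableSet_Ioo fun t ht => ?_
  exact ofReal_slice_le h (hu.aestronglyMeasurable (hsub ht)) hσr (hpos t (hsub ht)) hε hα

/-- The time interval has length `σ τ r² ≤ τ r²`, whence the factor `τ`, and the smaller ball has
the smaller volume. -/
lemma le_spaceTimeNorm_rpow {τ s σ : ℝ} (hτ : 0 < τ) (hr : 0 < r) (hσ0 : 0 < σ) (hσ : σ ≤ 1)
    (hα : 0 < α) (f : ℝ → Euc d → ℝ) :
    ENNReal.ofReal ((volume (Metric.ball x r)).toReal⁻¹ * (r ^ 2)⁻¹) *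
      (∫⁻ t in cylTime τ s r σ, ∫⁻ y in Metric.ball x (σ * r),
        ‖f t y‖ₑ ^ α * ENNReal.ofReal (Lam y)) ≤
      ENNReal.ofReal τ *
        spaceTimeNorm α (cylTime τ s r σ) (Metric.ball x (σ * r)) Lam f ^ α := by
  have hσr : σ * r ≤ r := by nlinarith
  rw [spaceTimeNorm, ← ENNReal.rpow_mul, one_div, inv_mul_cancel₀ hα.ne', ENNReal.rpow_one,
    ← mul_assoc]
  gcongr
  have h1 : volume (cylTime τ s r σ) = ENNReal.ofReal (σ * τ * r ^ 2) := by
    rw [cylTime, Real.volume_Ioo]; congr 1; ring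
  rw [h1, ENNReal.ofReal_mul (by positivity),
    ENNReal.ofReal_inv_of_pos (volume_ball_toReal_pos x hr),
    ENNReal.ofReal_toReal measure_ball_lt_top.ne, mul_comm, ← mul_assoc]
  refine mul_le_mul' ?_ (ENNReal.inv_le_inv.2 (measure_mono (Metric.ball_subset_ball hσr)))
  rw [← ENNReal.ofReal_inv_of_pos (by positivity), ← ENNReal.ofReal_mul hτ.le]
  refine ENNReal.ofReal_le_ofReal ?_
  rw [mul_inv, mul_inv, ← mul_assoc, mul_comm σ⁻¹, ← mul_assoc, mul_inv_cancel₀ hτ.ne', one_mul]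
  exact le_mul_of_one_le_left (by positivity) ((one_le_inv₀ hσ0).2 hσ)

end Conclusion

end DegenerateParabolic

end

theorem mainTheorem7 (d : ℕ) (hd : 2 ≤ d) (p q : ENNReal) (hp : 1 ≤ p) (hq : 1 ≤ q)
    (hpq : p⁻¹ + q⁻¹ < 2 / (d : ENNReal)) (hdq : ¬ (d = 2 ∧ q = ⊤)) :
    ∃ C₄ : ℝ, 0 < C₄ ∧
      ∀ (a : EuclideanSpace ℝ (Fin d) → Matrix (Fin d) (Fin d) ℝ)
        (lam Lam : EuclideanSpace ℝ (Fin d) → ℝ),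
        DegenerateParabolic.IsEllipticField a lam Lam →
        DegenerateParabolic.MomentCondition p q lam Lam →
      ∀ (τ : ℝ), 0 < τ → ∀ (σ' σ : ℝ), 1 / 2 ≤ σ' → σ' < σ → σ ≤ 1 →
      ∀ (x : EuclideanSpace ℝ (Fin d)) (s r : ℝ), 0 < r →
      ∀ u : ℝ → EuclideanSpace ℝ (Fin d) → ℝ,
        DegenerateParabolic.IsSupercaloric a Lam
          (DegenerateParabolic.cylTime τ s r 1) (Metric.ball x r) u →
        (∀ t ∈ DegenerateParabolic.cylTime τ s r 1,
          ∀ᵐ y ∂(MeasureTheory.volume.restrict (Metric.ball x r)), 0 < u t y) →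
      ∀ α : ℝ, 0 < α →
        DegenerateParabolic.spaceTimeSup (DegenerateParabolic.cylTime τ s r σ')
            (Metric.ball x (σ' * r)) (fun t y => (u t y) ^ (-α)) ≤
          ENNReal.ofReal C₄ *
            DegenerateParabolic.sobolevConst p q lam Lam x r
              ^ (1 / (DegenerateParabolic.nu d p q - 1)) *
            ENNReal.ofReal (τ * ((1 + τ⁻¹) / (σ - σ') ^ 2)
              ^ (DegenerateParabolic.nu d p q / (DegenerateParabolic.nu d p q - 1))) *
            DegenerateParabolic.spaceTimeNorm α (DegenerateParabolic.cylTime τ s r σ)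
              (Metric.ball x (σ * r)) Lam (fun t y => (u t y)⁻¹) ^ α := by
  open DegenerateParabolic in
  have hadm : IsAdmissible d p q := ⟨hd, hp, hq, hpq, hdq⟩
  obtain ⟨CS, hCS⟩ := exists_sobolev hadm
  obtain ⟨Cη, hCη0, hCη⟩ := exists_cutoff
  set ν := nu d p q with hν
  have hν1 : 1 < ν := hadm.one_lt_nu
  set w : ℝ := (volume (Metric.ball (0 : Euc d) 1)).toReal ^ (2 / d : ℝ) with hw
  have hw0 : 0 < w := Real.rpow_pos_of_pos (volume_ball_toReal_pos 0 one_pos) _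
  have hCS0 : (0 : ℝ) < CS + 1 := by positivity
  have he0 : 0 < 2 + 16 * Cη ^ 2 := by positivity
  set C₄ : ℝ := ((4 : ℝ) ^ (ν / (ν - 1)) * (CS + 1) * w * (2 + 16 * Cη ^ 2) ^ ν) ^ (1 / (ν - 1))
    with hC₄
  refine ⟨C₄, by positivity, ?_⟩
  intro a lam Lam ha hmom τ hτ σ' σ hσ' hσσ' hσ x s r hr u hu hpos α hα
  have h : IsIntegrableField a lam Lam :=
    hmom.isIntegrableField (zero_lt_two.trans_le hd) hp hq ha
  obtain ⟨hLam, hlam⟩ := hmom.eLpNorm_lt_top x r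
  have hvt : volume (Metric.ball x r) ≠ ∞ := measure_ball_lt_top.ne
  have hb0 := volume_ball_toReal_pos x hr
  set b := (volume (Metric.ball x r)).toReal with hb
  have hvinv : ∀ e : ℝ, 0 ≤ e → (volume (Metric.ball x r))⁻¹ ^ e ≠ ∞ := fun e he =>
    (ENNReal.rpow_lt_top_of_nonneg he (ENNReal.inv_ne_top.2
      (Metric.measure_ball_pos volume x hr).ne')).ne
  have hLam' : eLpNorm Lam p (ballAvg x r) ≠ ∞ := by
    rw [eLpNorm_ballAvg]
    exact ENNReal.mul_ne_top (hvinv _ ENNReal.toReal_nonneg) hLam.ne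
  have hlam' : eLpNorm (recip lam) q (ballAvg x r) ≠ ∞ := by
    rw [eLpNorm_ballAvg]
    exact ENNReal.mul_ne_top (hvinv _ ENNReal.toReal_nonneg) hlam.ne
  have hct : sobolevConst p q lam Lam x r ≠ ∞ := by
    refine ENNReal.mul_ne_top hlam' (ENNReal.rpow_lt_top_of_nonneg ?_ hLam').ne
    rw [← IsAdmissible.two_sub_nu]
    exact (sub_pos.2 hadm.nu_lt_two).le
  have hc0 : 0 < (sobolevConst p q lam Lam x r).toReal :=
    ENNReal.toReal_pos (sobolevConst_pos hadm h x hr hLam').ne' hct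
  set c := (sobolevConst p q lam Lam x r).toReal with hc
  -- The Sobolev constant of `B(x, r)` in averaged form, with `w r²` standing for the volume to the
  -- power `2/d`. The shift `CS + 1` ensures `K > 0`.
  set K : ℝ := (CS + 1) * (b ^ (1 - ν) * (w * r ^ 2) * c) with hK
  have hK0 : 0 < K := by positivity
  have hS : ∀ v g, HasFormGradient a Lam (Metric.ball x r) v g →
      eLpNorm v (ENNReal.ofReal (2 / (2 - ν))) (weighted Lam) ^ (2 : ℝ) ≤
        ENNReal.ofReal K * fieldEnergy a g := by
    intro v g hv
    refine (hCS a lam Lam h x r v g hv hlam.ne hLam.ne).trans ?_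
    rw [eLpNorm_mul_eq_sobolevConst hadm x hr]
    gcongr
    rw [hK, ENNReal.ofReal_mul hCS0.le, ENNReal.ofReal_mul (by positivity), hc,
      ENNReal.ofReal_toReal hct]
    gcongr
    · rw [← ENNReal.ofReal_coe_nnreal]
      exact ENNReal.ofReal_le_ofReal (by linarith)
    · rw [hw, ← volume_ball_rpow (zero_lt_two.trans_le hd) x hr, ← hb, ← Real.rpow_add hb0, hb,
        ← ENNReal.ofReal_rpow_of_pos hb0, ENNReal.ofReal_toReal hvt]
  have hM0 : 0 < (1 + τ⁻¹) / (σ - σ') ^ 2 := by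
    have := sub_pos.2 hσσ'
    positivity
  set M := (1 + τ⁻¹) / (σ - σ') ^ 2 with hM
  set RHS := ENNReal.ofReal C₄ * sobolevConst p q lam Lam x r ^ (1 / (ν - 1)) *
    ENNReal.ofReal (τ * M ^ (ν / (ν - 1))) *
    spaceTimeNorm α (cylTime τ s r σ) (Metric.ball x (σ * r)) Lam (fun t y => (u t y)⁻¹) ^ α
    with hRHS
  have htrunc : ∀ ε > 0, ENNReal.ofReal (iterConst 4 K ((2 + 16 * Cη ^ 2) * M / r ^ 2) ν *
      ∫ t in cylTime τ s r σ, slice Lam u x ε α (σ * r) t) ≤ RHS := by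
    intro ε hε
    rw [hK, iterConst_eq hν1 (by norm_num) hCS0 hb0 hw0 (by positivity) hc0 he0 hM0, ← hC₄,
      ENNReal.ofReal_mul (by positivity), ENNReal.ofReal_mul (by positivity), mul_assoc]
    have h1 := (mul_le_mul_right (ofReal_integral_slice_le h hτ hr hσ hu hpos hε hα)
      (ENNReal.ofReal (b⁻¹ * (r ^ 2)⁻¹))).trans (le_spaceTimeNorm_rpow (Lam := Lam) (x := x)
      (s := s) hτ hr (by linarith) hσ hα fun t y => (u t y)⁻¹)
    refine (mul_le_mul_right h1 _).trans (le_of_eq ?_)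
    rw [hRHS, ENNReal.ofReal_mul (by positivity), ENNReal.ofReal_mul (by positivity),
      ENNReal.ofReal_mul (by positivity), ← ENNReal.ofReal_rpow_of_pos hc0, hc,
      ENNReal.ofReal_toReal hct]
    ring
  refine iSup₂_le fun T hT => essSup_le_of_ae_le _ ?_
  have hT1 : T ∈ cylTime τ s r 1 := Ioo_subset_Ioo_left (by
    have : σ' * (τ * r ^ 2) ≤ 1 * (τ * r ^ 2) :=
      mul_le_mul_of_nonneg_right (by linarith) (by positivity)
    linarith) hT
  -- Countably many values of `ε` suffice, so the exceptional null sets can be united at the fixed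
  -- time `T`.
  have hall : ∀ n : ℕ, ∀ᵐ y ∂volume.restrict (Metric.ball x (σ' * r)),
      ENNReal.ofReal (shiftPow (1 / ((n : ℝ) + 1)) α (u T y)) ≤ RHS := by
    intro n
    have hn : (0 : ℝ) < 1 / ((n : ℝ) + 1) := by positivity
    have h1 := hu.ae_shiftPow_le hadm h hτ hr hpos hK0 hS (hCη d) hσ' hσσ' hσ hn hα hT
    rw [h.ae_weighted_restrict_iff] at h1
    filter_upwards [h1] with y hy
    exact (ENNReal.ofReal_le_ofReal hy).trans (htrunc _ hn)
  have hσ'r : σ' * r ≤ r := by nlinarith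
  filter_upwards [ae_all_iff.2 hall, ae_restrict_of_ae_restrict_of_subset
    (Metric.ball_subset_ball hσ'r) (hpos T hT1)] with y hy hy0
  -- Positivity of `u T y` makes the negative power continuous there, so the bounds uniform in `ε`
  -- pass to `ε = 0`.
  have hlim : Tendsto (fun n : ℕ => ENNReal.ofReal ((u T y + 1 / ((n : ℝ) + 1)) ^ (-α))) atTop
      (𝓝 (ENNReal.ofReal ((u T y + 0) ^ (-α)))) :=
    (ENNReal.continuous_ofReal.tendsto _).comp
      ((tendsto_const_nhds.add tendsto_one_div_add_atTop_nhds_zero_nat).rpow_const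
        (Or.inl (by simpa using hy0.ne')))
  rw [add_zero] at hlim
  refine le_of_tendsto' hlim fun n => ?_
  rw [← shiftPow_of_nonneg (by positivity) hy0.le]
  exact hy n
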